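/- **Setting.** Let $\mathcal X$ be a Polish space, $\mathcal Y$ a separable Hilbert space, and $\rho$ a Borel probability measure on $\mathcal X\times\mathcal Y$ whose marginal $\rho_{\mathcal X}$ on $\mathcal X$ has full support. Let $K:\mathcal X\times\mathcal X\to\mathcal B(\mathcal Y)$ be an operator-valued positive semidefinite kernel with reproducing kernel Hilbert space $\mathcal H_K$ (norm $\|\cdot\|_K$), such that all members of $\mathcal H_K$ are continuous and $\sup_x\|K(x,x)\|\le\kappa^2$. Let $(L_Kf)(x)=\int_{\mathcal X}K(x,t)f(t)\,d\rho_{\mathcal X}(t)$ on $L^2(\mathcal X,\rho_{\mathcal X};\mathcal Y)$, a bounded positive operator; $L_K^0$ denotes the orthogonal projection onto $(\ker L_K)^\perp$. Let $h^\dagger(x)=\int_{\mathcal Y}y\,d\rho(y|x)$ and $\mathcal E(h)=\int\|h(x)-y\|^2\,d\rho(x,y)$. For an i.i.d. sample $z^T=((x_t,y_t))_{t=1}^T$ from $\rho$ and step sizes $\eta_t>0$ let $h_1=0$ and $h_{t+1}=h_t-\eta_tK(\cdot,x_t)(h_t(x_t)-y_t)$. **Assumptions.** (i) For some $\sigma^2>0$: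 $\int\|y-h^\dagger(x)\|^2d\rho(y|x)\le\sigma^2$ for $\rho_{\mathcal X}$-almost every $x$. (ii) $h^\dagger=L_K^rg^\dagger$ for some $r>\frac12$ and $g^\dagger\in L^2(\mathcal X,\rho_{\mathcal X};\mathcal Y)$. (iii) $\operatorname{Tr}(L_K^s)<\infty$ for some $0\le s\le1$. **Thresholds.** For $v>0$ and $0<\theta<1$ let $\delta(v,\theta)$ be the least $\delta\ge0$ such that, for all $T\ge2$ and $\eta_1>0$, with $\eta_t=\eta_1t^{-\theta}$, $$\sum_{t=1}^{T-1}\frac{\eta_t^2}{1+(\sum_{j=t+1}^T\eta_j)^v}\le\delta\,\frac{\eta_1^2}{\min\{1,(\eta_1/(1-\theta))^v\}}\,R_{v,\theta}(T),$$ where for $v<1$: $R_{v,\theta}(T)=(T+1)^{1-v-\theta(2-v)}$ if $\theta<\frac12$, $(T+1)^{-v/2}\log(T+1)$ if $\theta=\frac12$, $(T+1)^{-v(1-\theta)}$ if $\theta>\frac12$; for $v=1$: $(T+1)^{-\theta}\log(T+1)$ if $\theta\le\frac12$, $(T+1)^{-(1-\theta)}$ if $\theta>\frac12$; for $v>1$: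 $(T+1)^{-\min\{\theta,v(1-\theta)\}}$. Put $$\gamma_2=\begin{cases}\dfrac{1-s}{8\kappa^2\operatorname{Tr}(L_K^s)(1+\kappa^{2(1-s)})(\delta(1-s,\theta)+1)},&0\le s<1,\\[2ex]\dfrac{2\theta-1}{16\kappa^2\operatorname{Tr}(L_K^s)(1+\kappa^{2(1-s)})(\delta(1,\theta)+1)\theta},&s=1,\ \theta>\frac12,\\[1ex]+\infty,&s=1,\ \theta\le\frac12,\end{cases}\qquad\gamma_2'=\frac{s}{16\kappa^2\operatorname{Tr}(L_K^s)(1+\kappa^{2(1-s)})(s+1)}$$ (so that for $s=0$ no $\eta$ is admitted in part (2)), with $a/0=+\infty$ for $a>0$, and let $f_2(T)=\log(T+1)$ if $s=1$ and $1$ otherwise, $f_3(T)=\log(T+1)$ if $\theta=\frac12$ and $1$ otherwise. **Conclusion.** All the risks and expectations below are finite, $h^\dagger$ agrees $\rho_{\mathcal X}$-almost everywhere with a member of $\mathcal H_K$ (again written $h^\dagger$), and the following holds. (1) Let $0<\theta<1$. There is a constant $c_3$, independent of $T$ and $\eta_1$, such that for all $T\ge1$ and all $0<\eta_1<\min\{\|L_K\|^{-1},1-\theta,\gamma_2\}$,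 with the step sizes $\eta_t=\eta_1t^{-\theta}$ and $m=\min\{2r,2-s\}$, $$\mathbb E_{z^T}[\mathcal E(h_{T+1})-\mathcal E(h^\dagger)]\le c_3\eta_1^{-2r}\begin{cases}(T+1)^{-\theta}f_2(T),&0<\theta\le\frac{m}{1+m},\\(T+1)^{-m(1-\theta)},&\frac m{1+m}<\theta<1,\end{cases}$$ and, if $s<1$ and $\frac s{1+s}<\theta<1$, $$\mathbb E_{z^T}\|h_{T+1}-h^\dagger\|_K^2\le c_3\eta_1^{-(2r-1)}\begin{cases}(T+1)^{s-(1+s)\theta}f_3(T),&\frac s{1+s}<\theta\le\min\{\frac{2r+s-1}{2r+s},\frac12\},\\(T+1)^{-\min\{2r-1,1-s\}(1-\theta)},&\min\{\frac{2r+s-1}{2r+s},\frac12\}<\theta<1.\end{cases}$$ (2) Let $0<\theta'<1$. There is a constant $c_3'$, independent of $T$ and $\eta$, such that for all $T\ge1$ and all $0<\eta<\min\{\|L_K\|^{-1},1,\gamma_2'\}$, with the constant step sizes $\eta_t=\eta T^{-\theta'}$, $1\le t\le T$, $$\mathbb E_{z^T}[\mathcal E(h_{T+1})-\mathcal E(h^\dagger)]\le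 c_3'\eta^{-2r}\begin{cases}(T+1)^{-\theta'}f_2(T),&0<\theta'\le\frac{2r}{2r+1},\\(T+1)^{-2r(1-\theta')},&\frac{2r}{2r+1}<\theta'<1,\end{cases}$$ and, if $\frac s{1+s}<\theta'<1$, $$\mathbb E_{z^T}\|h_{T+1}-h^\dagger\|_K^2\le c_3'\eta^{-(2r-1)}\begin{cases}(T+1)^{s-(1+s)\theta'},&\frac s{1+s}<\theta'\le\frac{2r+s-1}{2r+s},\\(T+1)^{-(2r-1)(1-\theta')},&\frac{2r+s-1}{2r+s}<\theta'<1.\end{cases}$$ -/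

import Mathlib

open MeasureTheory ProbabilityTheory Filter Topology RKHS
open scoped ENNReal InnerProductSpace

namespace OpLearn

/-! ### Powers and traces of positive operators -/

section Operators

variable {𝕜 E : Type*} [RCLike 𝕜] [NormedAddCommGroup E] [InnerProductSpace 𝕜 E] [CompleteSpace E]

/-- `B = A ^ r` in the continuous functional calculus of the bounded positive operator `A`, for
`0 < r`: the spectrum of `A` lies in `[0, ‖A‖]`, and `B` is the norm limit of `p n (A)` for some
real polynomials `p n` that converge to `x ↦ x ^ r` uniformly on `[0, ‖A‖]`. -/
def IsOpPow (A : E →L[𝕜] E) (r : ℝ) (B : E →L[𝕜] E) : Prop :=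
  ∃ p : ℕ → Polynomial ℝ,
    TendstoUniformlyOn (fun n x => (p n).eval x) (fun x => x ^ r) atTop (Set.Icc 0 ‖A‖) ∧
    Tendsto (fun n => Polynomial.aeval A ((p n).map (algebraMap ℝ 𝕜))) atTop (𝓝 B)

open Classical in
/-- The power `A ^ r` (`0 ≤ r`) of a bounded positive operator `A`; the power `A ^ 0` is the
orthogonal projection onto `(ker A)ᗮ`, the limit of `A ^ r` as `r` decreases to `0`. -/
noncomputable def opPow (A : E →L[𝕜] E) (r : ℝ) : E →L[𝕜] E :=
  if r = 0 then (LinearMap.ker A.toLinearMap)ᗮ.starProjection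
  else if h : ∃ B, IsOpPow A r B then h.choose else 0

/-- The trace `∑ₑ ⟪A e, e⟫ ∈ [0, ∞]` of a positive operator, along an orthonormal (Hilbert) basis;
for positive `A` it does not depend on the basis. -/
noncomputable def opTrace (A : E →L[𝕜] E) : ℝ≥0∞ :=
  ∑' e : (exists_hilbertBasis 𝕜 E).choose, ENNReal.ofReal (RCLike.re ⟪A (e : E), (e : E)⟫_𝕜)

end Operators

/-- A weakly measurable map into a separable Hilbert space is strongly measurable. -/
theorem stronglyMeasurable_of_inner {𝕜 X Y : Type*} [RCLike 𝕜] [NormedAddCommGroup Y]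
    [InnerProductSpace 𝕜 Y] [SecondCountableTopology Y] [MeasurableSpace X] {φ : X → Y} (hφ : ∀ v : Y, Measurable fun x => ⟪v, φ x⟫_𝕜) :
    StronglyMeasurable φ := by
  borelize Y
  have hnorm : ∀ c : Y, Measurable fun x => ‖φ x - c‖ := by
    intro c
    refine measurable_of_Iic fun r => ?_
    obtain hr | hr := lt_or_ge r 0
    · convert MeasurableSet.empty
      ext x
      simp only [Set.mem_preimage, Set.mem_Iic, Set.mem_empty_iff_false, iff_false, not_le]
      exact hr.trans_le (norm_nonneg _)
    have : (fun x => ‖φ x - c‖) ⁻¹' Set.Iic r =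
        ⋂ n, {x | ‖⟪TopologicalSpace.denseSeq Y n, φ x⟫_𝕜 -
          ⟪TopologicalSpace.denseSeq Y n, c⟫_𝕜‖ ≤ r * ‖TopologicalSpace.denseSeq Y n‖} := by
      ext x
      simp only [Set.mem_preimage, Set.mem_Iic, Set.mem_iInter, Set.mem_ofPred_eq, ← inner_sub_right]
      constructor
      · intro h n
        refine (norm_inner_le_norm _ _).trans ?_
        rw [mul_comm]
        gcongr
      · intro h
        have key : ∀ v : Y, ‖⟪v, φ x - c⟫_𝕜‖ ≤ r * ‖v‖ := by
          intro v
          refine (TopologicalSpace.denseRange_denseSeq Y).induction_on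
            (p := fun v => ‖⟪v, φ x - c⟫_𝕜‖ ≤ r * ‖v‖) v ?_ h
          exact isClosed_le (by fun_prop) (by fun_prop)
        have h2 := key (φ x - c)
        rw [← inner_self_re_eq_norm, inner_self_eq_norm_mul_norm] at h2
        by_contra hlt
        push Not at hlt
        nlinarith
    rw [this]
    refine MeasurableSet.iInter fun n => ?_
    exact measurableSet_le ((hφ _).sub_const _).norm measurable_const
  refine Measurable.stronglyMeasurable (measurable_of_isOpen fun U hU => ?_)
  choose! r hr hrU using Metric.isOpen_iff.1 hU
  obtain ⟨T, hTU, hTc, hT⟩ := TopologicalSpace.isOpen_biUnion_countable U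
    (fun y => Metric.ball y (r y)) fun _ _ => Metric.isOpen_ball
  have hUT : U = ⋃ y ∈ T, Metric.ball y (r y) := by
    rw [hT]
    refine Set.Subset.antisymm (fun y hy => ?_) (Set.iUnion₂_subset fun y hy => hrU y hy)
    exact Set.mem_biUnion hy (Metric.mem_ball_self (hr y hy))
  rw [hUT, Set.preimage_iUnion₂]
  refine MeasurableSet.biUnion hTc fun y _ => ?_
  have : φ ⁻¹' Metric.ball y (r y) = {x | ‖φ x - y‖ < r y} := by
    ext x
    simp [dist_eq_norm]
  rw [this]
  exact measurableSet_lt (hnorm y) measurable_const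

/-! ### Mercer kernels, the embedding into `L²`, and the integral operator -/

section Kernels

variable {𝕜 : Type*} [RCLike 𝕜] {X Y : Type*}
  [NormedAddCommGroup Y] [InnerProductSpace 𝕜 Y] [CompleteSpace Y]

/-- The reproducing kernel of the reproducing kernel Hilbert space `H` of functions `X → Y` is
Mercer (all members of `H` are continuous) and satisfies `‖K x x‖ ≤ κ ^ 2` for all `x`. -/
structure IsBoundedMercer (H : Type*) [NormedAddCommGroup H] [InnerProductSpace 𝕜 H]
    [CompleteSpace H] [TopologicalSpace X] [RKHS 𝕜 H X Y] (κ : ℝ) : Prop where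
  continuous : ∀ h : H, Continuous (h : X → Y)
  norm_kernel_le : ∀ x : X, ‖kernel H x x‖ ≤ κ ^ 2

variable {H : Type*} [NormedAddCommGroup H] [InnerProductSpace 𝕜 H] [CompleteSpace H]
  [RKHS 𝕜 H X Y]

variable [TopologicalSpace X] {κ : ℝ}

/-- Members of the space are bounded functions. -/
theorem IsBoundedMercer.norm_apply_le (hK : IsBoundedMercer (X := X) (Y := Y) H κ) (h : H) (x : X) :
    ‖h x‖ ≤ |κ| * ‖h‖ := by
  refine (RKHS.norm_apply_le h x).trans ?_
  rw [mul_comm]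
  gcongr
  rw [← Real.sqrt_sq_eq_abs]
  exact Real.sqrt_le_sqrt (hK.norm_kernel_le x)

variable [SecondCountableTopology Y]
  [MeasurableSpace X] [BorelSpace X] (μ : Measure X) [IsFiniteMeasure μ]

/-- Members of the space are square-integrable. -/
theorem IsBoundedMercer.memLp (hK : IsBoundedMercer (X := X) (Y := Y) H κ) (h : H) :
    MemLp (h : X → Y) 2 μ := by
  borelize Y
  exact MemLp.of_bound (hK.continuous h).measurable.stronglyMeasurable.aestronglyMeasurable
    (|κ| * ‖h‖) (Eventually.of_forall fun x => hK.norm_apply_le h x)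

/-- The canonical embedding `ι` of the reproducing kernel Hilbert space into `L²(μ; Y)`. -/
noncomputable def embedding (hK : IsBoundedMercer (X := X) (Y := Y) H κ) : H →L[𝕜] Lp Y 2 μ :=
  LinearMap.mkContinuous
    { toFun := fun h => (hK.memLp μ h).toLp
      map_add' := fun f g => by
        rw [← MemLp.toLp_add]
        congr 1
        simp
      map_smul' := fun c f => by
        rw [RingHom.id_apply, ← MemLp.toLp_const_smul]
        congr 1
        simp }
    (μ.real Set.univ ^ (2 : ℝ≥0∞).toReal⁻¹ * |κ|) (by
      intro h
      have := Lp.norm_le_of_ae_bound (f := (hK.memLp μ h).toLp) (C := |κ| * ‖h‖) (by positivity) (by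
        filter_upwards [(hK.memLp μ h).coeFn_toLp] with x hx
        rw [hx]
        exact hK.norm_apply_le h x)
      rw [mul_assoc]
      exact this)

theorem embedding_ae_eq (hK : IsBoundedMercer (X := X) (Y := Y) H κ) (h : H) :
    (embedding μ hK h : X → Y) =ᵐ[μ] h :=
  (hK.memLp μ h).coeFn_toLp

/-- The integral operator `L_K = ι ι^*` on `L²(μ; Y)`. By `integralOperator_ae_eq` below it is
`(L_K f)(x) = ∫ t, K x t (f t) ∂μ`. -/
noncomputable def integralOperator (hK : IsBoundedMercer (X := X) (Y := Y) H κ) :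
    Lp Y 2 μ →L[𝕜] Lp Y 2 μ :=
  embedding μ hK ∘L ContinuousLinearMap.adjoint (embedding μ hK)

/-- The adjoint of the embedding, pointwise. -/
theorem adjoint_embedding_apply [NormedSpace ℝ Y]
    (hK : IsBoundedMercer (X := X) (Y := Y) H κ) (f : Lp Y 2 μ) (x : X) :
    (ContinuousLinearMap.adjoint (embedding μ hK) f) x = ∫ t, kernel H x t (f t) ∂μ := by
  borelize Y
  have hker : ∀ (v : Y) (t : X) (y : Y), ⟪v, kernel H x t y⟫_𝕜 = ⟪kerFun H x v t, y⟫_𝕜 := by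
    intro v t y
    rw [kerFun_apply, kernel_inner, kernel_apply, ContinuousLinearMap.comp_apply,
      ContinuousLinearMap.adjoint_inner_right]
  have hfm : StronglyMeasurable (f : X → Y) := Lp.stronglyMeasurable f
  have hmeas : StronglyMeasurable fun t => kernel H x t (f t) := by
    refine stronglyMeasurable_of_inner (𝕜 := 𝕜) fun v => ?_
    simp_rw [hker]
    exact ((hK.continuous _).measurable.stronglyMeasurable.inner hfm).measurable
  have hint : Integrable (fun t => kernel H x t (f t)) μ := by
    have hf1 : Integrable (f : X → Y) μ := (Lp.memLp f).integrable (by norm_num)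
    refine (hf1.norm.const_mul (|κ| * |κ|)).mono' hmeas.aestronglyMeasurable
      (Eventually.of_forall fun t => ?_)
    refine (ContinuousLinearMap.le_opNorm _ _).trans ?_
    gcongr
    refine (RKHS.norm_kernel_le H x t).trans ?_
    rw [← Real.sqrt_sq_eq_abs]
    gcongr
    · exact hK.norm_kernel_le x
    · exact hK.norm_kernel_le t
  refine ext_inner_left 𝕜 fun v => ?_
  rw [← kerFun_inner, ContinuousLinearMap.adjoint_inner_right, L2.inner_def,
    ← integral_inner hint v]
  refine integral_congr_ae ?_
  filter_upwards [embedding_ae_eq μ hK (kerFun H x v)] with t ht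
  rw [ht, hker]

/-- `integralOperator` is the integral operator with kernel `K`. -/
theorem integralOperator_ae_eq [NormedSpace ℝ Y]
    (hK : IsBoundedMercer (X := X) (Y := Y) H κ) (f : Lp Y 2 μ) :
    (integralOperator μ hK f : X → Y) =ᵐ[μ] fun x => ∫ t, kernel H x t (f t) ∂μ := by
  refine (embedding_ae_eq μ hK _).trans (Eventually.of_forall fun x => ?_)
  exact adjoint_embedding_apply μ hK f x

end Kernels

/-! ### The regression operator, the risk, and the stochastic approximation -/

section Learning

variable {X Y : Type*} [MeasurableSpace X] [NormedAddCommGroup Y] [MeasurableSpace Y]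

/-- The expected risk `𝓔(h) = 𝔼 ‖h(x) - y‖²` for `(x, y) ∼ ρ`. -/
noncomputable def risk (ρ : Measure (X × Y)) (h : X → Y) : ℝ :=
  ∫ z, ‖h z.1 - z.2‖ ^ 2 ∂ρ

/-- The regression operator `h†(x) = ∫ y dρ(y|x)`. -/
noncomputable def regression [NormedSpace ℝ Y] [StandardBorelSpace Y]
    (ρ : Measure (X × Y)) [IsFiniteMeasure ρ] (x : X) : Y :=
  ∫ y, y ∂(ρ.condKernel x)

/-- The conditional variance of the noise is at most `σ²` for almost every `x`:
`∫ ‖y - h†(x)‖² dρ(y|x) ≤ σ²`. -/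
def CondNoiseBounded [NormedSpace ℝ Y] [StandardBorelSpace Y]
    (ρ : Measure (X × Y)) [IsFiniteMeasure ρ] (σ : ℝ) : Prop :=
  ∀ᵐ x ∂ρ.fst, ∫⁻ y, ‖y - regression ρ x‖ₑ ^ 2 ∂(ρ.condKernel x) ≤ ENNReal.ofReal (σ ^ 2)

/-- `f` has a finite expectation under `P`, which is at most `b`. -/
def ExpectationLE {Ω : Type*} [MeasurableSpace Ω] (P : Measure Ω) (f : Ω → ℝ) (b : ℝ) : Prop :=
  Integrable f P ∧ ∫ ω, f ω ∂P ≤ b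

end Learning

/-- The stochastic approximation with step sizes `η 1, η 2, …`: `sgd η n z` is the iterate
`h (n + 1)` computed from the sample `z = (z 1, …, z n)`, that is `h 1 = 0` and
`h (t + 1) = h t - η t • K(·, x t) (h t (x t) - y t)`. Here `kerFun H x v = K(·, x) v`. -/
noncomputable def sgd {𝕜 X Y H : Type*} [RCLike 𝕜]
    [NormedAddCommGroup Y] [InnerProductSpace 𝕜 Y] [CompleteSpace Y]
    [NormedAddCommGroup H] [InnerProductSpace 𝕜 H] [CompleteSpace H] [RKHS 𝕜 H X Y]
    (η : ℕ → ℝ) : (n : ℕ) → (Fin n → X × Y) → H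
  | 0, _ => 0
  | n + 1, z =>
    let h : H := sgd η n (Fin.init z)
    let x : X := (z (Fin.last n)).1
    let y : Y := (z (Fin.last n)).2
    h - (η (n + 1) : 𝕜) • kerFun H x (h x - y)

/-! ### The step-size thresholds and the rates -/

/-- The rate in the estimate that defines `stepConst`. -/
noncomputable def stepRate (v θ : ℝ) (T : ℕ) : ℝ :=
  if v < 1 then
    if θ < 1 / 2 then (T + 1 : ℝ) ^ (1 - v - θ * (2 - v))
    else if θ = 1 / 2 then (T + 1 : ℝ) ^ (-v / 2) * Real.log (T + 1)
    else (T + 1 : ℝ) ^ (-v * (1 - θ))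
  else if v = 1 then
    if θ ≤ 1 / 2 then (T + 1 : ℝ) ^ (-θ) * Real.log (T + 1)
    else (T + 1 : ℝ) ^ (-(1 - θ))
  else (T + 1 : ℝ) ^ (-min θ (v * (1 - θ)))

/-- The constant `δ` (for `0 < v` and `0 < θ < 1`): the least `δ ≥ 0` such that, with
`η t = η₁ t ^ (-θ)`,
`∑_{t=1}^{T-1} η t ^ 2 / (1 + (∑_{j=t+1}^T η j) ^ v) ≤ δ η₁ ^ 2 / min {1, (η₁ / (1-θ)) ^ v} * rate`
for all `T ≥ 2` and all `η₁ > 0`. -/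
noncomputable def stepConst (v θ : ℝ) : ℝ :=
  sInf {δ : ℝ | 0 ≤ δ ∧ ∀ T : ℕ, 2 ≤ T → ∀ η₁ : ℝ, 0 < η₁ →
    ∑ t ∈ Finset.Icc 1 (T - 1), (η₁ * (t : ℝ) ^ (-θ)) ^ 2 /
        (1 + (∑ j ∈ Finset.Icc (t + 1) T, η₁ * (j : ℝ) ^ (-θ)) ^ v) ≤
      δ * (η₁ ^ 2 / min 1 ((η₁ / (1 - θ)) ^ v)) * stepRate v θ T}

/-- The threshold `γ₂` for decaying step sizes, where `tr` stands for the trace of `L_K ^ s`. It is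
`(1-s) / (8 κ² tr (1 + κ^{2(1-s)}) (δ+1))` if `s < 1`, it is
`(2θ-1) / (16 κ² tr (1 + κ^{2(1-s)}) (δ+1) θ)` if `s = 1` and `1/2 < θ`, and there is no restriction
(`⊤`) if `s = 1` and `θ ≤ 1/2`. -/
noncomputable def gammaTwo (κ s θ : ℝ) (tr : ℝ≥0∞) : ℝ≥0∞ :=
  if s < 1 then
    ENNReal.ofReal (1 - s) / (8 * ENNReal.ofReal (κ ^ 2) * tr *
      (1 + ENNReal.ofReal ((κ ^ 2) ^ (1 - s))) * (ENNReal.ofReal (stepConst (1 - s) θ) + 1))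
  else if 1 / 2 < θ then
    ENNReal.ofReal (2 * θ - 1) / (16 * ENNReal.ofReal (κ ^ 2) * tr *
      (1 + ENNReal.ofReal ((κ ^ 2) ^ (1 - s))) * (ENNReal.ofReal (stepConst 1 θ) + 1) *
        ENNReal.ofReal θ)
  else ⊤

/-- The threshold `γ₂' = s / (16 κ² tr (1 + κ^{2(1-s)}) (s+1))` for constant step sizes. -/
noncomputable def gammaTwo' (κ s : ℝ) (tr : ℝ≥0∞) : ℝ≥0∞ :=
  ENNReal.ofReal s / (16 * ENNReal.ofReal (κ ^ 2) * tr *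
    (1 + ENNReal.ofReal ((κ ^ 2) ^ (1 - s))) * (ENNReal.ofReal s + 1))

/-- `f₂(T)`: the factor `log (T + 1)` if `s = 1`. -/
noncomputable def fTwo (s : ℝ) (T : ℕ) : ℝ := if s = 1 then Real.log (T + 1) else 1

/-- `f₃(T)`: the factor `log (T + 1)` if `θ = 1/2`. -/
noncomputable def fThree (θ : ℝ) (T : ℕ) : ℝ := if θ = 1 / 2 then Real.log (T + 1) else 1

/-- Rate of the prediction error, decaying step sizes. -/
noncomputable def predRateDecay (r s θ : ℝ) (T : ℕ) : ℝ :=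
  if θ ≤ min (2 * r) (2 - s) / (1 + min (2 * r) (2 - s)) then (T + 1 : ℝ) ^ (-θ) * fTwo s T
  else (T + 1 : ℝ) ^ (-(min (2 * r) (2 - s) * (1 - θ)))

/-- Rate of the estimation error, decaying step sizes (for `s / (1 + s) < θ`). -/
noncomputable def estRateDecay (r s θ : ℝ) (T : ℕ) : ℝ :=
  if θ ≤ min ((2 * r + s - 1) / (2 * r + s)) (1 / 2) then
    (T + 1 : ℝ) ^ (s - (1 + s) * θ) * fThree θ T
  else (T + 1 : ℝ) ^ (-(min (2 * r - 1) (1 - s) * (1 - θ)))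

/-- Rate of the prediction error, constant step sizes. -/
noncomputable def predRateConst (r s θ' : ℝ) (T : ℕ) : ℝ :=
  if θ' ≤ 2 * r / (2 * r + 1) then (T + 1 : ℝ) ^ (-θ') * fTwo s T
  else (T + 1 : ℝ) ^ (-(2 * r * (1 - θ')))

/-- Rate of the estimation error, constant step sizes (for `s / (1 + s) < θ'`). -/
noncomputable def estRateConst (r s θ' : ℝ) (T : ℕ) : ℝ :=
  if θ' ≤ (2 * r + s - 1) / (2 * r + s) then (T + 1 : ℝ) ^ (s - (1 + s) * θ')
  else (T + 1 : ℝ) ^ (-((2 * r - 1) * (1 - θ')))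

end OpLearn

open OpLearn

/-!
# Convergence rates of the stochastic approximation with an operator-valued kernel

Let `ι : H → L²` be the embedding, so that the integral operator is `L = ι ι*`. Finiteness of the
trace of `L ^ s` with `s ≤ 1` makes `ι` a Hilbert–Schmidt operator, and full support of the marginal
makes it injective. Hence `H` has an orthonormal basis `uⱼ` of eigenvectors of `ι* ι` with
eigenvalues `λⱼ > 0` and `∑ⱼ λⱼ ^ s < ∞` (`EigenSystem`, `exists_eigenSystem`). The source condition
provides `h† ∈ H` with coordinates `λⱼ ^ (r - 1/2) ⟪eⱼ, g⟫` (`EigenSystem.exists_preimage_opPow`),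
and the excess risk of `h` is `‖ι (h - h†)‖²` (`risk_sub_risk`).

For the coordinates of the error `h_n - h†`, one step of the iteration contracts the mean square of
the `j`-th one by `(1 - η λⱼ)²` and adds noise, which consists of an additive part of the size
`η² σ² λⱼ` and a multiplicative part of the size `η² 𝔼 |⟪uⱼ, K(·, x) e(x)⟫|²`, with `e` the current
error (`one_step`). The multiplicative part is at most `η² κ² λⱼ` times the squared norm of the
error; summed over `j`, it is at most `η² κ²` times the prediction error (`crossErr_le`,
`tsum_crossErr_le`). Unrolling, summing over `j`, and using that `λ ^ v ∏ (1 - η_i λ)²` is at most of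
the order of `(1 + ∑ η_i) ^ (-v)` (`exists_rpow_mul_prod_le`) gives recursive inequalities for the
prediction error `a` and the squared norm `k` of the error. After a rescaling by powers of the
initial step size `e` their constants are uniform in `e ≤ 1` (`exists_scaled_error_bounds`). The
inequality for `k` has the noise exponent `1 - s`, and those for `a` have the noise exponent `2 - s`
and either `k` or `a` itself in the multiplicative noise. For `s = 0` there are finitely many
eigenvalues, and the exponent for `k` may be any number, for instance `2`.

What remains is an analysis of the sums
`∑_t w_{t+1}² (1 + w_{t+2} + ⋯ + w_n) ^ (-v) f_t`. The recursions first give bounds of `k` (if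
`s / (1 + s) < θ`) or of `a` that are uniform in `n`, because the total weight of the noise tends to
zero (`exists_bound_of_recursion`); the conditions `e ‖L‖ ≤ 1` and `e ≤ 1` suffice
for this, since finitely many initial steps change the constants only. Inserting the bounds
into the recursions gives the rates. If `s < 1` and `θ ≤ s / (1 + s)`, a bound of `k` is not
available; there the recursion of `a` is used repeatedly: boundedness of `a` gives an intermediate
decay of `a`, and this gives the rate.
-/

set_option linter.unusedSectionVars false

namespace OpLearn

/-! ### Powers of positive operators -/

section PolynomialCalculus

variable {𝕜 E : Type*} [RCLike 𝕜] [NormedAddCommGroup E] [InnerProductSpace 𝕜 E] [CompleteSpace E]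

/-- The real polynomial `q` evaluated at the operator `A`. -/
noncomputable abbrev polyOp (A : E →L[𝕜] E) (q : Polynomial ℝ) : E →L[𝕜] E :=
  Polynomial.aeval A (q.map (algebraMap ℝ 𝕜))

theorem polyOp_apply_eigenvector (A : E →L[𝕜] E) (q : Polynomial ℝ) {l : ℝ} {e : E}
    (he : A e = (l : 𝕜) • e) : polyOp A q e = ((q.eval l : ℝ) : 𝕜) • e := by
  have hpow : ∀ k : ℕ, (A ^ k) e = ((l ^ k : ℝ) : 𝕜) • e := by
    intro k
    induction k with
    | zero => simp
    | succ k ih =>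
      rw [pow_succ, mul_apply_eq_comp, he, map_smul, ih, smul_smul]
      push_cast
      ring_nf
  rw [polyOp, Polynomial.aeval_eq_sum_range' (n := q.natDegree + 1)
    (Nat.lt_succ_of_le (Polynomial.natDegree_map_le)), Polynomial.eval_eq_sum_range,
    FunLike.coe_sum, Finset.sum_apply, RCLike.ofReal_sum, Finset.sum_smul]
  refine Finset.sum_congr rfl fun k _ => ?_
  change (q.map (algebraMap ℝ 𝕜)).coeff k • (A ^ k) e = _
  rw [hpow, Polynomial.coeff_map, smul_smul, RCLike.algebraMap_eq_ofReal]
  push_cast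
  rfl

theorem polyOp_isSymmetric {A : E →L[𝕜] E} (hA : A.IsSymmetric) (q : Polynomial ℝ) :
    (polyOp A q).IsSymmetric := by
  have hs : IsSelfAdjoint A := hA.isSelfAdjoint
  refine IsSelfAdjoint.isSymmetric ?_
  rw [polyOp, Polynomial.aeval_eq_sum_range]
  refine isSelfAdjoint_sum _ fun k _ => ?_
  refine IsSelfAdjoint.smul ?_ (hs.pow k)
  simp [isSelfAdjoint_iff]

/-- A real polynomial that is nonnegative on `[0, ‖A‖]` is nonnegative at a positive operator `A`.
The quadratic form at `x` only involves the compression of `A` to the span of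
`x, A x, …, A ^ d x`, which is diagonalizable with eigenvalues in `[0, ‖A‖]`. -/
theorem re_inner_polyOp_nonneg {A : E →L[𝕜] E} (hA : A.IsPositive) {q : Polynomial ℝ}
    (hq : ∀ t ∈ Set.Icc 0 ‖A‖, 0 ≤ q.eval t) (x : E) :
    0 ≤ RCLike.re ⟪polyOp A q x, x⟫_𝕜 := by
  set d := q.natDegree with hd
  set W : Submodule 𝕜 E := Submodule.span 𝕜 (Set.range fun k : Fin (d + 1) => (A ^ (k : ℕ)) x)
    with hW
  have : FiniteDimensional 𝕜 W := FiniteDimensional.span_of_finite 𝕜 (Set.finite_range _)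
  have hmem : ∀ k ≤ d, (A ^ k) x ∈ W := fun k hk =>
    Submodule.subset_span ⟨⟨k, Nat.lt_succ_of_le hk⟩, rfl⟩
  let B : W →ₗ[𝕜] W := (W.orthogonalProjectionOnto ∘L A ∘L W.subtypeL : W →L[𝕜] W)
  have hBapp : ∀ w : W, B w = W.orthogonalProjectionOnto (A w) := fun w => rfl
  have hBin : ∀ v w : W, ⟪B v, w⟫_𝕜 = ⟪A v, (w : E)⟫_𝕜 := by
    intro v w
    rw [hBapp, Submodule.coe_inner]
    exact Submodule.inner_orthogonalProjectionOnto_eq_of_mem_right w (A v)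
  have hB : B.IsSymmetric := by
    intro v w
    rw [hBin, ← inner_conj_symm v, hBin, inner_conj_symm]
    exact hA.isSymmetric _ _
  let x' : W := ⟨x, by simpa using hmem 0 (Nat.zero_le _)⟩
  have hpow : ∀ k ≤ d, (((B ^ k) x' : W) : E) = (A ^ k) x := by
    intro k
    induction k with
    | zero => simp [x']
    | succ k ih =>
      intro hk
      rw [pow_succ', Module.End.mul_apply, hBapp, ih (by omega), pow_succ',
        mul_apply_eq_comp]
      have h1 := hmem (k + 1) hk
      rw [pow_succ', mul_apply_eq_comp] at h1
      exact Submodule.starProjection_eq_self_iff.2 h1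
  set Q := q.map (algebraMap ℝ 𝕜) with hQ
  have hval : polyOp A q x = ((Polynomial.aeval B Q x' : W) : E) := by
    rw [polyOp, Polynomial.aeval_eq_sum_range' (n := d + 1)
      (Nat.lt_succ_of_le (Polynomial.natDegree_map_le)),
      Polynomial.aeval_eq_sum_range' (n := d + 1)
      (Nat.lt_succ_of_le (Polynomial.natDegree_map_le))]
    rw [FunLike.coe_sum, Finset.sum_apply, LinearMap.sum_apply, Submodule.coe_sum]
    refine Finset.sum_congr rfl fun k hk => ?_
    have := hpow k (by have := Finset.mem_range.1 hk; omega)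
    simp [this]
  let b := hB.eigenvectorBasis rfl
  let m := hB.eigenvalues rfl
  have hm : ∀ i, m i ∈ Set.Icc 0 ‖A‖ := by
    intro i
    have h1 : ⟪B (b i), b i⟫_𝕜 = (m i : 𝕜) := by
      rw [hB.apply_eigenvectorBasis, inner_smul_left, inner_self_eq_norm_sq_to_K]
      simp [m]
    rw [hBin] at h1
    have h2 : RCLike.re ⟪A (b i), (b i : E)⟫_𝕜 = m i := by rw [h1]; simp
    have hn : ‖((b i : W) : E)‖ = 1 := by
      rw [Submodule.norm_coe]; exact b.orthonormal.1 i
    constructor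
    · rw [← h2]; exact hA.re_inner_nonneg_left _
    · rw [← h2]
      refine (RCLike.re_le_norm _).trans ((norm_inner_le_norm _ _).trans ?_)
      have := A.le_opNorm (b i : E)
      rw [hn] at this ⊢
      linarith
  have hQb : ∀ i, Polynomial.aeval B Q (b i) = ((q.eval (m i) : ℝ) : 𝕜) • b i := by
    intro i
    rw [Module.End.aeval_apply_of_hasEigenvector (hB.hasEigenvector_eigenvectorBasis rfl i)]
    congr 1
    rw [hQ, Polynomial.eval_map_algebraMap]
    change Polynomial.aeval (algebraMap ℝ 𝕜 (m i)) q = algebraMap ℝ 𝕜 (q.eval (m i))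
    rw [Polynomial.aeval_algebraMap_apply]
    simp
  have hx' : x' = ∑ i, ⟪b i, x'⟫_𝕜 • b i := (b.sum_repr' x').symm
  have hfin : ⟪polyOp A q x, x⟫_𝕜 = ∑ i, ((q.eval (m i) * ‖⟪b i, x'⟫_𝕜‖ ^ 2 : ℝ) : 𝕜) := by
    rw [hval]
    change ⟪((Polynomial.aeval B Q x' : W) : E), (x' : E)⟫_𝕜 = _
    rw [← Submodule.coe_inner]
    conv_lhs =>
      enter [2]
      rw [hx']
    rw [map_sum, sum_inner]
    refine Finset.sum_congr rfl fun i _ => ?_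
    rw [map_smul, hQb, inner_smul_left, inner_smul_left, RCLike.conj_ofReal]
    push_cast
    rw [← RCLike.conj_mul]
    ring
  rw [hfin, ← RCLike.ofReal_sum, RCLike.ofReal_re]
  exact Finset.sum_nonneg fun i _ => mul_nonneg (hq _ (hm i)) (sq_nonneg _)

/-- The polynomial `c² - q²` is nonnegative on `[0, ‖A‖]`, hence `‖q(A) x‖² ≤ c² ‖x‖²`. -/
theorem norm_polyOp_le {A : E →L[𝕜] E} (hA : A.IsPositive) {q : Polynomial ℝ} {c : ℝ}
    (hc : 0 ≤ c) (hq : ∀ t ∈ Set.Icc 0 ‖A‖, |q.eval t| ≤ c) : ‖polyOp A q‖ ≤ c := by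
  refine ContinuousLinearMap.opNorm_le_bound _ hc fun x => ?_
  have h := re_inner_polyOp_nonneg hA (q := Polynomial.C (c ^ 2) - q * q) (fun t ht => by
    have := hq t ht
    have h2 := abs_le.1 this
    simp only [Polynomial.eval_sub, Polynomial.eval_C, Polynomial.eval_mul]
    nlinarith) x
  have h1 : polyOp A (Polynomial.C (c ^ 2) - q * q) x =
      ((c ^ 2 : ℝ) : 𝕜) • x - polyOp A q (polyOp A q x) := by
    rw [polyOp, Polynomial.map_sub, Polynomial.map_mul, Polynomial.map_C, map_sub, map_mul,
      Polynomial.aeval_C, Algebra.algebraMap_eq_smul_one]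
    rfl
  have h2 : ⟪polyOp A q (polyOp A q x), x⟫_𝕜 = ⟪polyOp A q x, polyOp A q x⟫_𝕜 :=
    polyOp_isSymmetric hA.isSymmetric q _ x
  rw [h1, inner_sub_left, inner_smul_left, map_sub, RCLike.conj_ofReal, RCLike.re_ofReal_mul,
    h2, inner_self_eq_norm_sq, inner_self_eq_norm_sq] at h
  refine abs_le_of_sq_le_sq' ?_ (by positivity) |>.2
  rw [mul_pow]
  linarith

/-- Limits of polynomials in `A` inherit positivity from the limit function on `[0, ‖A‖]`. -/
theorem re_inner_nonneg_of_tendsto {A B : E →L[𝕜] E} (hA : A.IsPositive) {p : ℕ → Polynomial ℝ}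
    {f : ℝ → ℝ} (hp : TendstoUniformlyOn (fun n x => (p n).eval x) f atTop (Set.Icc 0 ‖A‖))
    (hB : Tendsto (fun n => polyOp A (p n)) atTop (𝓝 B)) (hf : ∀ t ∈ Set.Icc 0 ‖A‖, 0 ≤ f t)
    (x : E) : 0 ≤ RCLike.re ⟪B x, x⟫_𝕜 := by
  refine le_of_forall_pos_le_add fun ε hε => ?_
  set δ := ε / (‖x‖ ^ 2 + 1) with hδ
  have hδ0 : 0 < δ := by positivity
  have hlim : Tendsto (fun n => RCLike.re ⟪polyOp A (p n) x, x⟫_𝕜 + δ * ‖x‖ ^ 2) atTop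
      (𝓝 (RCLike.re ⟪B x, x⟫_𝕜 + δ * ‖x‖ ^ 2)) := by
    refine Tendsto.add_const _ ?_
    have h1 : Tendsto (fun n => polyOp A (p n) x) atTop (𝓝 (B x)) :=
      ((ContinuousLinearMap.apply 𝕜 E x).continuous.tendsto B).comp hB
    exact (RCLike.continuous_re.tendsto _).comp (h1.inner tendsto_const_nhds)
  have hle : δ * ‖x‖ ^ 2 ≤ ε := by
    rw [hδ, div_mul_eq_mul_div, div_le_iff₀ (by positivity)]
    nlinarith
  refine le_trans ?_ (add_le_add_right hle _)
  refine ge_of_tendsto hlim ?_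
  filter_upwards [Metric.tendstoUniformlyOn_iff.1 hp δ hδ0] with n hn
  have h := re_inner_polyOp_nonneg hA (q := p n + Polynomial.C δ) (fun t ht => by
    have h2 := hn t ht
    rw [Real.dist_eq, abs_lt] at h2
    simp only [Polynomial.eval_add, Polynomial.eval_C]
    linarith [hf t ht]) x
  have h1 : polyOp A (p n + Polynomial.C δ) x = polyOp A (p n) x + (δ : 𝕜) • x := by
    simp [polyOp, Polynomial.aeval_C, Algebra.algebraMap_eq_smul_one]
  rwa [h1, inner_add_left, inner_smul_left, map_add, RCLike.conj_ofReal, RCLike.re_ofReal_mul,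
    inner_self_eq_norm_sq] at h

/-- Polynomials converging to `x ↦ x ^ a` uniformly on `[0, ‖A‖]` form a Cauchy sequence at `A`. -/
theorem exists_isOpPow {A : E →L[𝕜] E} (hA : A.IsPositive) {a : ℝ} (ha : 0 < a) :
    ∃ B, IsOpPow A a B := by
  have hcont : ContinuousOn (fun x : ℝ => x ^ a) (Set.Icc 0 ‖A‖) :=
    (Real.continuous_rpow_const ha.le).continuousOn
  have hex : ∀ n : ℕ, ∃ p : Polynomial ℝ, ∀ x ∈ Set.Icc 0 ‖A‖, |p.eval x - x ^ a| < 1 / (n + 1) :=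
    fun n => exists_polynomial_near_of_continuousOn 0 ‖A‖ _ hcont _ (by positivity)
  choose p hp using hex
  have hunif : TendstoUniformlyOn (fun n x => (p n).eval x) (fun x => x ^ a) atTop
      (Set.Icc 0 ‖A‖) := by
    refine Metric.tendstoUniformlyOn_iff.2 fun ε hε => ?_
    filter_upwards [tendsto_one_div_add_atTop_nhds_zero_nat.eventually (gt_mem_nhds hε)]
      with n hn x hx
    rw [dist_comm, Real.dist_eq]
    exact (hp n x hx).trans hn
  have hcau : CauchySeq fun n => polyOp A (p n) := by
    refine Metric.cauchySeq_iff.2 fun ε hε => ?_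
    obtain ⟨N, hN⟩ := exists_nat_one_div_lt (show (0 : ℝ) < ε / 4 by positivity)
    refine ⟨N, fun m hm n hn => ?_⟩
    have hsmall : ∀ k : ℕ, N ≤ k → 1 / ((k : ℝ) + 1) ≤ ε / 4 := fun k hk =>
      (one_div_le_one_div_of_le (by positivity) (by gcongr)).trans hN.le
    rw [dist_eq_norm]
    have h1 : polyOp A (p m) - polyOp A (p n) = polyOp A (p m - p n) := by simp [polyOp]
    rw [h1]
    refine (norm_polyOp_le hA (c := ε / 2) (by positivity) fun t ht => ?_).trans_lt (by linarith)
    have h2 := abs_lt.1 (hp m t ht)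
    have h3 := abs_lt.1 (hp n t ht)
    have h4 := hsmall m hm
    have h5 := hsmall n hn
    rw [Polynomial.eval_sub, abs_le]
    constructor <;> linarith
  obtain ⟨B, hB⟩ := cauchySeq_tendsto_of_complete hcau
  exact ⟨B, p, hunif, hB⟩

theorem opPow_isOpPow {A : E →L[𝕜] E} (hA : A.IsPositive) {a : ℝ} (ha : 0 < a) :
    IsOpPow A a (opPow A a) := by
  have h := exists_isOpPow hA ha
  rw [opPow, if_neg ha.ne', dif_pos h]
  exact h.choose_spec

theorem opPow_zero (A : E →L[𝕜] E) :
    opPow A 0 = (LinearMap.ker A.toLinearMap)ᗮ.starProjection := by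
  rw [opPow, if_pos rfl]

theorem opPow_isSymmetric {A : E →L[𝕜] E} (hA : A.IsPositive) {a : ℝ} (ha : 0 ≤ a) :
    (opPow A a).IsSymmetric := by
  rcases ha.eq_or_lt with rfl | ha
  · rw [opPow_zero]
    exact Submodule.starProjection_isSymmetric _
  · obtain ⟨p, -, hB⟩ := opPow_isOpPow hA ha
    intro x y
    have happ : ∀ z, Tendsto (fun n => polyOp A (p n) z) atTop (𝓝 (opPow A a z)) := fun z =>
      ((ContinuousLinearMap.apply 𝕜 E z).continuous.tendsto _).comp hB
    refine tendsto_nhds_unique ((happ x).inner tendsto_const_nhds) ?_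
    refine (tendsto_const_nhds.inner (happ y)).congr fun n => ?_
    exact (polyOp_isSymmetric hA.isSymmetric (p n) x y).symm

theorem re_inner_opPow_nonneg {A : E →L[𝕜] E} (hA : A.IsPositive) {a : ℝ} (ha : 0 ≤ a) (x : E) :
    0 ≤ RCLike.re ⟪opPow A a x, x⟫_𝕜 := by
  rcases ha.eq_or_lt with rfl | ha
  · rw [opPow_zero]
    exact (ContinuousLinearMap.IsPositive.of_isStarProjection
      (isStarProjection_starProjection)).re_inner_nonneg_left x
  · obtain ⟨p, hp, hB⟩ := opPow_isOpPow hA ha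
    exact re_inner_nonneg_of_tendsto hA hp hB (fun t ht => Real.rpow_nonneg ht.1 _) x

theorem eigenvalue_mem_Icc {A : E →L[𝕜] E} (hA : A.IsPositive) {l : ℝ} {e : E} (he0 : e ≠ 0)
    (he : A e = (l : 𝕜) • e) : l ∈ Set.Icc 0 ‖A‖ := by
  have hpos : 0 < ‖e‖ := norm_pos_iff.2 he0
  have h1 := hA.re_inner_nonneg_left e
  rw [he, inner_smul_left, RCLike.conj_ofReal, RCLike.re_ofReal_mul, inner_self_eq_norm_sq] at h1
  have hl : 0 ≤ l := nonneg_of_mul_nonneg_left h1 (by positivity)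
  refine ⟨hl, ?_⟩
  have h2 := A.le_opNorm e
  rw [he, norm_smul, RCLike.norm_ofReal, abs_of_nonneg hl] at h2
  exact le_of_mul_le_mul_right h2 hpos

theorem opPow_apply_of_isOpPow {A : E →L[𝕜] E} (hA : A.IsPositive) {a : ℝ} (ha : 0 < a) {l : ℝ}
    {e : E} (he : A e = (l : 𝕜) • e) (hl : l ∈ Set.Icc 0 ‖A‖) :
    opPow A a e = ((l ^ a : ℝ) : 𝕜) • e := by
  obtain ⟨p, hp, hB⟩ := opPow_isOpPow hA ha
  have happ : Tendsto (fun n => polyOp A (p n) e) atTop (𝓝 (opPow A a e)) :=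
    ((ContinuousLinearMap.apply 𝕜 E e).continuous.tendsto _).comp hB
  refine tendsto_nhds_unique happ ?_
  simp_rw [polyOp_apply_eigenvector A _ he]
  exact ((RCLike.continuous_ofReal.tendsto _).comp (hp.tendsto_at hl)).smul_const e

theorem opPow_apply_eigenvector {A : E →L[𝕜] E} (hA : A.IsPositive) {a : ℝ} (ha : 0 ≤ a) {l : ℝ}
    (hl : 0 < l) {e : E} (he : A e = (l : 𝕜) • e) : opPow A a e = ((l ^ a : ℝ) : 𝕜) • e := by
  rcases eq_or_ne e 0 with rfl | he0
  · simp
  rcases ha.eq_or_lt with rfl | ha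
  · rw [opPow_zero, Real.rpow_zero, RCLike.ofReal_one, one_smul]
    refine Submodule.starProjection_eq_self_iff.2 ?_
    intro v hv
    have hv' : A v = 0 := hv
    have h1 : ⟪A v, e⟫_𝕜 = (l : 𝕜) * ⟪v, e⟫_𝕜 := by
      rw [← inner_smul_right, ← he]
      exact hA.isSymmetric v e
    rw [hv', inner_zero_left] at h1
    have hl' : (l : 𝕜) ≠ 0 := by exact_mod_cast hl.ne'
    exact (mul_eq_zero.1 h1.symm).resolve_left hl'
  · exact opPow_apply_of_isOpPow hA ha he (eigenvalue_mem_Icc hA he0 he)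

theorem opPow_apply_of_ker {A : E →L[𝕜] E} (hA : A.IsPositive) {a : ℝ} (ha : 0 < a) {x : E}
    (hx : A x = 0) : opPow A a x = 0 := by
  have h := opPow_apply_of_isOpPow hA ha (l := 0) (e := x) (by simpa using hx)
    ⟨le_rfl, norm_nonneg _⟩
  simpa [Real.zero_rpow ha.ne'] using h

/-- On `[0, ‖A‖]` one has `x ≤ ‖A‖ ^ (1 - a) * x ^ a` for `0 ≤ a ≤ 1`. -/
theorem re_inner_le_opPow {A : E →L[𝕜] E} (hA : A.IsPositive) {a : ℝ} (ha : 0 ≤ a) (ha1 : a ≤ 1)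
    (x : E) : RCLike.re ⟪A x, x⟫_𝕜 ≤ ‖A‖ ^ (1 - a) * RCLike.re ⟪opPow A a x, x⟫_𝕜 := by
  rcases ha.eq_or_lt with rfl | ha
  · have hidem : ⟪opPow A 0 x, x⟫_𝕜 = ⟪opPow A 0 x, opPow A 0 x⟫_𝕜 := by
      rw [opPow_zero]
      rw [Submodule.inner_starProjection_left_eq_right, ← Submodule.starProjection_eq_self_iff.2
        (Submodule.starProjection_apply_mem _ x)]
      rw [← Submodule.inner_starProjection_left_eq_right]
      simp [Submodule.starProjection_eq_self_iff.2 (Submodule.starProjection_apply_mem _ x)]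
    have hker : A x = A (opPow A 0 x) := by
      have h1 : x - opPow A 0 x ∈ LinearMap.ker A.toLinearMap := by
        have h2 := Submodule.sub_starProjection_mem_orthogonal
          (K := (LinearMap.ker A.toLinearMap)ᗮ) x
        rw [opPow_zero]
        rwa [Submodule.orthogonal_orthogonal_eq_closure,
          IsClosed.submodule_topologicalClosure_eq] at h2
        exact A.isClosed_ker
      have h3 : A (x - opPow A 0 x) = 0 := h1
      rwa [map_sub, sub_eq_zero] at h3
    have h4 : ⟪A x, x⟫_𝕜 = ⟪A (opPow A 0 x), opPow A 0 x⟫_𝕜 := by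
      have hs : ∀ u v, ⟪A u, v⟫_𝕜 = ⟪u, A v⟫_𝕜 := hA.isSymmetric
      rw [hker, hs, hker, ← hs]
    rw [h4, hidem, inner_self_eq_norm_sq, sub_zero, Real.rpow_one]
    refine (RCLike.re_le_norm _).trans ((norm_inner_le_norm _ _).trans ?_)
    have := A.le_opNorm (opPow A 0 x)
    nlinarith [norm_nonneg (opPow A 0 x)]
  · obtain ⟨p, hp, hB⟩ := opPow_isOpPow hA ha
    set c := ‖A‖ ^ (1 - a) with hc
    have h := re_inner_nonneg_of_tendsto hA (p := fun n => Polynomial.C c * p n - Polynomial.X)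
      (f := fun t => c * t ^ a - t) (B := (c : 𝕜) • opPow A a - A) ?_ ?_ ?_ x
    · rw [sub_apply, inner_sub_left, map_sub, smul_apply,
        inner_smul_left, RCLike.conj_ofReal, RCLike.re_ofReal_mul] at h
      linarith
    · have h1 : TendstoUniformlyOn (fun n x => c * (p n).eval x) (fun x => c * x ^ a) atTop
          (Set.Icc 0 ‖A‖) :=
        (Real.uniformContinuous_const_mul (x := c)).comp_tendstoUniformlyOn hp
      have h2 : TendstoUniformlyOn (fun (_ : ℕ) (x : ℝ) => x) (fun x => x) atTop
          (Set.Icc 0 ‖A‖) := by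
        refine Metric.tendstoUniformlyOn_iff.2 fun ε hε => ?_
        simp [hε]
      refine (h1.sub h2).congr (Eventually.of_forall fun n x _ => ?_)
      simp
    · have h1 : ∀ n, polyOp A (Polynomial.C c * p n - Polynomial.X) =
          (c : 𝕜) • polyOp A (p n) - A := by
        intro n
        simp [polyOp, Polynomial.aeval_C, Algebra.algebraMap_eq_smul_one]
      simp_rw [h1]
      exact (hB.const_smul (c : 𝕜)).sub_const A
    · intro t ht
      rcases ht.1.eq_or_lt with rfl | ht0
      · simp [Real.zero_rpow ha.ne']
      have h1 : t ^ (1 - a) ≤ c := Real.rpow_le_rpow ht.1 ht.2 (by linarith)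
      have h2 : t = t ^ (1 - a) * t ^ a := by
        rw [← Real.rpow_add ht0]; simp
      have h3 : 0 ≤ t ^ a := Real.rpow_nonneg ht.1 _
      nlinarith

end PolynomialCalculus

/-! ### Spectral decomposition of the embedding -/

section Spectral

variable {𝕜 E H : Type*} [RCLike 𝕜] [NormedAddCommGroup E] [InnerProductSpace 𝕜 E]
  [CompleteSpace E] [NormedAddCommGroup H] [InnerProductSpace 𝕜 H] [CompleteSpace H]

theorem isCompactOperator_smulRight (φ : E →L[𝕜] 𝕜) (v : H) :
    IsCompactOperator (φ.smulRight v) := by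
  have h1 : IsCompactOperator (ContinuousLinearMap.id 𝕜 𝕜) := by
    refine ⟨Metric.closedBall 0 1, isCompact_closedBall 0 1, ?_⟩
    simpa using Metric.closedBall_mem_nhds (0 : 𝕜) one_pos
  exact (h1.clm_comp (ContinuousLinearMap.toSpanSingleton 𝕜 v)).comp_clm φ

/-- A Hilbert–Schmidt operator is compact. -/
theorem isCompactOperator_of_summable_norm_sq {I : Type*} (b : HilbertBasis I 𝕜 E)
    (T : E →L[𝕜] H) (hT : Summable fun i => ‖T (b i)‖ ^ 2) : IsCompactOperator T := by
  classical
  let F : Finset I → E →L[𝕜] H := fun u => ∑ i ∈ u, (innerSL 𝕜 (b i)).smulRight (T (b i))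
  have hFapp : ∀ u x, F u x = ∑ i ∈ u, ⟪b i, x⟫_𝕜 • T (b i) := fun u x => by
    simp [F, sum_apply]
  have hlim : ∀ x, Tendsto (fun u => F u x) atTop (𝓝 (T x)) := by
    intro x
    have h1 : HasSum (fun i => T (⟪b i, x⟫_𝕜 • b i)) (T x) := by
      have := (b.hasSum_repr x).mapL T
      simpa [b.repr_apply_apply] using this
    refine h1.congr fun u => ?_
    rw [hFapp]
    simp
  refine isCompactOperator_of_tendsto (l := atTop) (F := F) ?_ (Eventually.of_forall fun u => ?_)
  · refine Metric.tendsto_atTop.2 fun ε hε => ?_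
    obtain ⟨u₀, hu₀⟩ := summable_iff_vanishing_norm.1 hT ((ε / 2) ^ 2) (by positivity)
    refine ⟨u₀, fun u hu => ?_⟩
    rw [dist_comm, dist_eq_norm]
    refine (ContinuousLinearMap.opNorm_le_bound _ (by positivity : 0 ≤ ε / 2) fun x => ?_).trans_lt
      (by linarith)
    rw [sub_apply]
    refine le_of_tendsto ((hlim x).sub_const (F u x)).norm ?_
    filter_upwards [eventually_ge_atTop u] with w hw
    have h1 : F w x - F u x = ∑ i ∈ w \ u, ⟪b i, x⟫_𝕜 • T (b i) := by
      rw [hFapp, hFapp, ← Finset.sum_sdiff hw]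
      abel
    have h2 : ∑ i ∈ w \ u, ‖T (b i)‖ ^ 2 ≤ (ε / 2) ^ 2 := by
      have := hu₀ (w \ u) (Finset.disjoint_left.2 fun i hi hi' =>
        (Finset.mem_sdiff.1 hi).2 (hu hi'))
      exact ((le_abs_self _).trans_lt this).le
    have h3 : ∑ i ∈ w \ u, ‖⟪b i, x⟫_𝕜‖ ^ 2 ≤ ‖x‖ ^ 2 := b.orthonormal.sum_inner_products_le x
    rw [h1]
    refine (norm_sum_le _ _).trans ?_
    simp_rw [norm_smul]
    refine (Real.sum_mul_le_sqrt_mul_sqrt _ _ _).trans ?_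
    rw [mul_comm]
    exact mul_le_mul (Real.sqrt_le_iff.2 ⟨by positivity, h2⟩)
      (Real.sqrt_le_iff.2 ⟨by positivity, h3⟩) (Real.sqrt_nonneg _) (by positivity)
  · refine Finset.sum_induction _ (fun S : E →L[𝕜] H => IsCompactOperator S) ?_ ?_ ?_
    · exact fun a b ha hb => ha.add hb
    · exact isCompactOperator_zero
    · exact fun i _ => isCompactOperator_smulRight _ _

/-- The spectral theorem for a compact symmetric operator, with a single Hilbert basis. -/
theorem exists_hilbertBasis_eigenvectors {C : H →L[𝕜] H} (hC : IsCompactOperator C)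
    (hsym : C.IsSymmetric) :
    ∃ (J : Set H) (b : HilbertBasis J 𝕜 H), ∀ j, ∃ μ : 𝕜, C (b j) = μ • b j := by
  have hcomplete : ∀ μ : 𝕜, CompleteSpace (Module.End.eigenspace (C : Module.End 𝕜 H) μ) := by
    intro μ
    have : IsClosed ((Module.End.eigenspace (C : Module.End 𝕜 H) μ : Submodule 𝕜 H) : Set H) := by
      have h1 : ((Module.End.eigenspace (C : Module.End 𝕜 H) μ : Submodule 𝕜 H) : Set H) =
          {x | C x = μ • x} := by
        ext x
        simp
      rw [h1]
      exact isClosed_eq C.continuous (continuous_const_smul μ)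
    exact this.completeSpace_coe
  choose w bw hbw using fun μ : 𝕜 =>
    exists_hilbertBasis 𝕜 (Module.End.eigenspace (C : Module.End 𝕜 H) μ)
  let v : (Σ μ : 𝕜, w μ) → H := fun a => ((bw a.1 a.2 : Module.End.eigenspace _ a.1) : H)
  have hv : Orthonormal 𝕜 v := hsym.orthogonalFamily_eigenspaces.orthonormal_sigma_orthonormal
    fun μ => (bw μ).orthonormal
  have hr := hv.toSubtypeRange
  refine ⟨Set.range v, HilbertBasis.mkOfOrthogonalEqBot hr ?_, ?_⟩
  · rw [Subtype.range_coe, Submodule.eq_bot_iff]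
    intro x hx
    have h1 : x ∈ (⨆ μ, Module.End.eigenspace (C : Module.End 𝕜 H) μ)ᗮ := by
      rw [← Submodule.iInf_orthogonal, Submodule.mem_iInf]
      intro μ y hy
      have h2 : ∀ j, ⟪(bw μ j : H), x⟫_𝕜 = 0 := fun j =>
        hx _ (Submodule.subset_span ⟨⟨μ, j⟩, rfl⟩)
      have h3 := ((bw μ).hasSum_repr ⟨y, hy⟩).mapL
        (Module.End.eigenspace (C : Module.End 𝕜 H) μ).subtypeL
      have h4 := h3.mapL (innerSL 𝕜 x)
      have h5 : HasSum (fun _ : w μ => (0 : 𝕜)) ⟪x, y⟫_𝕜 := by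
        refine h4.congr_fun ?_
        intro j
        simp [inner_eq_zero_symm.1 (h2 j)]
      rw [← inner_conj_symm, h5.unique hasSum_zero, map_zero]
    rw [ContinuousLinearMap.orthogonalComplement_iSup_eigenspaces_eq_bot hC hsym] at h1
    exact h1
  · rintro ⟨_, ⟨a, rfl⟩⟩
    refine ⟨a.1, ?_⟩
    rw [HilbertBasis.coe_mkOfOrthogonalEqBot]
    exact Module.End.mem_eigenspace_iff.1 (bw a.1 a.2).2

/-- Parseval's identity in `[0, ∞]`. -/
theorem tsum_enorm_inner_sq {I : Type*} (b : HilbertBasis I 𝕜 E) (x : E) :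
    ∑' i, ‖⟪b i, x⟫_𝕜‖ₑ ^ 2 = ‖x‖ₑ ^ 2 := by
  have h := b.hasSum_inner_mul_inner x x
  have h1 : HasSum (fun i => ‖⟪b i, x⟫_𝕜‖ ^ 2) (‖x‖ ^ 2) := by
    have h2 := RCLike.reCLM.hasSum h
    rw [RCLike.reCLM_apply, inner_self_eq_norm_sq] at h2
    refine h2.congr_fun fun i => ?_
    rw [← inner_conj_symm x (b i), RCLike.conj_mul]
    norm_cast
  have h3 : ∀ z : ℝ, 0 ≤ z → ENNReal.ofReal z ^ 2 = ENNReal.ofReal (z ^ 2) := fun z hz =>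
    (ENNReal.ofReal_pow hz 2).symm
  simp_rw [← ofReal_norm, h3 _ (norm_nonneg _)]
  rw [← ENNReal.ofReal_tsum_of_nonneg (fun i => sq_nonneg _) h1.summable, h1.tsum_eq]

/-- The form of `T` is nonnegative at `x - p`, for the projection `p` of `x` onto the span of the
eigenvectors `e i`, `i ∈ u`. -/
theorem sum_mul_norm_inner_sq_le {I : Type*} {T : E →L[𝕜] E} (hsym : T.IsSymmetric)
    (hpos : ∀ x, 0 ≤ RCLike.re ⟪T x, x⟫_𝕜) {e : I → E} (he : Orthonormal 𝕜 e) {t : I → ℝ}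
    (hT : ∀ i, T (e i) = (t i : 𝕜) • e i) (u : Finset I) (x : E) :
    ∑ i ∈ u, t i * ‖⟪e i, x⟫_𝕜‖ ^ 2 ≤ RCLike.re ⟪T x, x⟫_𝕜 := by
  classical
  set p := ∑ i ∈ u, ⟪e i, x⟫_𝕜 • e i with hp
  have hTp : T p = ∑ i ∈ u, (⟪e i, x⟫_𝕜 * (t i : 𝕜)) • e i := by
    rw [hp, map_sum]
    simp [hT, smul_smul]
  have h1 : ⟪T p, x⟫_𝕜 = ((∑ i ∈ u, t i * ‖⟪e i, x⟫_𝕜‖ ^ 2 : ℝ) : 𝕜) := by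
    rw [hTp, sum_inner]
    push_cast
    refine Finset.sum_congr rfl fun i _ => ?_
    rw [inner_smul_left, map_mul, RCLike.conj_ofReal, ← RCLike.conj_mul]
    ring
  have h2 : ⟪T p, p⟫_𝕜 = ((∑ i ∈ u, t i * ‖⟪e i, x⟫_𝕜‖ ^ 2 : ℝ) : 𝕜) := by
    rw [hTp, hp, he.inner_sum]
    push_cast
    refine Finset.sum_congr rfl fun i _ => ?_
    rw [map_mul, RCLike.conj_ofReal, ← RCLike.conj_mul]
    ring
  have h3 : RCLike.re ⟪T x, p⟫_𝕜 = RCLike.re ⟪T p, x⟫_𝕜 := by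
    have : ⟪T x, p⟫_𝕜 = ⟪x, T p⟫_𝕜 := hsym x p
    rw [this, inner_re_symm]
  have h := hpos (x - p)
  rw [map_sub, inner_sub_left, inner_sub_right, inner_sub_right, map_sub, map_sub, map_sub, h3,
    h2, h1, RCLike.ofReal_re] at h
  linarith

/-- The diagonal of a positive operator over any Hilbert basis dominates its eigenvalues. -/
theorem tsum_eigenvalues_le {I I' : Type*} {T : E →L[𝕜] E} (hsym : T.IsSymmetric)
    (hpos : ∀ x, 0 ≤ RCLike.re ⟪T x, x⟫_𝕜) {e : I → E} (he : Orthonormal 𝕜 e) {t : I → ℝ}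
    (ht : ∀ i, 0 ≤ t i) (hT : ∀ i, T (e i) = (t i : 𝕜) • e i) (b : HilbertBasis I' 𝕜 E) :
    ∑' i, ENNReal.ofReal (t i) ≤ ∑' k, ENNReal.ofReal (RCLike.re ⟪T (b k), b k⟫_𝕜) := by
  have h1 : ∀ i, ENNReal.ofReal (t i) =
      ∑' k, ENNReal.ofReal (t i) * ‖⟪b k, e i⟫_𝕜‖ₑ ^ 2 := by
    intro i
    rw [ENNReal.tsum_mul_left, tsum_enorm_inner_sq, ← ofReal_norm, he.1 i]
    simp
  rw [tsum_congr h1, ENNReal.tsum_comm]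
  refine ENNReal.tsum_le_tsum fun k => ?_
  rw [ENNReal.tsum_eq_iSup_sum]
  refine iSup_le fun u => ?_
  refine le_trans (le_of_eq ?_) (ENNReal.ofReal_le_ofReal
    (sum_mul_norm_inner_sq_le hsym hpos he hT u (b k)))
  rw [ENNReal.ofReal_sum_of_nonneg fun i _ => mul_nonneg (ht i) (sq_nonneg _)]
  refine Finset.sum_congr rfl fun i _ => ?_
  rw [ENNReal.ofReal_mul (ht i), ENNReal.ofReal_pow (norm_nonneg _), norm_inner_symm,
    ofReal_norm]

/-- A diagonalization of `ι* ι` with positive eigenvalues: an orthonormal basis `u j` of `H` with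
`ι* ι u j = λ j u j`, the latter stated in the form `⟪ι u j, ι h⟫ = λ j ⟪u j, h⟫`. -/
structure EigenSystem (ι : H →L[𝕜] E) (J : Type*) where
  /-- The orthonormal basis of eigenvectors of `ι* ι`. -/
  basis : HilbertBasis J 𝕜 H
  /-- The eigenvalues. -/
  eig : J → ℝ
  eig_pos : ∀ j, 0 < eig j
  inner_eq : ∀ j h, ⟪ι (basis j), ι h⟫_𝕜 = (eig j : 𝕜) * ⟪basis j, h⟫_𝕜

theorem isPositive_comp_adjoint (ι : H →L[𝕜] E) :
    (ι ∘L ContinuousLinearMap.adjoint ι).IsPositive :=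
  ContinuousLinearMap.isPositive_self_comp_adjoint ι

/-- The trace condition makes `ι*` a Hilbert–Schmidt operator, as `ι ι* ≤ ‖ι ι*‖ ^ (1 - s) (ι ι*) ^ s`
for `s ≤ 1`, so `ι* ι` is compact; its kernel is trivial, so the eigenvalues are positive. -/
theorem exists_eigenSystem {ι : H →L[𝕜] E} (hinj : Function.Injective ι) {s : ℝ} (hs0 : 0 ≤ s)
    (hs1 : s ≤ 1)
    (htr : opTrace (opPow (ι ∘L ContinuousLinearMap.adjoint ι) s) < ⊤) :
    ∃ J : Set H, Nonempty (EigenSystem ι J) := by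
  set L := ι ∘L ContinuousLinearMap.adjoint ι with hL
  have hpos : L.IsPositive := isPositive_comp_adjoint ι
  obtain ⟨b, hb⟩ := (exists_hilbertBasis 𝕜 E).choose_spec
  have hsum : Summable fun e => RCLike.re ⟪opPow L s (b e), b e⟫_𝕜 := by
    have h1 : ∑' e, ENNReal.ofReal (RCLike.re ⟪opPow L s (b e), b e⟫_𝕜) ≠ ⊤ := by
      rw [hb]; exact htr.ne
    refine (ENNReal.summable_toReal h1).congr fun e => ?_
    exact ENNReal.toReal_ofReal (re_inner_opPow_nonneg hpos hs0 _)
  have hHS : Summable fun e => ‖ContinuousLinearMap.adjoint ι (b e)‖ ^ 2 := by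
    refine Summable.of_nonneg_of_le (fun _ => sq_nonneg _) (fun e => ?_)
      (hsum.mul_left (‖L‖ ^ (1 - s)))
    refine le_trans (le_of_eq ?_) (re_inner_le_opPow hpos hs0 hs1 (b e))
    rw [hL, ContinuousLinearMap.comp_apply, ← ContinuousLinearMap.adjoint_inner_right,
      inner_self_eq_norm_sq]
  have hcomp : IsCompactOperator (ContinuousLinearMap.adjoint ι ∘L ι) :=
    (isCompactOperator_of_summable_norm_sq b _ hHS).comp_clm ι
  have hsym : (ContinuousLinearMap.adjoint ι ∘L ι).IsSymmetric :=
    (ContinuousLinearMap.isPositive_adjoint_comp_self ι).isSymmetric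
  obtain ⟨J, u, hu⟩ := exists_hilbertBasis_eigenvectors hcomp hsym
  refine ⟨J, ⟨u, fun j => ‖ι (u j)‖ ^ 2, fun j => ?_, fun j h => ?_⟩⟩
  · have h1 : u j ≠ 0 := u.orthonormal.ne_zero j
    have h2 : ι (u j) ≠ 0 := fun h => h1 (hinj (by rw [h, map_zero]))
    positivity
  · obtain ⟨μ, hμ⟩ := hu j
    rw [ContinuousLinearMap.comp_apply] at hμ
    have h1 : ∀ h, ⟪ι (u j), ι h⟫_𝕜 = (starRingEnd 𝕜) μ * ⟪u j, h⟫_𝕜 := fun h => by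
      rw [← ContinuousLinearMap.adjoint_inner_left, hμ, inner_smul_left]
    have h2 := h1 (u j)
    rw [inner_self_eq_norm_sq_to_K, inner_self_eq_norm_sq_to_K, u.orthonormal.1 j] at h2
    rw [h1]
    congr 1
    simpa using h2.symm

namespace EigenSystem

variable {ι : H →L[𝕜] E} {J : Type*} (S : EigenSystem ι J)

theorem norm_sq_image (j : J) : ‖ι (S.basis j)‖ ^ 2 = S.eig j := by
  have h := S.inner_eq j (S.basis j)
  rw [inner_self_eq_norm_sq_to_K, inner_self_eq_norm_sq_to_K, S.basis.orthonormal.1 j] at h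
  have h2 : ((‖ι (S.basis j)‖ ^ 2 : ℝ) : 𝕜) = ((S.eig j : ℝ) : 𝕜) := by
    push_cast
    simpa using h
  exact_mod_cast h2

theorem adjoint_image (j : J) :
    ContinuousLinearMap.adjoint ι (ι (S.basis j)) = (S.eig j : 𝕜) • S.basis j := by
  refine ext_inner_right 𝕜 fun h => ?_
  rw [ContinuousLinearMap.adjoint_inner_left, S.inner_eq, inner_smul_left, RCLike.conj_ofReal]

/-- The normalized images of the eigenvectors of `ι* ι` are eigenvectors of `ι ι*`. -/
noncomputable def vec (j : J) : E := (((√(S.eig j))⁻¹ : ℝ) : 𝕜) • ι (S.basis j)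

theorem image_eq (j : J) : ι (S.basis j) = ((√(S.eig j) : ℝ) : 𝕜) • S.vec j := by
  have h : √(S.eig j) ≠ 0 := (Real.sqrt_pos.2 (S.eig_pos j)).ne'
  rw [vec, smul_smul, ← RCLike.ofReal_mul, mul_inv_cancel₀ h]
  simp

theorem orthonormal_vec : Orthonormal 𝕜 S.vec := by
  classical
  rw [orthonormal_iff_ite]
  intro i j
  have hi : 0 < √(S.eig i) := Real.sqrt_pos.2 (S.eig_pos i)
  rw [vec, vec, inner_smul_left, inner_smul_right, S.inner_eq,
    orthonormal_iff_ite.1 S.basis.orthonormal i j]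
  split_ifs with hij
  · subst hij
    rw [RCLike.conj_ofReal, mul_one, ← RCLike.ofReal_mul, ← RCLike.ofReal_mul]
    rw [← RCLike.ofReal_one]
    congr 1
    have := Real.mul_self_sqrt (S.eig_pos i).le
    field_simp
    linarith
  · simp

theorem operator_vec (j : J) :
    (ι ∘L ContinuousLinearMap.adjoint ι) (S.vec j) = (S.eig j : 𝕜) • S.vec j := by
  rw [vec, ContinuousLinearMap.comp_apply, map_smul, S.adjoint_image, map_smul, map_smul,
    smul_comm]

theorem eig_le (j : J) : S.eig j ≤ ‖ι ∘L ContinuousLinearMap.adjoint ι‖ :=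
  (eigenvalue_mem_Icc (isPositive_comp_adjoint ι) (S.orthonormal_vec.ne_zero j)
    (S.operator_vec j)).2

theorem tsum_eig_rpow_lt_top {s : ℝ} (hs0 : 0 ≤ s)
    (htr : opTrace (opPow (ι ∘L ContinuousLinearMap.adjoint ι) s) < ⊤) :
    ∑' j, ENNReal.ofReal (S.eig j ^ s) < ⊤ := by
  have hpos := isPositive_comp_adjoint ι
  obtain ⟨b, hb⟩ := (exists_hilbertBasis 𝕜 E).choose_spec
  refine lt_of_le_of_lt (tsum_eigenvalues_le (opPow_isSymmetric hpos hs0)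
    (re_inner_opPow_nonneg hpos hs0) S.orthonormal_vec
    (fun j => Real.rpow_nonneg (S.eig_pos j).le s)
    (fun j => opPow_apply_eigenvector hpos hs0 (S.eig_pos j) (S.operator_vec j)) b) ?_
  rw [hb]
  exact htr

theorem tsum_enorm_inner_vec_sq_lt_top (g : E) : ∑' j, ‖⟪S.vec j, g⟫_𝕜‖ₑ ^ 2 < ⊤ := by
  refine lt_of_le_of_lt ?_ (ENNReal.ofReal_lt_top (r := ‖g‖ ^ 2))
  rw [ENNReal.tsum_eq_iSup_sum]
  refine iSup_le fun u => ?_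
  refine le_trans (le_of_eq ?_) (ENNReal.ofReal_le_ofReal
    (S.orthonormal_vec.sum_inner_products_le (s := u) g))
  rw [ENNReal.ofReal_sum_of_nonneg fun i _ => sq_nonneg _]
  refine Finset.sum_congr rfl fun i _ => ?_
  rw [ENNReal.ofReal_pow (norm_nonneg _), ofReal_norm]

/-- The range of `(ι ι*) ^ r` with `1 / 2 < r` lies in the range of `ι`: the vector
`h = ∑ⱼ λⱼ ^ (r - 1/2) ⟪eⱼ, g⟫ uⱼ` satisfies `ι h = (ι ι*) ^ r g`. -/
theorem exists_preimage_opPow {r : ℝ} (hr : 1 / 2 < r) (g : E) :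
    ∃ hd : H, ι hd = opPow (ι ∘L ContinuousLinearMap.adjoint ι) r g ∧
      ∀ j, ⟪S.basis j, hd⟫_𝕜 = ((S.eig j ^ (r - 1 / 2) : ℝ) : 𝕜) * ⟪S.vec j, g⟫_𝕜 := by
  set L := ι ∘L ContinuousLinearMap.adjoint ι with hL
  have hpos : L.IsPositive := isPositive_comp_adjoint ι
  set f : J → 𝕜 := fun j => ((S.eig j ^ (r - 1 / 2) : ℝ) : 𝕜) * ⟪S.vec j, g⟫_𝕜 with hf
  have hmem : Memℓp f 2 := by
    refine memℓp_gen ?_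
    refine Summable.of_nonneg_of_le (fun _ => by positivity) (fun j => ?_)
      ((S.orthonormal_vec.inner_products_summable g).mul_left ((‖L‖ ^ (r - 1 / 2)) ^ 2))
    have h1 : S.eig j ^ (r - 1 / 2) ≤ ‖L‖ ^ (r - 1 / 2) :=
      Real.rpow_le_rpow (S.eig_pos j).le (S.eig_le j) (by linarith)
    have h0 : 0 ≤ S.eig j ^ (r - 1 / 2) := Real.rpow_nonneg (S.eig_pos j).le _
    simp only [ENNReal.toReal_ofNat, Real.rpow_ofNat, hf, norm_mul, RCLike.norm_ofReal,
      abs_of_nonneg h0, mul_pow]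
    gcongr
  let hd : H := S.basis.repr.symm ⟨f, hmem⟩
  have hcoef : ∀ j, ⟪S.basis j, hd⟫_𝕜 = f j := fun j => by
    rw [← S.basis.repr_apply_apply]
    simp [hd]
  refine ⟨hd, ?_, hcoef⟩
  -- the difference `ι hd - L ^ r g` is orthogonal to the eigenvectors, hence it lies in the kernel
  -- of `ι*`; there `L ^ r` vanishes, so the difference is orthogonal to `L ^ r g` and to `ι hd`
  have hvec : ∀ j, ⟪S.vec j, ι hd - opPow L r g⟫_𝕜 = 0 := by
    intro j
    have h0 : √(S.eig j) ≠ 0 := (Real.sqrt_pos.2 (S.eig_pos j)).ne'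
    have h1 : ⟪S.vec j, opPow L r g⟫_𝕜 = ((S.eig j ^ r : ℝ) : 𝕜) * ⟪S.vec j, g⟫_𝕜 := by
      have h2 : ⟪opPow L r (S.vec j), g⟫_𝕜 = ⟪S.vec j, opPow L r g⟫_𝕜 :=
        opPow_isSymmetric hpos (by linarith) _ _
      rw [← h2, opPow_apply_eigenvector hpos (by linarith) (S.eig_pos j) (S.operator_vec j),
        inner_smul_left, RCLike.conj_ofReal]
    rw [inner_sub_right, h1, sub_eq_zero, vec, inner_smul_left, S.inner_eq, hcoef]
    simp only [hf, vec]
    rw [RCLike.conj_ofReal, ← mul_assoc, ← mul_assoc, ← RCLike.ofReal_mul, ← RCLike.ofReal_mul]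
    congr 2
    have h3 : S.eig j ^ r = S.eig j ^ (r - 1 / 2) * √(S.eig j) := by
      rw [Real.sqrt_eq_rpow, ← Real.rpow_add (S.eig_pos j)]
      congr 1
      ring
    rw [h3]
    have h4 := Real.mul_self_sqrt (S.eig_pos j).le
    field_simp
    rw [sq, h4]
  have hker : ContinuousLinearMap.adjoint ι (ι hd - opPow L r g) = 0 := by
    rw [← S.basis.repr.map_eq_zero_iff]
    ext j
    rw [S.basis.repr_apply_apply, ContinuousLinearMap.adjoint_inner_right, S.image_eq,
      inner_smul_left, hvec]
    simp
  have hw : opPow L r (ι hd - opPow L r g) = 0 :=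
    opPow_apply_of_ker hpos (by linarith) (by rw [hL, ContinuousLinearMap.comp_apply, hker, map_zero])
  have h2 : ⟪ι hd - opPow L r g, opPow L r g⟫_𝕜 = 0 := by
    have h3 : ⟪opPow L r (ι hd - opPow L r g), g⟫_𝕜 = ⟪ι hd - opPow L r g, opPow L r g⟫_𝕜 :=
      opPow_isSymmetric hpos (by linarith) _ _
    rw [← h3, hw, inner_zero_left]
  have h4 : ⟪ι hd - opPow L r g, ι hd - opPow L r g⟫_𝕜 = 0 := by
    conv_lhs => rw [inner_sub_right]
    rw [h2, ← ContinuousLinearMap.adjoint_inner_left, hker, inner_zero_left, sub_zero]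
  exact sub_eq_zero.1 (inner_self_eq_zero.1 h4)

end EigenSystem

end Spectral

/-! ### One step of the iteration, and the risk -/

theorem enorm_sq_eq_ofReal {F : Type*} [NormedAddCommGroup F] (a : F) :
    ‖a‖ₑ ^ 2 = ENNReal.ofReal (‖a‖ ^ 2) := by
  rw [ENNReal.ofReal_pow (norm_nonneg _), ofReal_norm]

theorem enorm_sub_sq_le {F : Type*} [NormedAddCommGroup F] (a b : F) :
    ‖a - b‖ₑ ^ 2 ≤ 2 * ‖a‖ₑ ^ 2 + 2 * ‖b‖ₑ ^ 2 := by
  simp_rw [enorm_sq_eq_ofReal]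
  rw [show (2 : ℝ≥0∞) = ENNReal.ofReal 2 by simp, ← ENNReal.ofReal_mul (by norm_num),
    ← ENNReal.ofReal_mul (by norm_num), ← ENNReal.ofReal_add (by positivity) (by positivity)]
  refine ENNReal.ofReal_le_ofReal ?_
  have h := norm_sub_le a b
  nlinarith [norm_nonneg (a - b), norm_nonneg a, norm_nonneg b, sq_nonneg (‖a‖ - ‖b‖)]

theorem lintegral_fst_comp {X Y : Type*} [MeasurableSpace X] [MeasurableSpace Y]
    {ρ : Measure (X × Y)} {f : X → ℝ≥0∞} (hf : Measurable f) :
    ∫⁻ z, f z.1 ∂ρ = ∫⁻ x, f x ∂ρ.fst := by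
  rw [Measure.fst, lintegral_map hf measurable_fst]

section OneStep

variable {𝕜 : Type*} [RCLike 𝕜]

/-- The mean square of `c - η f`, for an `f` with the mean `l c`: the variance of `f` is at most its
mean square. -/
theorem lintegral_enorm_sub_mul_sq_le {α : Type*} [MeasurableSpace α] {P : Measure α}
    [IsProbabilityMeasure P] {f : α → 𝕜} (hf : MemLp f 2 P) (c : 𝕜) (η l : ℝ)
    (hmean : ∫ w, f w ∂P = (l : 𝕜) * c) :
    ∫⁻ w, ‖c - (η : 𝕜) * f w‖ₑ ^ 2 ∂P ≤
      ENNReal.ofReal ((1 - η * l) ^ 2) * ‖c‖ₑ ^ 2 + ENNReal.ofReal (η ^ 2) * ∫⁻ w, ‖f w‖ₑ ^ 2 ∂P := by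
  have hf1 : Integrable f P := hf.integrable (by norm_num)
  have hf2 : Integrable (fun w => ‖f w‖ ^ 2) P := hf.integrable_norm_pow (by norm_num)
  have hpt : ∀ w, ‖c - (η : 𝕜) * f w‖ ^ 2 =
      ‖c‖ ^ 2 - 2 * η * RCLike.re ((starRingEnd 𝕜) c * f w) + η ^ 2 * ‖f w‖ ^ 2 := by
    intro w
    have h := @norm_sub_sq 𝕜 𝕜 _ _ _ c ((η : 𝕜) * f w)
    rw [h, norm_mul, RCLike.norm_ofReal, mul_pow, sq_abs, RCLike.inner_apply']
    have : (starRingEnd 𝕜) c * ((η : 𝕜) * f w) = (η : 𝕜) * ((starRingEnd 𝕜) c * f w) := by ring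
    rw [this, RCLike.re_ofReal_mul]
    ring
  have hg : Integrable (fun w => RCLike.re ((starRingEnd 𝕜) c * f w)) P :=
    (hf1.const_mul _).re
  have hint : Integrable (fun w => ‖c - (η : 𝕜) * f w‖ ^ 2) P := by
    simp_rw [hpt]
    exact ((integrable_const _).sub (hg.const_mul _)).add (hf2.const_mul _)
  have hre : ∫ w, RCLike.re ((starRingEnd 𝕜) c * f w) ∂P = l * ‖c‖ ^ 2 := by
    rw [integral_re (hf1.const_mul _), integral_const_mul, hmean]
    have : (starRingEnd 𝕜) c * ((l : 𝕜) * c) = (l : 𝕜) * ((starRingEnd 𝕜) c * c) := by ring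
    rw [this, RCLike.re_ofReal_mul, RCLike.conj_mul]
    norm_cast
  have hval : ∫ w, ‖c - (η : 𝕜) * f w‖ ^ 2 ∂P =
      (1 - 2 * η * l) * ‖c‖ ^ 2 + η ^ 2 * ∫ w, ‖f w‖ ^ 2 ∂P := by
    simp_rw [hpt]
    have h1 : Integrable (fun w => ‖c‖ ^ 2 - 2 * η * RCLike.re ((starRingEnd 𝕜) c * f w)) P :=
      (integrable_const _).sub (hg.const_mul _)
    rw [integral_add h1 (hf2.const_mul _),
      integral_sub (integrable_const _) (hg.const_mul _), integral_const_mul, integral_const_mul,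
      hre]
    simp
    ring
  simp_rw [enorm_sq_eq_ofReal]
  rw [← ofReal_integral_eq_lintegral_ofReal hint (Eventually.of_forall fun _ => by positivity),
    ← ofReal_integral_eq_lintegral_ofReal hf2 (Eventually.of_forall fun _ => by positivity),
    hval, ← ENNReal.ofReal_mul (by positivity), ← ENNReal.ofReal_mul (by positivity),
    ← ENNReal.ofReal_add (by positivity)
      (mul_nonneg (by positivity) (integral_nonneg fun _ => by positivity))]
  refine ENNReal.ofReal_le_ofReal ?_
  have : 0 ≤ (η * l) ^ 2 * ‖c‖ ^ 2 := by positivity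
  nlinarith

end OneStep

section Noise

variable {𝕜 : Type*} [RCLike 𝕜]
    {X : Type*} [TopologicalSpace X] [PolishSpace X] [MeasurableSpace X] [BorelSpace X]
    {Y : Type*} [NormedAddCommGroup Y] [InnerProductSpace 𝕜 Y] [NormedSpace ℝ Y] [CompleteSpace Y]
    [SecondCountableTopology Y] [MeasurableSpace Y] [BorelSpace Y]
    {H : Type*} [NormedAddCommGroup H] [InnerProductSpace 𝕜 H] [CompleteSpace H] [RKHS 𝕜 H X Y]
    {κ : ℝ} (hK : IsBoundedMercer (X := X) (Y := Y) H κ)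
    {ρ : Measure (X × Y)} [IsProbabilityMeasure ρ] {σ : ℝ}
    {hd : H}

include hK

theorem measurable_coe (u : H) : Measurable (u : X → Y) := (hK.continuous u).measurable

/-- Integration of the bound of the conditional variance against a weight that depends on `x` only. -/
theorem cond_noise_le (hnoise : CondNoiseBounded ρ σ)
    (hhd : (hd : X → Y) =ᵐ[ρ.fst] regression ρ) {φ : X → ℝ≥0∞} (hφ : Measurable φ) :
    ∫⁻ z, φ z.1 * ‖z.2 - hd z.1‖ₑ ^ 2 ∂ρ ≤ ENNReal.ofReal (σ ^ 2) * ∫⁻ x, φ x ∂ρ.fst := by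
  have hm : Measurable fun z : X × Y => ‖z.2 - hd z.1‖ₑ ^ 2 :=
    ((measurable_snd.sub ((measurable_coe hK hd).comp measurable_fst)).enorm).pow_const 2
  rw [← ρ.lintegral_condKernel (f := fun z => φ z.1 * ‖z.2 - hd z.1‖ₑ ^ 2)
    ((hφ.comp measurable_fst).mul hm), ← lintegral_const_mul _ hφ]
  refine lintegral_mono_ae ?_
  filter_upwards [hnoise, hhd] with x hx hx'
  have hm' : Measurable fun y => ‖y - hd x‖ₑ ^ 2 := hm.comp measurable_prodMk_left
  rw [lintegral_const_mul _ hm', mul_comm]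
  gcongr
  rwa [hx']

theorem noise_memLp (hnoise : CondNoiseBounded ρ σ)
    (hhd : (hd : X → Y) =ᵐ[ρ.fst] regression ρ) :
    MemLp (fun z : X × Y => z.2 - hd z.1) 2 ρ := by
  have hm : Measurable fun z : X × Y => z.2 - hd z.1 :=
    measurable_snd.sub ((measurable_coe hK hd).comp measurable_fst)
  refine ⟨hm.aestronglyMeasurable, ?_⟩
  rw [eLpNorm_lt_top_iff_lintegral_rpow_enorm_lt_top (by norm_num) (by norm_num)]
  have h := cond_noise_le hK hnoise hhd (φ := fun _ => 1) measurable_const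
  simp only [one_mul, lintegral_const, measure_univ, mul_one] at h
  simpa using h.trans_lt ENNReal.ofReal_lt_top

theorem norm_apply_memLp (u : H) : MemLp (fun z : X × Y => u z.1) 2 ρ := by
  refine MemLp.of_bound ?_ (|κ| * ‖u‖) (Eventually.of_forall fun z => hK.norm_apply_le u z.1)
  exact ((measurable_coe hK u).comp measurable_fst).aestronglyMeasurable

theorem integrable_inner_noise (hnoise : CondNoiseBounded ρ σ)
    (hhd : (hd : X → Y) =ᵐ[ρ.fst] regression ρ) (u : H) :
    Integrable (fun z : X × Y => ⟪u z.1, z.2 - hd z.1⟫_𝕜) ρ := by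
  have h1 := noise_memLp hK hnoise hhd
  refine (((h1.integrable (by norm_num)).norm).const_mul (|κ| * ‖u‖)).mono'
    (((measurable_coe hK u).comp measurable_fst).aestronglyMeasurable.inner
      h1.aestronglyMeasurable) (Eventually.of_forall fun z => ?_)
  exact (norm_inner_le_norm _ _).trans (mul_le_mul_of_nonneg_right (hK.norm_apply_le u z.1)
    (norm_nonneg _))

/-- The noise `y - h†(x)` has conditional mean zero. -/
theorem integral_inner_noise (hnoise : CondNoiseBounded ρ σ)
    (hhd : (hd : X → Y) =ᵐ[ρ.fst] regression ρ) (u : H) :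
    ∫ z, ⟪u z.1, z.2 - hd z.1⟫_𝕜 ∂ρ = 0 := by
  rw [← ρ.integral_condKernel (integrable_inner_noise hK hnoise hhd u)]
  refine integral_eq_zero_of_ae ?_
  filter_upwards [hnoise, hhd] with x hx hx'
  have hm : MemLp (fun y : Y => y - regression ρ x) 2 (ρ.condKernel x) := by
    refine ⟨(measurable_id.sub_const _).aestronglyMeasurable, ?_⟩
    rw [eLpNorm_lt_top_iff_lintegral_rpow_enorm_lt_top (by norm_num) (by norm_num)]
    simpa using hx.trans_lt ENNReal.ofReal_lt_top
  have hi : Integrable (fun y : Y => y - regression ρ x) (ρ.condKernel x) :=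
    hm.integrable (by norm_num)
  have hid : Integrable (fun y : Y => y) (ρ.condKernel x) := by
    refine (hi.add (integrable_const (regression ρ x))).congr (Eventually.of_forall fun y => ?_)
    simp
  simp only [hx', Pi.zero_apply]
  rw [integral_inner hi, integral_sub hid (integrable_const _)]
  simp [regression]

theorem integral_inner_fst (u v : H) :
    ∫ z, ⟪u z.1, v z.1⟫_𝕜 ∂ρ = ⟪embedding ρ.fst hK u, embedding ρ.fst hK v⟫_𝕜 := by
  rw [L2.inner_def]
  have h1 : ∫ x, ⟪embedding ρ.fst hK u x, embedding ρ.fst hK v x⟫_𝕜 ∂ρ.fst =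
      ∫ x, ⟪u x, v x⟫_𝕜 ∂ρ.fst := by
    refine integral_congr_ae ?_
    filter_upwards [embedding_ae_eq ρ.fst hK u, embedding_ae_eq ρ.fst hK v] with x hx hx'
    rw [hx, hx']
  rw [h1, Measure.fst, integral_map measurable_fst.aemeasurable]
  exact (measurable_coe hK u).aestronglyMeasurable.inner (measurable_coe hK v).aestronglyMeasurable

/-- The `L²` norm of the embedding as a Lebesgue integral. -/
theorem lintegral_enorm_apply_sq (u : H) :
    ∫⁻ x, ‖u x‖ₑ ^ 2 ∂ρ.fst = ‖embedding ρ.fst hK u‖ₑ ^ 2 := by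
  have h1 : ∫⁻ x, ‖embedding ρ.fst hK u x‖ₑ ^ 2 ∂ρ.fst = ∫⁻ x, ‖u x‖ₑ ^ 2 ∂ρ.fst := by
    refine lintegral_congr_ae ?_
    filter_upwards [embedding_ae_eq ρ.fst hK u] with x hx
    rw [hx]
  rw [← h1, Lp.enorm_def, eLpNorm_eq_lintegral_rpow_enorm_toReal (by norm_num) (by norm_num)]
  rw [← ENNReal.rpow_natCast, ← ENNReal.rpow_mul]
  simp

theorem norm_kerFun_le (x : X) : ‖kerFun H x‖ ≤ |κ| := by
  rw [norm_kerFun_eq_sqrt_norm_kernel, ← Real.sqrt_sq_eq_abs]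
  exact Real.sqrt_le_sqrt (hK.norm_kernel_le x)

/-- The mean square of a coordinate of the error after one step of the stochastic approximation: a
contraction by `(1 - η λⱼ)²`, the multiplicative noise, and the additive noise. -/
theorem one_step {J : Type*} (S : EigenSystem (embedding ρ.fst hK) J)
    (hnoise : CondNoiseBounded ρ σ) (hhd : (hd : X → Y) =ᵐ[ρ.fst] regression ρ) (h : H) (η : ℝ)
    (j : J) :
    ∫⁻ w, ‖⟪S.basis j, h - (η : 𝕜) • kerFun H w.1 (h w.1 - w.2) - hd⟫_𝕜‖ₑ ^ 2 ∂ρ ≤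
      ENNReal.ofReal ((1 - η * S.eig j) ^ 2) * ‖⟪S.basis j, h - hd⟫_𝕜‖ₑ ^ 2 +
      ENNReal.ofReal (2 * η ^ 2) * (∫⁻ x, ‖⟪S.basis j x, (h - hd) x⟫_𝕜‖ₑ ^ 2 ∂ρ.fst +
        ENNReal.ofReal (σ ^ 2 * S.eig j)) := by
  set u := S.basis j with hu
  set e := h - hd with he
  let f : X × Y → 𝕜 := fun w => ⟪u w.1, e w.1⟫_𝕜 - ⟪u w.1, w.2 - hd w.1⟫_𝕜
  have hmu := measurable_coe hK u
  have hme := measurable_coe hK e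
  have hmf1 : Measurable fun x => ⟪u x, e x⟫_𝕜 := hmu.inner hme
  have hmf2 : Measurable fun w : X × Y => ⟪u w.1, w.2 - hd w.1⟫_𝕜 :=
    (hmu.comp measurable_fst).inner
      (measurable_snd.sub ((measurable_coe hK hd).comp measurable_fst))
  have hrew : ∀ w : X × Y, ⟪u, h - (η : 𝕜) • kerFun H w.1 (h w.1 - w.2) - hd⟫_𝕜 =
      ⟪u, e⟫_𝕜 - (η : 𝕜) * f w := by
    intro w
    have h1 : h - (η : 𝕜) • kerFun H w.1 (h w.1 - w.2) - hd =
        e - (η : 𝕜) • kerFun H w.1 (h w.1 - w.2) := by rw [he]; abel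
    have h2 : h w.1 - w.2 = e w.1 - (w.2 - hd w.1) := by
      rw [he, RKHS.coe_sub, Pi.sub_apply]; abel
    rw [h1, inner_sub_right u e, inner_smul_right, inner_kerFun, h2, inner_sub_right (u w.1)]
  have hb1 : MemLp (fun w : X × Y => ⟪u w.1, e w.1⟫_𝕜) 2 ρ := by
    refine MemLp.of_bound (hmf1.comp measurable_fst).aestronglyMeasurable
      ((|κ| * ‖u‖) * (|κ| * ‖e‖)) (Eventually.of_forall fun z => ?_)
    exact (norm_inner_le_norm _ _).trans (mul_le_mul (hK.norm_apply_le u z.1)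
      (hK.norm_apply_le e z.1) (norm_nonneg _) (by positivity))
  have hb2 : MemLp (fun w : X × Y => ⟪u w.1, w.2 - hd w.1⟫_𝕜) 2 ρ := by
    refine ((noise_memLp hK hnoise hhd).norm.const_mul (|κ| * ‖u‖)).mono
      hmf2.aestronglyMeasurable (Eventually.of_forall fun z => ?_)
    refine (norm_inner_le_norm _ _).trans (le_trans ?_ (le_abs_self _))
    exact mul_le_mul_of_nonneg_right (hK.norm_apply_le u z.1) (norm_nonneg _)
  have hmem : MemLp f 2 ρ := hb1.sub hb2
  have hmean : ∫ w, f w ∂ρ = (S.eig j : 𝕜) * ⟪u, e⟫_𝕜 := by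
    rw [integral_sub (hb1.integrable (by norm_num)) (hb2.integrable (by norm_num)),
      integral_inner_noise hK hnoise hhd, integral_inner_fst hK, S.inner_eq, sub_zero]
  simp_rw [hrew]
  refine (lintegral_enorm_sub_mul_sq_le hmem ⟪u, e⟫_𝕜 η (S.eig j) hmean).trans ?_
  refine add_le_add_right ?_ _
  have hle : ∫⁻ w, ‖f w‖ₑ ^ 2 ∂ρ ≤ 2 * (∫⁻ x, ‖⟪u x, e x⟫_𝕜‖ₑ ^ 2 ∂ρ.fst +
        ENNReal.ofReal (σ ^ 2 * S.eig j)) := by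
    calc ∫⁻ w, ‖f w‖ₑ ^ 2 ∂ρ
        ≤ ∫⁻ w, (2 * ‖⟪u w.1, e w.1⟫_𝕜‖ₑ ^ 2 +
            2 * (‖u w.1‖ₑ ^ 2 * ‖w.2 - hd w.1‖ₑ ^ 2)) ∂ρ := by
          refine lintegral_mono fun w => (enorm_sub_sq_le _ _).trans ?_
          gcongr
          rw [← mul_pow]
          gcongr
          rw [← ofReal_norm, ← ofReal_norm, ← ofReal_norm, ← ENNReal.ofReal_mul (norm_nonneg _)]
          exact ENNReal.ofReal_le_ofReal (norm_inner_le_norm _ _)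
      _ = 2 * ∫⁻ x, ‖⟪u x, e x⟫_𝕜‖ₑ ^ 2 ∂ρ.fst +
            2 * ∫⁻ w, ‖u w.1‖ₑ ^ 2 * ‖w.2 - hd w.1‖ₑ ^ 2 ∂ρ := by
          have hmf3 : Measurable fun w : X × Y => ‖⟪u w.1, e w.1⟫_𝕜‖ₑ ^ 2 :=
            (hmf1.comp measurable_fst).enorm.pow_const 2
          rw [lintegral_add_left (hmf3.const_mul 2), lintegral_const_mul _ hmf3,
            lintegral_const_mul', lintegral_fst_comp (f := fun x => ‖⟪u x, e x⟫_𝕜‖ₑ ^ 2)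
              (hmf1.enorm.pow_const 2)]
          norm_num
      _ ≤ _ := by
          rw [mul_add]
          gcongr
          refine (cond_noise_le hK hnoise hhd (φ := fun x => ‖u x‖ₑ ^ 2)
            (hmu.enorm.pow_const 2)).trans (le_of_eq ?_)
          rw [lintegral_enorm_apply_sq hK, enorm_sq_eq_ofReal, S.norm_sq_image,
            ← ENNReal.ofReal_mul (sq_nonneg _)]
  refine (mul_le_mul_right hle _).trans (le_of_eq ?_)
  rw [mul_comm 2 (η ^ 2), ENNReal.ofReal_mul (p := η ^ 2) (by positivity), mul_assoc]
  simp

theorem regression_ae_eq (hhd : (hd : X → Y) =ᵐ[ρ.fst] regression ρ) :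
    ∀ᵐ z ∂ρ, hd z.1 = regression ρ z.1 :=
  ae_of_ae_map measurable_fst.aemeasurable hhd

theorem residual_memLp (hnoise : CondNoiseBounded ρ σ)
    (hhd : (hd : X → Y) =ᵐ[ρ.fst] regression ρ) (h : H) :
    MemLp (fun z : X × Y => h z.1 - z.2) 2 ρ := by
  refine ((norm_apply_memLp hK (h - hd)).sub (noise_memLp hK hnoise hhd)).congr_norm ?_ ?_
  · exact (((measurable_coe hK h).comp measurable_fst).sub measurable_snd).aestronglyMeasurable
  · refine Eventually.of_forall fun z => ?_
    simp

theorem integrable_risk (hnoise : CondNoiseBounded ρ σ)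
    (hhd : (hd : X → Y) =ᵐ[ρ.fst] regression ρ) (h : H) :
    Integrable (fun z : X × Y => ‖h z.1 - z.2‖ ^ 2) ρ :=
  (residual_memLp hK hnoise hhd h).integrable_norm_pow (by norm_num)

theorem risk_regression (hhd : (hd : X → Y) =ᵐ[ρ.fst] regression ρ) :
    risk ρ (regression ρ) = risk ρ hd := by
  refine integral_congr_ae ?_
  filter_upwards [regression_ae_eq hK hhd] with z hz
  rw [hz]

/-- The excess risk of `h` is the squared distance of `h` to the regression operator in `L²`. -/
theorem risk_sub_risk (hnoise : CondNoiseBounded ρ σ)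
    (hhd : (hd : X → Y) =ᵐ[ρ.fst] regression ρ) (h : H) :
    risk ρ h - risk ρ (regression ρ) = ‖embedding ρ.fst hK (h - hd)‖ ^ 2 := by
  rw [risk_regression hK hhd, risk, risk, ← integral_sub (integrable_risk hK hnoise hhd h)
    (integrable_risk hK hnoise hhd hd)]
  have hpt : ∀ z : X × Y, ‖h z.1 - z.2‖ ^ 2 - ‖hd z.1 - z.2‖ ^ 2 =
      RCLike.re ⟪(h - hd) z.1, (h - hd) z.1⟫_𝕜 -
        2 * RCLike.re ⟪(h - hd) z.1, z.2 - hd z.1⟫_𝕜 := by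
    intro z
    have h1 : h z.1 - z.2 = (h - hd) z.1 - (z.2 - hd z.1) := by simp
    rw [h1, @norm_sub_sq 𝕜, inner_self_eq_norm_sq, norm_sub_rev (hd z.1)]
    ring
  simp_rw [hpt]
  have hi1 : Integrable (fun z : X × Y => ⟪(h - hd) z.1, (h - hd) z.1⟫_𝕜) ρ := by
    have h2 := (norm_apply_memLp hK (ρ := ρ) (h - hd)).integrable_norm_pow (p := 2) (by norm_num)
    have h3 : Integrable (fun z : X × Y => ((‖(h - hd) z.1‖ ^ 2 : ℝ) : 𝕜)) ρ := h2.ofReal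
    refine h3.congr (Eventually.of_forall fun z => ?_)
    simp only [inner_self_eq_norm_sq_to_K]
    push_cast
    rfl
  have hi2 := integrable_inner_noise hK hnoise hhd (h - hd)
  rw [integral_sub hi1.re (hi2.re.const_mul 2), integral_const_mul, integral_re hi1,
    integral_re hi2, integral_inner_noise hK hnoise hhd, integral_inner_fst hK,
    inner_self_eq_norm_sq]
  simp

end Noise

/-! ### Mean square errors along the iteration -/

/-- Parseval's identity for the image under `ι`, in `[0, ∞]`. -/
theorem EigenSystem.tsum_enorm_image_sq {𝕜 E H J : Type*} [RCLike 𝕜] [NormedAddCommGroup E]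
    [InnerProductSpace 𝕜 E] [CompleteSpace E] [NormedAddCommGroup H] [InnerProductSpace 𝕜 H]
    [CompleteSpace H] {ι : H →L[𝕜] E} (S : EigenSystem ι J) (h : H) :
    ∑' j, ENNReal.ofReal (S.eig j) * ‖⟪S.basis j, h⟫_𝕜‖ₑ ^ 2 = ‖ι h‖ₑ ^ 2 := by
  have h0 := S.basis.hasSum_inner_mul_inner h (ContinuousLinearMap.adjoint ι (ι h))
  have h1 : HasSum (fun j => S.eig j * ‖⟪S.basis j, h⟫_𝕜‖ ^ 2) (‖ι h‖ ^ 2) := by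
    have h2 := RCLike.reCLM.hasSum h0
    rw [RCLike.reCLM_apply, ContinuousLinearMap.adjoint_inner_right, inner_self_eq_norm_sq] at h2
    refine h2.congr_fun fun j => ?_
    rw [ContinuousLinearMap.adjoint_inner_right, S.inner_eq, mul_left_comm,
      ← inner_conj_symm h (S.basis j), RCLike.conj_mul, RCLike.re_ofReal_mul]
    norm_cast
  simp_rw [enorm_sq_eq_ofReal, ← ENNReal.ofReal_mul (S.eig_pos _).le]
  rw [← ENNReal.ofReal_tsum_of_nonneg (fun j => mul_nonneg (S.eig_pos j).le (sq_nonneg _))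
    h1.summable, h1.tsum_eq]

theorem countable_of_tsum_lt_top {J : Type*} {f : J → ℝ} (hf : ∀ j, 0 < f j)
    (h : ∑' j, ENNReal.ofReal (f j) < ⊤) : Countable J := by
  have h1 := Summable.countable_support_ennreal h.ne
  have h2 : Function.support (fun j => ENNReal.ofReal (f j)) = Set.univ := by
    ext j
    simp [hf j]
  rw [h2] at h1
  exact Set.countable_univ_iff.1 h1

theorem secondCountable_of_hilbertBasis {𝕜 H J : Type*} [RCLike 𝕜] [NormedAddCommGroup H]
    [InnerProductSpace 𝕜 H] [Countable J] (b : HilbertBasis J 𝕜 H) :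
    SecondCountableTopology H := by
  have h1 : TopologicalSpace.IsSeparable
      (Submodule.span 𝕜 (Set.range b) : Set H) :=
    (Set.countable_range b).isSeparable.span
  have h2 := h1.closure
  have h3 : closure (Submodule.span 𝕜 (Set.range b) : Set H) = Set.univ := by
    rw [← Submodule.topologicalClosure_coe, b.dense_span]
    rfl
  rw [h3] at h2
  have := TopologicalSpace.isSeparable_univ_iff.1 h2
  exact UniformSpace.secondCountable_of_separable H

/-- The last observation is independent of the earlier ones. -/
theorem lintegral_pi_succ {α : Type*} [MeasurableSpace α] (ρ : Measure α) [IsProbabilityMeasure ρ]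
    (n : ℕ) {G : (Fin n → α) → α → ℝ≥0∞} (hG : Measurable (Function.uncurry G)) :
    ∫⁻ z, G (Fin.init z) (z (Fin.last n)) ∂(Measure.pi fun _ : Fin (n + 1) => ρ) =
      ∫⁻ z, ∫⁻ w, G z w ∂ρ ∂(Measure.pi fun _ : Fin n => ρ) := by
  have hmp := measurePreserving_piFinSuccAbove (fun _ : Fin (n + 1) => ρ) (Fin.last n)
  have h1 := hmp.lintegral_comp (f := fun p : α × (Fin n → α) => G p.2 p.1)
    (hG.comp measurable_swap)
  have h2 : ∀ z : Fin (n + 1) → α,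
      MeasurableEquiv.piFinSuccAbove (fun _ : Fin (n + 1) => α) (Fin.last n) z =
        (z (Fin.last n), Fin.init z) := by
    intro z
    ext i
    · rfl
    · simp [MeasurableEquiv.piFinSuccAbove, Fin.init]
  simp_rw [h2] at h1
  have h3 : Measurable fun p : α × (Fin n → α) => G p.2 p.1 := hG.comp measurable_swap
  rw [h1, lintegral_prod_symm _ h3.aemeasurable]

section Iterates

variable {𝕜 : Type*} [RCLike 𝕜]
    {X : Type*} [TopologicalSpace X] [PolishSpace X] [MeasurableSpace X] [BorelSpace X]
    {Y : Type*} [NormedAddCommGroup Y] [InnerProductSpace 𝕜 Y] [NormedSpace ℝ Y] [CompleteSpace Y]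
    [SecondCountableTopology Y] [MeasurableSpace Y] [BorelSpace Y]
    {H : Type*} [NormedAddCommGroup H] [InnerProductSpace 𝕜 H] [CompleteSpace H] [RKHS 𝕜 H X Y]
    {κ : ℝ} (hK : IsBoundedMercer (X := X) (Y := Y) H κ)

include hK in
theorem stronglyMeasurable_kerFun [SecondCountableTopology H] {Ω : Type*} [MeasurableSpace Ω]
    {x : Ω → X} (hx : Measurable x) {v : Ω → Y} (hv : StronglyMeasurable v) :
    StronglyMeasurable fun ω => kerFun H (x ω) (v ω) := by
  refine stronglyMeasurable_of_inner (𝕜 := 𝕜) fun u => ?_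
  simp_rw [inner_kerFun]
  exact ((measurable_coe hK u).comp hx).inner hv.measurable

include hK in
theorem stronglyMeasurable_apply [SecondCountableTopology H] {Ω : Type*} [MeasurableSpace Ω]
    {x : Ω → X} (hx : Measurable x) {h : Ω → H} (hh : StronglyMeasurable h) :
    StronglyMeasurable fun ω => h ω (x ω) := by
  refine stronglyMeasurable_of_inner (𝕜 := 𝕜) fun v => ?_
  simp_rw [← kerFun_inner]
  exact ((stronglyMeasurable_kerFun hK hx stronglyMeasurable_const).inner hh).measurable

include hK in
theorem stronglyMeasurable_step [SecondCountableTopology H] {Ω : Type*} [MeasurableSpace Ω]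
    {w : Ω → X × Y} (hw : Measurable w) {h : Ω → H} (hh : StronglyMeasurable h) (c : 𝕜) :
    StronglyMeasurable fun ω => h ω - c • kerFun H (w ω).1 (h ω (w ω).1 - (w ω).2) := by
  refine hh.sub (StronglyMeasurable.const_smul ?_ c)
  exact stronglyMeasurable_kerFun hK hw.fst
    ((stronglyMeasurable_apply hK hw.fst hh).sub hw.snd.stronglyMeasurable)

include hK in
theorem stronglyMeasurable_sgd [SecondCountableTopology H] (η : ℕ → ℝ) (n : ℕ) :
    StronglyMeasurable (sgd (𝕜 := 𝕜) (X := X) (Y := Y) (H := H) η n) := by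
  induction n with
  | zero => exact stronglyMeasurable_const
  | succ n ih =>
    have hinit : Measurable fun z : Fin (n + 1) → X × Y => (Fin.init z : Fin n → X × Y) :=
      measurable_pi_lambda _ fun i => measurable_pi_apply _
    exact stronglyMeasurable_step hK (measurable_pi_apply (Fin.last n)) (ih.comp_measurable hinit) _

variable {ρ : Measure (X × Y)} [IsProbabilityMeasure ρ] {σ : ℝ} (hd : H)
  {J : Type*} (S : EigenSystem (embedding ρ.fst hK) J) (η : ℕ → ℝ)

/-- The mean square of the `j`-th coordinate of the error after `n` steps. -/
noncomputable def coordErr (j : J) (n : ℕ) : ℝ≥0∞ :=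
  ∫⁻ z, ‖⟪S.basis j, sgd (𝕜 := 𝕜) (X := X) (Y := Y) (H := H) η n z - hd⟫_𝕜‖ₑ ^ 2
    ∂(Measure.pi fun _ : Fin n => ρ)

/-- The mean square of the `j`-th coordinate of `K(·, x) e(x)`, for the error `e` after `n` steps
and an independent input `x`. -/
noncomputable def crossErr (j : J) (n : ℕ) : ℝ≥0∞ :=
  ∫⁻ z, ∫⁻ x, ‖⟪S.basis j x, (sgd (𝕜 := 𝕜) (X := X) (Y := Y) (H := H) η n z - hd) x⟫_𝕜‖ₑ ^ 2 ∂ρ.fst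
    ∂(Measure.pi fun _ : Fin n => ρ)

/-- The mean square error after `n` steps in `L²`. -/
noncomputable def predErr (n : ℕ) : ℝ≥0∞ :=
  ∫⁻ z, ‖embedding ρ.fst hK (sgd (𝕜 := 𝕜) (X := X) (Y := Y) (H := H) η n z - hd)‖ₑ ^ 2
    ∂(Measure.pi fun _ : Fin n => ρ)

/-- The mean square error after `n` steps in the reproducing kernel Hilbert space. -/
noncomputable def normErr (ρ : Measure (X × Y)) (n : ℕ) : ℝ≥0∞ :=
  ∫⁻ z, ‖sgd (𝕜 := 𝕜) (X := X) (Y := Y) (H := H) η n z - hd‖ₑ ^ 2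
    ∂(Measure.pi fun _ : Fin n => ρ)

variable {hd}

theorem coordErr_zero (j : J) : coordErr hK hd S η j 0 = ‖⟪S.basis j, hd⟫_𝕜‖ₑ ^ 2 := by
  simp [coordErr, sgd]

/-- One step of the recursion of the coordinates, averaged over the past. -/
theorem coordErr_succ_le [SecondCountableTopology H] (hnoise : CondNoiseBounded ρ σ)
    (hhd : (hd : X → Y) =ᵐ[ρ.fst] regression ρ) (j : J) (n : ℕ) :
    coordErr hK hd S η j (n + 1) ≤
      ENNReal.ofReal ((1 - η (n + 1) * S.eig j) ^ 2) * coordErr hK hd S η j n +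
      ENNReal.ofReal (2 * η (n + 1) ^ 2) *
        (crossErr hK hd S η j n + ENNReal.ofReal (σ ^ 2 * S.eig j)) := by
  have hsg := stronglyMeasurable_sgd (𝕜 := 𝕜) (X := X) (Y := Y) (H := H) hK η n
  have hm : Measurable (Function.uncurry fun (z : Fin n → X × Y) (w : X × Y) =>
      ‖⟪S.basis j, sgd (𝕜 := 𝕜) (H := H) η n z - (η (n + 1) : 𝕜) •
        kerFun H w.1 (sgd (𝕜 := 𝕜) (H := H) η n z w.1 - w.2) - hd⟫_𝕜‖ₑ ^ 2) := by
    have h1 := stronglyMeasurable_step hK (w := fun p : (Fin n → X × Y) × (X × Y) => p.2)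
      measurable_snd (hsg.comp_measurable measurable_fst) (η (n + 1) : 𝕜)
    have h2 := (stronglyMeasurable_const (b := S.basis j)).inner (𝕜 := 𝕜)
      (h1.sub (stronglyMeasurable_const (b := hd)))
    exact h2.measurable.enorm.pow_const 2
  have h1 := lintegral_pi_succ ρ n hm
  have hm1 : Measurable fun z : Fin n → X × Y =>
      ‖⟪S.basis j, sgd (𝕜 := 𝕜) (H := H) η n z - hd⟫_𝕜‖ₑ ^ 2 :=
    ((stronglyMeasurable_const (b := S.basis j)).inner (𝕜 := 𝕜)
      (hsg.sub (stronglyMeasurable_const (b := hd)))).measurable.enorm.pow_const 2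
  calc coordErr hK hd S η j (n + 1)
      = _ := h1
    _ ≤ _ := lintegral_mono fun z => one_step hK S hnoise hhd (sgd η n z) (η (n + 1)) j
    _ = _ := by
      rw [lintegral_add_left (hm1.const_mul _), lintegral_const_mul _ hm1,
        lintegral_const_mul' _ _ ENNReal.ofReal_ne_top, lintegral_add_right _ measurable_const,
        lintegral_const, measure_univ, mul_one]
      rfl

theorem tsum_coordErr [SecondCountableTopology H] [Countable J] (n : ℕ) :
    ∑' j, coordErr hK hd S η j n = normErr (𝕜 := 𝕜) hd η ρ n := by
  have hsg := stronglyMeasurable_sgd (𝕜 := 𝕜) (X := X) (Y := Y) (H := H) hK η n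
  have hm : ∀ j, Measurable fun z : Fin n → X × Y =>
      ‖⟪S.basis j, sgd (𝕜 := 𝕜) (H := H) η n z - hd⟫_𝕜‖ₑ ^ 2 := fun j =>
    ((stronglyMeasurable_const (b := S.basis j)).inner (𝕜 := 𝕜)
      (hsg.sub (stronglyMeasurable_const (b := hd)))).measurable.enorm.pow_const 2
  simp only [coordErr, normErr]
  rw [← lintegral_tsum fun j => (hm j).aemeasurable]
  refine lintegral_congr fun z => ?_
  exact tsum_enorm_inner_sq S.basis _

theorem tsum_eig_mul_coordErr [SecondCountableTopology H] [Countable J] (n : ℕ) :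
    ∑' j, ENNReal.ofReal (S.eig j) * coordErr hK hd S η j n = predErr (ρ := ρ) hK hd η n := by
  have hsg := stronglyMeasurable_sgd (𝕜 := 𝕜) (X := X) (Y := Y) (H := H) hK η n
  have hm : ∀ j, Measurable fun z : Fin n → X × Y =>
      ‖⟪S.basis j, sgd (𝕜 := 𝕜) (H := H) η n z - hd⟫_𝕜‖ₑ ^ 2 := fun j =>
    ((stronglyMeasurable_const (b := S.basis j)).inner (𝕜 := 𝕜)
      (hsg.sub (stronglyMeasurable_const (b := hd)))).measurable.enorm.pow_const 2
  simp only [coordErr, predErr]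
  simp_rw [← lintegral_const_mul _ (hm _)]
  rw [← lintegral_tsum fun j => ((hm j).const_mul _).aemeasurable]
  refine lintegral_congr fun z => ?_
  exact S.tsum_enorm_image_sq _

/-- The multiplicative noise in the `j`-th coordinate: `|⟪uⱼ(x), e(x)⟫| ≤ κ ‖e‖ ‖uⱼ(x)‖`, and the
mean square of `uⱼ(x)` is `λⱼ`. -/
theorem crossErr_le (j : J) (n : ℕ) :
    crossErr hK hd S η j n ≤
      ENNReal.ofReal (κ ^ 2 * S.eig j) * normErr (𝕜 := 𝕜) hd η ρ n := by
  simp only [crossErr, normErr]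
  rw [← lintegral_const_mul' _ _ ENNReal.ofReal_ne_top]
  refine lintegral_mono fun z => ?_
  set e := sgd (𝕜 := 𝕜) (X := X) (Y := Y) (H := H) η n z - hd
  calc ∫⁻ x, ‖⟪S.basis j x, e x⟫_𝕜‖ₑ ^ 2 ∂ρ.fst
      ≤ ∫⁻ x, ENNReal.ofReal (κ ^ 2 * ‖e‖ ^ 2) * ‖S.basis j x‖ₑ ^ 2 ∂ρ.fst := by
        refine lintegral_mono fun x => ?_
        simp only [enorm_sq_eq_ofReal]
        rw [← ENNReal.ofReal_mul (by positivity)]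
        refine ENNReal.ofReal_le_ofReal ?_
        have h1 := norm_inner_le_norm (𝕜 := 𝕜) (S.basis j x) (e x)
        have h2 := hK.norm_apply_le e x
        calc ‖⟪S.basis j x, e x⟫_𝕜‖ ^ 2 ≤ (‖S.basis j x‖ * (|κ| * ‖e‖)) ^ 2 := by
              gcongr
              exact h1.trans (by gcongr)
          _ = _ := by rw [mul_pow, mul_pow, sq_abs]; ring
    _ = _ := by
        rw [lintegral_const_mul' _ _ ENNReal.ofReal_ne_top, lintegral_enorm_apply_sq hK,
          enorm_sq_eq_ofReal, S.norm_sq_image, enorm_sq_eq_ofReal,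
          ← ENNReal.ofReal_mul (by positivity), ← ENNReal.ofReal_mul
            (mul_nonneg (sq_nonneg _) (S.eig_pos j).le)]
        congr 1
        ring

/-- The squares of the coordinates of `K(·, x) e(x)` sum to `‖K(·, x) e(x)‖² ≤ κ² ‖e(x)‖²`. -/
theorem tsum_lintegral_inner_apply_le [Countable J] (e : H) :
    ∑' j, ∫⁻ x, ‖⟪S.basis j x, e x⟫_𝕜‖ₑ ^ 2 ∂ρ.fst ≤
      ENNReal.ofReal (κ ^ 2) * ‖embedding ρ.fst hK e‖ₑ ^ 2 := by
  have hm : ∀ j, Measurable fun x => ‖⟪S.basis j x, e x⟫_𝕜‖ₑ ^ 2 := fun j =>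
    ((measurable_coe hK _).inner (measurable_coe hK e)).enorm.pow_const 2
  rw [← lintegral_tsum fun j => (hm j).aemeasurable,
    ← lintegral_enorm_apply_sq hK, ← lintegral_const_mul' _ _ ENNReal.ofReal_ne_top]
  refine lintegral_mono fun x => ?_
  simp_rw [← inner_kerFun]
  rw [tsum_enorm_inner_sq S.basis]
  simp only [enorm_sq_eq_ofReal]
  rw [← ENNReal.ofReal_mul (by positivity)]
  refine ENNReal.ofReal_le_ofReal ?_
  calc ‖kerFun H x (e x)‖ ^ 2 ≤ (|κ| * ‖e x‖) ^ 2 := by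
        gcongr
        exact ((kerFun H x).le_opNorm _).trans
          (mul_le_mul_of_nonneg_right (norm_kerFun_le hK x) (norm_nonneg _))
    _ = _ := by rw [mul_pow, sq_abs]

include hK in
theorem measurable_inner_apply_sgd [SecondCountableTopology H] (u : H) (n : ℕ) :
    Measurable (Function.uncurry fun (z : Fin n → X × Y) (x : X) =>
      ‖⟪u x, (sgd (𝕜 := 𝕜) (H := H) η n z - hd) x⟫_𝕜‖ₑ ^ 2) := by
  have hsg := stronglyMeasurable_sgd (𝕜 := 𝕜) (X := X) (Y := Y) (H := H) hK η n
  have h0 : StronglyMeasurable fun p : (Fin n → X × Y) × X =>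
      sgd (𝕜 := 𝕜) (H := H) η n p.1 - hd :=
    (hsg.comp_measurable measurable_fst).sub stronglyMeasurable_const
  have h1 := (stronglyMeasurable_apply hK measurable_snd h0).measurable
  have h2 : Measurable fun p : (Fin n → X × Y) × X => u p.2 :=
    (measurable_coe hK _).comp measurable_snd
  exact (h2.inner h1).enorm.pow_const 2

/-- The multiplicative noise summed over the coordinates, at most `κ²` times the prediction error. -/
theorem tsum_crossErr_le [SecondCountableTopology H] [Countable J] (n : ℕ) :
    ∑' j, crossErr hK hd S η j n ≤ ENNReal.ofReal (κ ^ 2) * predErr (ρ := ρ) hK hd η n := by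
  have hm : ∀ j, Measurable fun z : Fin n → X × Y =>
      ∫⁻ x, ‖⟪S.basis j x, (sgd (𝕜 := 𝕜) (H := H) η n z - hd) x⟫_𝕜‖ₑ ^ 2 ∂ρ.fst := fun j =>
    (measurable_inner_apply_sgd hK η (S.basis j) n).lintegral_prod_right
  simp only [crossErr, predErr]
  rw [← lintegral_tsum fun j => (hm j).aemeasurable,
    ← lintegral_const_mul' _ _ ENNReal.ofReal_ne_top]
  exact lintegral_mono fun z => tsum_lintegral_inner_apply_le hK S _

/-- The recursion of the coordinates, unrolled. -/
theorem coordErr_le [SecondCountableTopology H] (hnoise : CondNoiseBounded ρ σ)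
    (hhd : (hd : X → Y) =ᵐ[ρ.fst] regression ρ) (j : J) (n : ℕ) :
    coordErr hK hd S η j n ≤
      ENNReal.ofReal (∏ i ∈ Finset.Ico 0 n, (1 - η (i + 1) * S.eig j) ^ 2) *
        ‖⟪S.basis j, hd⟫_𝕜‖ₑ ^ 2 +
      ∑ t ∈ Finset.range n, ENNReal.ofReal (2 * η (t + 1) ^ 2) *
        (ENNReal.ofReal (∏ i ∈ Finset.Ico (t + 1) n, (1 - η (i + 1) * S.eig j) ^ 2) *
        (crossErr hK hd S η j t + ENNReal.ofReal (σ ^ 2 * S.eig j))) := by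
  induction n with
  | zero => simp [coordErr_zero]
  | succ n ih =>
    refine (coordErr_succ_le hK S η hnoise hhd j n).trans ?_
    rw [Finset.sum_range_succ, Finset.Ico_self, Finset.prod_empty, ENNReal.ofReal_one, one_mul,
      ← add_assoc]
    gcongr
    refine (mul_le_mul_right ih _).trans (le_of_eq ?_)
    rw [mul_add, Finset.mul_sum, Finset.prod_Ico_succ_top (Nat.zero_le n),
      mul_comm (∏ i ∈ Finset.Ico 0 n, (1 - η (i + 1) * S.eig j) ^ 2),
      ENNReal.ofReal_mul (p := (1 - η (n + 1) * S.eig j) ^ 2) (sq_nonneg _), mul_assoc]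
    congr 1
    refine Finset.sum_congr rfl fun t ht => ?_
    rw [Finset.prod_Ico_succ_top (by have := Finset.mem_range.1 ht; omega),
      mul_comm (∏ i ∈ Finset.Ico (t + 1) n, (1 - η (i + 1) * S.eig j) ^ 2),
      ENNReal.ofReal_mul (p := (1 - η (n + 1) * S.eig j) ^ 2) (sq_nonneg _)]
    ring

end Iterates

/-! ### Unrolling the recursion of the coordinate errors -/

/-- For the step sizes `w`, one plus the sum of the steps number `a + 1, …, b`. -/
noncomputable def gap (w : ℕ → ℝ) (a b : ℕ) : ℝ := 1 + ∑ i ∈ Finset.Ico a b, w (i + 1)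

theorem one_le_gap {w : ℕ → ℝ} (hw : ∀ i, 0 ≤ w i) (a b : ℕ) : 1 ≤ gap w a b :=
  le_add_of_nonneg_right (Finset.sum_nonneg fun _ _ => hw _)

theorem gap_pos {w : ℕ → ℝ} (hw : ∀ i, 0 ≤ w i) (a b : ℕ) : 0 < gap w a b :=
  one_pos.trans_le (one_le_gap hw a b)

theorem gap_rpow_nonneg {w : ℕ → ℝ} (hw : ∀ i, 0 ≤ w i) (a b : ℕ) (p : ℝ) : 0 ≤ gap w a b ^ p :=
  Real.rpow_nonneg (gap_pos hw a b).le p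

/-- The sum `∑_{t < n} w_{t+1}² (1 + w_{t+2} + ⋯ + w_n) ^ (-v) f t`. -/
noncomputable def wsum (w : ℕ → ℝ) (v : ℝ) (f : ℕ → ℝ) (n : ℕ) : ℝ :=
  ∑ t ∈ Finset.range n, w (t + 1) ^ 2 * gap w (t + 1) n ^ (-v) * f t

/-- The product of the contraction factors decays like a power of the sum of the steps, since
`z ^ v * exp (-z)` is bounded. -/
theorem exists_rpow_mul_prod_le {v : ℝ} (hv : 0 ≤ v) (M : ℝ) :
    ∃ D : ℝ, 0 < D ∧ ∀ l, 0 < l → l ≤ M → ∀ w : ℕ → ℝ, (∀ i, 0 ≤ w i) → (∀ i, w i * l ≤ 1) →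
      ∀ a b, l ^ v * ∏ i ∈ Finset.Ico a b, (1 - w (i + 1) * l) ^ 2 ≤ D * gap w a b ^ (-v) := by
  refine ⟨(⌈v⌉₊).factorial * Real.exp (1 + M), by positivity, fun l hl hlM w hw hwl a b => ?_⟩
  have hg := gap_pos hw a b
  have hprod : ∏ i ∈ Finset.Ico a b, (1 - w (i + 1) * l) ^ 2 ≤
      Real.exp (-((gap w a b - 1) * l)) := by
    have h1 : ∀ i ∈ Finset.Ico a b, (1 - w (i + 1) * l) ^ 2 ≤ Real.exp (-(w (i + 1) * l)) := by
      intro i _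
      have h2 := Real.one_sub_le_exp_neg (w (i + 1) * l)
      have h3 := hwl (i + 1)
      have h4 : 0 ≤ w (i + 1) * l := mul_nonneg (hw _) hl.le
      nlinarith
    refine (Finset.prod_le_prod (fun _ _ => sq_nonneg _) h1).trans (le_of_eq ?_)
    rw [← Real.exp_sum, Finset.sum_neg_distrib, ← Finset.sum_mul, gap, add_sub_cancel_left]
  rw [Real.rpow_neg hg.le, ← div_eq_mul_inv, le_div_iff₀ (Real.rpow_pos_of_pos hg v)]
  set z := 1 + M + (gap w a b - 1) * l with hz
  have hgl : 0 ≤ (gap w a b - 1) * l := mul_nonneg (by linarith [one_le_gap hw a b]) hl.le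
  have hz1 : 1 ≤ z := by linarith
  have h5 : l ^ v * gap w a b ^ v ≤ (⌈v⌉₊).factorial * Real.exp z := by
    rw [← Real.mul_rpow hl.le hg.le]
    calc (l * gap w a b) ^ v ≤ z ^ v :=
          Real.rpow_le_rpow (mul_nonneg hl.le hg.le) (by nlinarith) hv
      _ ≤ z ^ (⌈v⌉₊ : ℝ) := Real.rpow_le_rpow_of_exponent_le hz1 (Nat.le_ceil v)
      _ = z ^ ⌈v⌉₊ := Real.rpow_natCast _ _
      _ ≤ _ := by
        have := Real.pow_div_factorial_le_exp z (by linarith) ⌈v⌉₊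
        rwa [div_le_iff₀ (by positivity), mul_comm] at this
  have h6 : 0 ≤ l ^ v * gap w a b ^ v :=
    mul_nonneg (Real.rpow_nonneg hl.le _) (Real.rpow_nonneg hg.le _)
  calc l ^ v * (∏ i ∈ Finset.Ico a b, (1 - w (i + 1) * l) ^ 2) * gap w a b ^ v
      = l ^ v * gap w a b ^ v * ∏ i ∈ Finset.Ico a b, (1 - w (i + 1) * l) ^ 2 := by ring
    _ ≤ ((⌈v⌉₊).factorial * Real.exp z) * Real.exp (-((gap w a b - 1) * l)) :=
        mul_le_mul h5 hprod (Finset.prod_nonneg fun _ _ => sq_nonneg _) (by positivity)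
    _ = _ := by
        rw [mul_assoc, ← Real.exp_add, hz]
        congr 2
        ring

/-- Scaling the steps by `e ≤ 1` costs at most the factor `e ^ (-p)`, since `1 + e S ≥ e (1 + S)`. -/
theorem gap_const_mul_rpow_le {e : ℝ} (he : 0 < e) (he1 : e ≤ 1) {w : ℕ → ℝ} (hw : ∀ i, 0 ≤ w i)
    {p : ℝ} (hp : 0 ≤ p) (a b : ℕ) :
    gap (fun i => e * w i) a b ^ (-p) ≤ e ^ (-p) * gap w a b ^ (-p) := by
  have hg := gap_pos hw a b
  rw [← Real.mul_rpow he.le hg.le]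
  refine Real.rpow_le_rpow_of_nonpos (by positivity) ?_ (by linarith)
  simp only [gap, ← Finset.mul_sum]
  linarith

section Errors

variable {𝕜 : Type*} [RCLike 𝕜]
    {X : Type*} [TopologicalSpace X] [PolishSpace X] [MeasurableSpace X] [BorelSpace X]
    {Y : Type*} [NormedAddCommGroup Y] [InnerProductSpace 𝕜 Y] [NormedSpace ℝ Y] [CompleteSpace Y]
    [SecondCountableTopology Y] [MeasurableSpace Y] [BorelSpace Y]
    {H : Type*} [NormedAddCommGroup H] [InnerProductSpace 𝕜 H] [CompleteSpace H] [RKHS 𝕜 H X Y]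
    {κ : ℝ} (hK : IsBoundedMercer (X := X) (Y := Y) H κ)
    {ρ : Measure (X × Y)} [IsProbabilityMeasure ρ] {σ : ℝ} {hd : H}
    {J : Type*} (S : EigenSystem (embedding ρ.fst hK) J)
    [SecondCountableTopology H] [Countable J]

include S in
/-- Weighted sums of the coordinates of the error, for any bounds `N t` of the weighted noise. -/
theorem tsum_rpow_mul_coordErr_le (hnoise : CondNoiseBounded ρ σ)
    (hhd : (hd : X → Y) =ᵐ[ρ.fst] regression ρ) {b q D : ℝ} {Q : J → ℝ≥0∞}
    (hQ : ∀ j, ‖⟪S.basis j, hd⟫_𝕜‖ₑ ^ 2 ≤ ENNReal.ofReal (S.eig j ^ q) * Q j) {η : ℕ → ℝ} {n : ℕ}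
    (hD : ∀ j, S.eig j ^ (b + q) * ∏ i ∈ Finset.Ico 0 n, (1 - η (i + 1) * S.eig j) ^ 2 ≤
      D * gap η 0 n ^ (-(b + q))) {N : ℕ → ℝ≥0∞}
    (hN : ∀ t < n, ∑' j, ENNReal.ofReal
      (S.eig j ^ b * ∏ i ∈ Finset.Ico (t + 1) n, (1 - η (i + 1) * S.eig j) ^ 2) *
        (crossErr hK hd S η j t + ENNReal.ofReal (σ ^ 2 * S.eig j)) ≤ N t) :
    ∑' j, ENNReal.ofReal (S.eig j ^ b) * coordErr hK hd S η j n ≤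
      ENNReal.ofReal (D * gap η 0 n ^ (-(b + q))) * (∑' j, Q j) +
      ∑ t ∈ Finset.range n, ENNReal.ofReal (2 * η (t + 1) ^ 2) * N t := by
  have hb0 : ∀ j, 0 ≤ S.eig j ^ b := fun j => Real.rpow_nonneg (S.eig_pos j).le b
  have hj : ∀ j, ENNReal.ofReal (S.eig j ^ b) * coordErr hK hd S η j n ≤
      ENNReal.ofReal (D * gap η 0 n ^ (-(b + q))) * Q j +
      ∑ t ∈ Finset.range n, ENNReal.ofReal (2 * η (t + 1) ^ 2) * (ENNReal.ofReal
      (S.eig j ^ b * ∏ i ∈ Finset.Ico (t + 1) n, (1 - η (i + 1) * S.eig j) ^ 2) *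
        (crossErr hK hd S η j t + ENNReal.ofReal (σ ^ 2 * S.eig j))) := by
    intro j
    refine (mul_le_mul_right (coordErr_le hK S η hnoise hhd j n) _).trans ?_
    rw [mul_add, Finset.mul_sum]
    refine add_le_add ?_ (Finset.sum_le_sum fun t _ => ?_)
    · calc ENNReal.ofReal (S.eig j ^ b) *
            (ENNReal.ofReal (∏ i ∈ Finset.Ico 0 n, (1 - η (i + 1) * S.eig j) ^ 2) *
              ‖⟪S.basis j, hd⟫_𝕜‖ₑ ^ 2)
          ≤ ENNReal.ofReal (S.eig j ^ b) *
            (ENNReal.ofReal (∏ i ∈ Finset.Ico 0 n, (1 - η (i + 1) * S.eig j) ^ 2) *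
              (ENNReal.ofReal (S.eig j ^ q) * Q j)) := by gcongr; exact hQ j
        _ = ENNReal.ofReal (S.eig j ^ (b + q) *
              ∏ i ∈ Finset.Ico 0 n, (1 - η (i + 1) * S.eig j) ^ 2) * Q j := by
            rw [Real.rpow_add (S.eig_pos j), mul_assoc (S.eig j ^ b), ENNReal.ofReal_mul (hb0 j),
              ENNReal.ofReal_mul (p := S.eig j ^ q) (Real.rpow_nonneg (S.eig_pos j).le q)]
            ring
        _ ≤ _ := mul_le_mul_left (ENNReal.ofReal_le_ofReal (hD j)) _
    · rw [ENNReal.ofReal_mul (hb0 j)]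
      refine le_of_eq ?_
      ring
  refine (ENNReal.tsum_le_tsum hj).trans ?_
  rw [ENNReal.tsum_add, ENNReal.tsum_mul_left,
    Summable.tsum_finsetSum fun _ _ => ENNReal.summable]
  gcongr with t ht
  rw [ENNReal.tsum_mul_left]
  gcongr
  exact hN t (Finset.mem_range.1 ht)

include S in
/-- The weighted error `∑ⱼ λⱼ ^ b 𝔼 |⟪uⱼ, h_n - h†⟫|²`, with the multiplicative noise controlled by
the norm of the error in the reproducing kernel Hilbert space. The noise exponent `v` is available
as soon as `∑ⱼ λⱼ ^ (b + 1 - v)` is finite. -/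
theorem exists_tsum_rpow_mul_coordErr_le (hnoise : CondNoiseBounded ρ σ)
    (hhd : (hd : X → Y) =ᵐ[ρ.fst] regression ρ) {M b q v : ℝ} (hM : ∀ j, S.eig j ≤ M)
    (hbq : 0 ≤ b + q) (hv : 0 ≤ v)
    {Q : J → ℝ≥0∞} (hQs : ∑' j, Q j < ⊤)
    (hQ : ∀ j, ‖⟪S.basis j, hd⟫_𝕜‖ₑ ^ 2 ≤ ENNReal.ofReal (S.eig j ^ q) * Q j)
    (hW : ∑' j, ENNReal.ofReal (S.eig j ^ (b + 1 - v)) < ⊤) :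
    ∃ C : ℝ, 0 < C ∧ ∀ η : ℕ → ℝ, (∀ i, 0 ≤ η i) → (∀ i, η i * M ≤ 1) → ∀ n,
      ∑' j, ENNReal.ofReal (S.eig j ^ b) * coordErr hK hd S η j n ≤
        ENNReal.ofReal C * (ENNReal.ofReal (gap η 0 n ^ (-(b + q))) +
          ∑ t ∈ Finset.range n, ENNReal.ofReal (η (t + 1) ^ 2 * gap η (t + 1) n ^ (-v)) *
            (1 + normErr (𝕜 := 𝕜) hd η ρ t)) := by
  obtain ⟨D, hD, hDle⟩ := exists_rpow_mul_prod_le hbq M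
  obtain ⟨D', hD', hDle'⟩ := exists_rpow_mul_prod_le hv M
  set W := ∑' j, ENNReal.ofReal (S.eig j ^ (b + 1 - v)) with hWdef
  set C := D * (∑' j, Q j).toReal + 2 * (D' * W.toReal * (κ ^ 2 + σ ^ 2)) + 1 with hC
  have p1 : 0 ≤ D * (∑' j, Q j).toReal := by positivity
  have p2 : 0 ≤ D' * W.toReal * (κ ^ 2 + σ ^ 2) := by positivity
  have hC1 : D * (∑' j, Q j).toReal ≤ C := by linarith
  have hC2 : 2 * (D' * W.toReal * (κ ^ 2 + σ ^ 2)) ≤ C := by linarith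
  refine ⟨C, by positivity, fun η hη hηM n => ?_⟩
  have hηj : ∀ j i, η i * S.eig j ≤ 1 := fun j i =>
    (mul_le_mul_of_nonneg_left (hM j) (hη i)).trans (hηM i)
  set N : ℕ → ℝ≥0∞ := fun t => ENNReal.ofReal (D' * W.toReal * (κ ^ 2 + σ ^ 2) *
    gap η (t + 1) n ^ (-v)) * (1 + normErr (𝕜 := 𝕜) hd η ρ t) with hN
  refine (tsum_rpow_mul_coordErr_le hK S hnoise hhd hQ (D := D) (N := N)
    (fun j => hDle _ (S.eig_pos j) (hM j) η hη (hηj j) 0 n) fun t _ => ?_).trans ?_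
  · have hj : ∀ j, ENNReal.ofReal
        (S.eig j ^ b * ∏ i ∈ Finset.Ico (t + 1) n, (1 - η (i + 1) * S.eig j) ^ 2) *
        (crossErr hK hd S η j t + ENNReal.ofReal (σ ^ 2 * S.eig j)) ≤
        ENNReal.ofReal (S.eig j ^ (b + 1 - v)) * (ENNReal.ofReal (D' * (κ ^ 2 + σ ^ 2) *
          gap η (t + 1) n ^ (-v)) * (1 + normErr (𝕜 := 𝕜) hd η ρ t)) := by
      intro j
      have h0 := S.eig_pos j
      have h1 : crossErr hK hd S η j t + ENNReal.ofReal (σ ^ 2 * S.eig j) ≤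
          ENNReal.ofReal ((κ ^ 2 + σ ^ 2) * S.eig j) * (1 + normErr (𝕜 := 𝕜) hd η ρ t) := by
        rw [add_mul, mul_add, mul_one, add_comm]
        refine add_le_add (ENNReal.ofReal_le_ofReal ?_) ((crossErr_le hK S η j t).trans ?_)
        · nlinarith [show 0 ≤ κ ^ 2 * S.eig j by positivity]
        · gcongr
          nlinarith [show 0 ≤ σ ^ 2 * S.eig j by positivity]
      refine (mul_le_mul_right h1 _).trans ?_
      rw [← mul_assoc, ← mul_assoc]
      refine mul_le_mul_left ?_ _
      have hp : 0 ≤ ∏ i ∈ Finset.Ico (t + 1) n, (1 - η (i + 1) * S.eig j) ^ 2 :=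
        Finset.prod_nonneg fun _ _ => sq_nonneg _
      rw [← ENNReal.ofReal_mul (mul_nonneg (Real.rpow_nonneg h0.le _) hp),
        ← ENNReal.ofReal_mul (Real.rpow_nonneg h0.le _)]
      refine ENNReal.ofReal_le_ofReal ?_
      have h2 := hDle' _ h0 (hM j) η hη (hηj j) (t + 1) n
      have h3 : S.eig j ^ b * S.eig j = S.eig j ^ (b + 1 - v) * S.eig j ^ v := by
        rw [← Real.rpow_add h0, ← Real.rpow_add_one h0.ne']
        congr 1
        ring
      calc S.eig j ^ b * (∏ i ∈ Finset.Ico (t + 1) n, (1 - η (i + 1) * S.eig j) ^ 2) *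
            ((κ ^ 2 + σ ^ 2) * S.eig j)
          = (κ ^ 2 + σ ^ 2) * (S.eig j ^ b * S.eig j) *
            ∏ i ∈ Finset.Ico (t + 1) n, (1 - η (i + 1) * S.eig j) ^ 2 := by ring
        _ = (κ ^ 2 + σ ^ 2) * S.eig j ^ (b + 1 - v) * (S.eig j ^ v *
            ∏ i ∈ Finset.Ico (t + 1) n, (1 - η (i + 1) * S.eig j) ^ 2) := by rw [h3]; ring
        _ ≤ (κ ^ 2 + σ ^ 2) * S.eig j ^ (b + 1 - v) * (D' * gap η (t + 1) n ^ (-v)) := by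
            gcongr
        _ = _ := by ring
    refine (ENNReal.tsum_le_tsum hj).trans (le_of_eq ?_)
    rw [ENNReal.tsum_mul_right, hN, ← hWdef, ← mul_assoc]
    nth_rw 1 [← ENNReal.ofReal_toReal hW.ne]
    rw [← ENNReal.ofReal_mul ENNReal.toReal_nonneg]
    congr 2
    ring
  · rw [mul_add, Finset.mul_sum]
    refine add_le_add ?_ (Finset.sum_le_sum fun t _ => ?_)
    · nth_rw 1 [← ENNReal.ofReal_toReal hQs.ne]
      rw [← ENNReal.ofReal_mul (mul_nonneg hD.le (gap_rpow_nonneg hη _ _ _)),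
        ← ENNReal.ofReal_mul (by positivity)]
      refine ENNReal.ofReal_le_ofReal ?_
      have := mul_le_mul_of_nonneg_right hC1 (gap_rpow_nonneg hη 0 n (-(b + q)))
      linarith
    · rw [hN, ← mul_assoc, ← mul_assoc]
      refine mul_le_mul_left ?_ _
      rw [← ENNReal.ofReal_mul (by positivity), ← ENNReal.ofReal_mul (by positivity)]
      refine ENNReal.ofReal_le_ofReal ?_
      have := mul_le_mul_of_nonneg_right hC2 (mul_nonneg (sq_nonneg (η (t + 1)))
        (gap_rpow_nonneg hη (t + 1) n (-v)))
      linarith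

include S in
/-- The prediction error, with the multiplicative noise controlled by the prediction error itself, at
the price of the noise exponent `1` for this part. -/
theorem exists_predErr_le (hnoise : CondNoiseBounded ρ σ)
    (hhd : (hd : X → Y) =ᵐ[ρ.fst] regression ρ) {M q v : ℝ} (hM : ∀ j, S.eig j ≤ M)
    (hbq : 0 ≤ 1 + q) (hv : 0 ≤ v)
    {Q : J → ℝ≥0∞} (hQs : ∑' j, Q j < ⊤)
    (hQ : ∀ j, ‖⟪S.basis j, hd⟫_𝕜‖ₑ ^ 2 ≤ ENNReal.ofReal (S.eig j ^ q) * Q j)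
    (hW : ∑' j, ENNReal.ofReal (S.eig j ^ (2 - v)) < ⊤) :
    ∃ C : ℝ, 0 < C ∧ ∀ η : ℕ → ℝ, (∀ i, 0 ≤ η i) → (∀ i, η i * M ≤ 1) → ∀ n,
      predErr (ρ := ρ) hK hd η n ≤
        ENNReal.ofReal C * (ENNReal.ofReal (gap η 0 n ^ (-(1 + q))) +
          ∑ t ∈ Finset.range n, (ENNReal.ofReal (η (t + 1) ^ 2 * gap η (t + 1) n ^ (-1 : ℝ)) *
            predErr (ρ := ρ) hK hd η t +
            ENNReal.ofReal (η (t + 1) ^ 2 * gap η (t + 1) n ^ (-v)))) := by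
  obtain ⟨D, hD, hDle⟩ := exists_rpow_mul_prod_le hbq M
  obtain ⟨D', hD', hDle'⟩ := exists_rpow_mul_prod_le hv M
  obtain ⟨E, hE, hEle⟩ := exists_rpow_mul_prod_le zero_le_one M
  set W := ∑' j, ENNReal.ofReal (S.eig j ^ (2 - v)) with hWdef
  set C := D * (∑' j, Q j).toReal + 2 * (D' * W.toReal * σ ^ 2) + 2 * (E * κ ^ 2) + 1 with hC
  have p1 : 0 ≤ D * (∑' j, Q j).toReal := by positivity
  have p2 : 0 ≤ D' * W.toReal * σ ^ 2 := by positivity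
  have p3 : 0 ≤ E * κ ^ 2 := by positivity
  have hC1 : D * (∑' j, Q j).toReal ≤ C := by linarith
  have hC2 : 2 * (D' * W.toReal * σ ^ 2) ≤ C := by linarith
  have hC3 : 2 * (E * κ ^ 2) ≤ C := by linarith
  have hC0 : 0 < C := by linarith
  refine ⟨C, hC0, fun η hη hηM n => ?_⟩
  have hηj : ∀ j i, η i * S.eig j ≤ 1 := fun j i =>
    (mul_le_mul_of_nonneg_left (hM j) (hη i)).trans (hηM i)
  set N : ℕ → ℝ≥0∞ := fun t => ENNReal.ofReal (E * κ ^ 2 * gap η (t + 1) n ^ (-1 : ℝ)) *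
    predErr (ρ := ρ) hK hd η t + ENNReal.ofReal (D' * W.toReal * σ ^ 2 * gap η (t + 1) n ^ (-v))
    with hN
  have hone : ∑' j, ENNReal.ofReal (S.eig j ^ (1 : ℝ)) * coordErr hK hd S η j n =
      predErr (ρ := ρ) hK hd η n := by
    simp_rw [Real.rpow_one]
    exact tsum_eig_mul_coordErr hK S η n
  rw [← hone]
  refine (tsum_rpow_mul_coordErr_le hK S hnoise hhd hQ (D := D) (N := N)
    (fun j => hDle _ (S.eig_pos j) (hM j) η hη (hηj j) 0 n) fun t _ => ?_).trans ?_
  · have hj : ∀ j, ENNReal.ofReal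
        (S.eig j ^ (1 : ℝ) * ∏ i ∈ Finset.Ico (t + 1) n, (1 - η (i + 1) * S.eig j) ^ 2) *
        (crossErr hK hd S η j t + ENNReal.ofReal (σ ^ 2 * S.eig j)) ≤
        ENNReal.ofReal (E * gap η (t + 1) n ^ (-1 : ℝ)) * crossErr hK hd S η j t +
        ENNReal.ofReal (S.eig j ^ (2 - v)) * ENNReal.ofReal (D' * σ ^ 2 *
          gap η (t + 1) n ^ (-v)) := by
      intro j
      have h0 := S.eig_pos j
      have hp : 0 ≤ ∏ i ∈ Finset.Ico (t + 1) n, (1 - η (i + 1) * S.eig j) ^ 2 :=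
        Finset.prod_nonneg fun _ _ => sq_nonneg _
      rw [mul_add]
      refine add_le_add ?_ ?_
      · exact mul_le_mul_left
          (ENNReal.ofReal_le_ofReal (hEle _ h0 (hM j) η hη (hηj j) (t + 1) n)) _
      · rw [← ENNReal.ofReal_mul (mul_nonneg (Real.rpow_nonneg h0.le _) hp),
          ← ENNReal.ofReal_mul (Real.rpow_nonneg h0.le _)]
        refine ENNReal.ofReal_le_ofReal ?_
        have h2 := hDle' _ h0 (hM j) η hη (hηj j) (t + 1) n
        have h3 : S.eig j ^ (1 : ℝ) * S.eig j = S.eig j ^ (2 - v) * S.eig j ^ v := by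
          rw [← Real.rpow_add h0, ← Real.rpow_add_one h0.ne']
          congr 1
          ring
        calc S.eig j ^ (1 : ℝ) * (∏ i ∈ Finset.Ico (t + 1) n, (1 - η (i + 1) * S.eig j) ^ 2) *
              (σ ^ 2 * S.eig j)
            = σ ^ 2 * (S.eig j ^ (1 : ℝ) * S.eig j) *
              ∏ i ∈ Finset.Ico (t + 1) n, (1 - η (i + 1) * S.eig j) ^ 2 := by ring
          _ = σ ^ 2 * S.eig j ^ (2 - v) * (S.eig j ^ v *
              ∏ i ∈ Finset.Ico (t + 1) n, (1 - η (i + 1) * S.eig j) ^ 2) := by rw [h3]; ring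
          _ ≤ σ ^ 2 * S.eig j ^ (2 - v) * (D' * gap η (t + 1) n ^ (-v)) := by
              gcongr
          _ = _ := by ring
    refine (ENNReal.tsum_le_tsum hj).trans ?_
    rw [ENNReal.tsum_add, ENNReal.tsum_mul_left, ENNReal.tsum_mul_right, hN, ← hWdef]
    refine add_le_add ?_ (le_of_eq ?_)
    · refine (mul_le_mul_right (tsum_crossErr_le hK S η t) _).trans (le_of_eq ?_)
      rw [← mul_assoc, ← ENNReal.ofReal_mul (mul_nonneg hE.le (gap_rpow_nonneg hη _ _ _))]
      congr 2
      ring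
    · nth_rw 1 [← ENNReal.ofReal_toReal hW.ne]
      rw [← ENNReal.ofReal_mul ENNReal.toReal_nonneg]
      congr 1
      ring
  · rw [mul_add, Finset.mul_sum]
    refine add_le_add ?_ (Finset.sum_le_sum fun t _ => ?_)
    · nth_rw 1 [← ENNReal.ofReal_toReal hQs.ne]
      rw [← ENNReal.ofReal_mul (mul_nonneg hD.le (gap_rpow_nonneg hη _ _ _)),
        ← ENNReal.ofReal_mul hC0.le]
      refine ENNReal.ofReal_le_ofReal ?_
      have := mul_le_mul_of_nonneg_right hC1 (gap_rpow_nonneg hη 0 n (-(1 + q)))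
      linarith
    · rw [hN, mul_add, mul_add, ← mul_assoc, ← mul_assoc]
      refine add_le_add ?_ ?_
      · refine mul_le_mul_left ?_ _
        rw [← ENNReal.ofReal_mul (by positivity), ← ENNReal.ofReal_mul hC0.le]
        refine ENNReal.ofReal_le_ofReal ?_
        have := mul_le_mul_of_nonneg_right hC3 (mul_nonneg (sq_nonneg (η (t + 1)))
          (gap_rpow_nonneg hη (t + 1) n (-1)))
        linarith
      · rw [← ENNReal.ofReal_mul (by positivity), ← ENNReal.ofReal_mul hC0.le]
        refine ENNReal.ofReal_le_ofReal ?_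
        have := mul_le_mul_of_nonneg_right hC2 (mul_nonneg (sq_nonneg (η (t + 1)))
          (gap_rpow_nonneg hη (t + 1) n (-v)))
        linarith

end Errors

/-! ### Rescaling by the initial step size -/

theorem tsum_rpow_lt_top_of_le {J : Type*} {l : J → ℝ} (hl : ∀ j, 0 < l j) {M : ℝ}
    (hM : ∀ j, l j ≤ M) {s p : ℝ} (hsp : s ≤ p) (hs : ∑' j, ENNReal.ofReal (l j ^ s) < ⊤) :
    ∑' j, ENNReal.ofReal (l j ^ p) < ⊤ := by
  refine lt_of_le_of_lt (b := ∑' j, ENNReal.ofReal (M ^ (p - s)) * ENNReal.ofReal (l j ^ s))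
    (ENNReal.tsum_le_tsum fun j => ?_) ?_
  · rw [← ENNReal.ofReal_mul (Real.rpow_nonneg ((hl j).le.trans (hM j)) _)]
    refine ENNReal.ofReal_le_ofReal ?_
    have h1 : l j ^ p = l j ^ (p - s) * l j ^ s := by
      rw [← Real.rpow_add (hl j)]
      congr 1
      ring
    rw [h1]
    exact mul_le_mul_of_nonneg_right (Real.rpow_le_rpow (hl j).le (hM j) (by linarith))
      (Real.rpow_nonneg (hl j).le _)
  · rw [ENNReal.tsum_mul_left]
    exact ENNReal.mul_lt_top ENNReal.ofReal_lt_top hs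

/-- A finite sum of `l j ^ 0 = 1` means that there are finitely many indices. -/
theorem tsum_rpow_lt_top_of_zero {J : Type*} {l : J → ℝ}
    (h0 : ∑' j, ENNReal.ofReal (l j ^ (0 : ℝ)) < ⊤) (p : ℝ) :
    ∑' j, ENNReal.ofReal (l j ^ p) < ⊤ := by
  simp only [Real.rpow_zero, ENNReal.ofReal_one] at h0
  have : Finite J := by
    by_contra h
    rw [not_finite_iff_infinite] at h
    exact h0.ne (ENNReal.tsum_const_eq_top_of_ne_zero one_ne_zero)
  have := Fintype.ofFinite J
  rw [tsum_fintype]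
  exact ENNReal.sum_lt_top.2 fun _ _ => ENNReal.ofReal_lt_top

/-- The effect of rescaling the errors by a power of the initial step size `e ≤ 1`. -/
theorem rescaled_le {e : ℝ} (he : 0 < e) (he1 : e ≤ 1) {w : ℕ → ℝ} (hw : ∀ i, 0 ≤ w i)
    {C Z q v d : ℝ} (hC : 0 ≤ C) (hq : 0 ≤ q) (hdq : d ≤ q) (hv : 0 ≤ v) (hv2 : v ≤ 2)
    {K : ℕ → ℝ} (hK : ∀ n, 0 ≤ K n) {n : ℕ}
    (h : Z ≤ C * (gap (fun i => e * w i) 0 n ^ (-q) + ∑ t ∈ Finset.range n,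
      ((e * w (t + 1)) ^ 2 * gap (fun i => e * w i) (t + 1) n ^ (-v)) * (1 + K t))) :
    e ^ q * Z ≤ C * (gap w 0 n ^ (-q) + wsum w v (fun t => 1 + e ^ d * K t) n) := by
  have heq : 0 < e ^ q := Real.rpow_pos_of_pos he q
  refine (mul_le_mul_of_nonneg_left h heq.le).trans ?_
  rw [mul_left_comm]
  refine mul_le_mul_of_nonneg_left ?_ hC
  rw [mul_add, wsum, Finset.mul_sum]
  refine add_le_add ?_ (Finset.sum_le_sum fun t _ => ?_)
  · refine (mul_le_mul_of_nonneg_left (gap_const_mul_rpow_le he he1 hw hq 0 n) heq.le).trans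
      (le_of_eq ?_)
    rw [← mul_assoc, ← Real.rpow_add he, add_neg_cancel, Real.rpow_zero, one_mul]
  · have h1 := gap_const_mul_rpow_le he he1 hw hv (t + 1) n
    have h2 : e ^ 2 * e ^ (-v) ≤ 1 := by
      rw [← Real.rpow_natCast, ← Real.rpow_add he]
      exact Real.rpow_le_one he.le he1 (by push_cast; linarith)
    have h3 : e ^ q * (1 + K t) ≤ 1 + e ^ d * K t := by
      have h4 : e ^ q ≤ 1 := Real.rpow_le_one he.le he1 hq
      have h5 : e ^ q ≤ e ^ d := Real.rpow_le_rpow_of_exponent_ge he he1 hdq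
      have := mul_le_mul_of_nonneg_right h5 (hK t)
      linarith
    have hg := gap_rpow_nonneg hw (t + 1) n (-v)
    have h6 : (e * w (t + 1)) ^ 2 * gap (fun i => e * w i) (t + 1) n ^ (-v) ≤
        w (t + 1) ^ 2 * gap w (t + 1) n ^ (-v) := by
      calc (e * w (t + 1)) ^ 2 * gap (fun i => e * w i) (t + 1) n ^ (-v)
          ≤ (e * w (t + 1)) ^ 2 * (e ^ (-v) * gap w (t + 1) n ^ (-v)) := by gcongr
        _ = (e ^ 2 * e ^ (-v)) * (w (t + 1) ^ 2 * gap w (t + 1) n ^ (-v)) := by ring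
        _ ≤ 1 * (w (t + 1) ^ 2 * gap w (t + 1) n ^ (-v)) := by gcongr
        _ = _ := one_mul _
    calc e ^ q * ((e * w (t + 1)) ^ 2 * gap (fun i => e * w i) (t + 1) n ^ (-v) * (1 + K t))
        = ((e * w (t + 1)) ^ 2 * gap (fun i => e * w i) (t + 1) n ^ (-v)) *
          (e ^ q * (1 + K t)) := by ring
      _ ≤ (w (t + 1) ^ 2 * gap w (t + 1) n ^ (-v)) * (1 + e ^ d * K t) :=
          mul_le_mul h6 h3 (mul_nonneg heq.le (by linarith [hK t])) (by positivity)

/-- Transfer of a recursive bound from `[0, ∞]` to the real numbers. -/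
theorem toReal_le_of_le_ofReal_mul {Z : ℝ≥0∞} {C g : ℝ} {x : ℕ → ℝ} {K : ℕ → ℝ≥0∞} {n : ℕ}
    (hC : 0 ≤ C) (hg : 0 ≤ g) (hx : ∀ t, 0 ≤ x t) (hK : ∀ t, K t < ⊤)
    (h : Z ≤ ENNReal.ofReal C * (ENNReal.ofReal g + ∑ t ∈ Finset.range n,
      ENNReal.ofReal (x t) * (1 + K t))) :
    Z.toReal ≤ C * (g + ∑ t ∈ Finset.range n, x t * (1 + (K t).toReal)) := by
  refine ENNReal.toReal_le_of_le_ofReal ?_ (h.trans (le_of_eq ?_))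
  · have : 0 ≤ ∑ t ∈ Finset.range n, x t * (1 + (K t).toReal) :=
      Finset.sum_nonneg fun t _ => mul_nonneg (hx t) (by positivity)
    positivity
  · rw [ENNReal.ofReal_mul hC, ENNReal.ofReal_add hg
      (Finset.sum_nonneg fun t _ => mul_nonneg (hx t) (by positivity)),
      ENNReal.ofReal_sum_of_nonneg fun t _ => mul_nonneg (hx t) (by positivity)]
    congr 2
    refine Finset.sum_congr rfl fun t _ => ?_
    rw [ENNReal.ofReal_mul (hx t), ENNReal.ofReal_add zero_le_one ENNReal.toReal_nonneg,
      ENNReal.ofReal_toReal (hK t).ne, ENNReal.ofReal_one]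

section Errors

variable {𝕜 : Type*} [RCLike 𝕜]
    {X : Type*} [TopologicalSpace X] [PolishSpace X] [MeasurableSpace X] [BorelSpace X]
    {Y : Type*} [NormedAddCommGroup Y] [InnerProductSpace 𝕜 Y] [NormedSpace ℝ Y] [CompleteSpace Y]
    [SecondCountableTopology Y] [MeasurableSpace Y] [BorelSpace Y]
    {H : Type*} [NormedAddCommGroup H] [InnerProductSpace 𝕜 H] [CompleteSpace H] [RKHS 𝕜 H X Y]
    {κ : ℝ} (hK : IsBoundedMercer (X := X) (Y := Y) H κ)
    {ρ : Measure (X × Y)} [IsProbabilityMeasure ρ] {σ : ℝ} {hd : H}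
    {J : Type*} (S : EigenSystem (embedding ρ.fst hK) J)
    [SecondCountableTopology H] [Countable J]

include S in
/-- The recursive bounds of the prediction error `a` and of the squared norm `k` of the error, both
rescaled by powers of the initial step size `e`, with a constant that is uniform in `e`. The
steps are `e * w i`; the last two bounds differ in the control of the multiplicative noise, by `k` or
by `a`. -/
theorem exists_scaled_error_bounds (hnoise : CondNoiseBounded ρ σ)
    (hhd : (hd : X → Y) =ᵐ[ρ.fst] regression ρ) {M r : ℝ} (hM : ∀ j, S.eig j ≤ M)
    (hr : 1 / 2 < r) {Q : J → ℝ≥0∞} (hQs : ∑' j, Q j < ⊤)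
    (hQ : ∀ j, ‖⟪S.basis j, hd⟫_𝕜‖ₑ ^ 2 ≤ ENNReal.ofReal (S.eig j ^ (2 * r - 1)) * Q j)
    (hW : ∑' j, ENNReal.ofReal (S.eig j ^ (1 : ℝ)) < ⊤)
    {u v : ℝ} (hu : 0 ≤ u) (hu2 : u ≤ 2) (hv : 0 ≤ v) (hv2 : v ≤ 2)
    (hWu : ∑' j, ENNReal.ofReal (S.eig j ^ (2 - u)) < ⊤)
    (hWv : ∑' j, ENNReal.ofReal (S.eig j ^ (1 - v)) < ⊤) :
    ∃ C : ℝ, 0 < C ∧ ∀ e : ℝ, 0 < e → e ≤ 1 → ∀ w : ℕ → ℝ, (∀ i, 0 ≤ w i) →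
      (∀ i, e * w i * M ≤ 1) → ∃ a k : ℕ → ℝ, (∀ n, 0 ≤ a n) ∧ (∀ n, 0 ≤ k n) ∧
        (∀ n, predErr (ρ := ρ) hK hd (fun i => e * w i) n =
          ENNReal.ofReal (e ^ (-(2 * r)) * a n)) ∧
        (∀ n, normErr (𝕜 := 𝕜) hd (fun i => e * w i) ρ n =
          ENNReal.ofReal (e ^ (-(2 * r - 1)) * k n)) ∧
        (∀ n, k n ≤ C * (gap w 0 n ^ (-(2 * r - 1)) + wsum w v (fun t => 1 + k t) n)) ∧
        (∀ n, a n ≤ C * (gap w 0 n ^ (-(2 * r)) + wsum w u (fun t => 1 + k t) n)) ∧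
        (∀ n, a n ≤ C * (gap w 0 n ^ (-(2 * r)) + wsum w 1 a n + wsum w u (fun _ => 1) n)) := by
  obtain ⟨C₀, hC₀, h₀⟩ := exists_tsum_rpow_mul_coordErr_le hK S hnoise hhd (b := 0)
    (q := 2 * r - 1) (v := 0) hM (by linarith) le_rfl hQs hQ (by simpa using hW)
  obtain ⟨C₁, hC₁, h₁⟩ := exists_tsum_rpow_mul_coordErr_le hK S hnoise hhd (b := 0)
    (q := 2 * r - 1) (v := v) hM (by linarith) hv hQs hQ (by simpa using hWv)
  obtain ⟨C₂, hC₂, h₂⟩ := exists_tsum_rpow_mul_coordErr_le hK S hnoise hhd (b := 1)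
    (q := 2 * r - 1) (v := u) hM (by linarith) hu hQs hQ (by
      rw [show (1 : ℝ) + 1 - u = 2 - u by ring]; exact hWu)
  obtain ⟨C₃, hC₃, h₃⟩ := exists_predErr_le hK S hnoise hhd
    (q := 2 * r - 1) (v := u) hM (by linarith) hu hQs hQ hWu
  simp only [zero_add, Real.rpow_zero, ENNReal.ofReal_one, one_mul,
    tsum_coordErr hK S] at h₀ h₁
  simp only [add_sub_cancel, Real.rpow_one, tsum_eig_mul_coordErr hK S] at h₂ h₃
  set C := C₁ + C₂ + C₃ with hC
  refine ⟨C, by positivity, fun e he he1 w hw hwM => ?_⟩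
  set η : ℕ → ℝ := fun i => e * w i with hη
  have hη0 : ∀ i, 0 ≤ η i := fun i => mul_nonneg he.le (hw i)
  -- finiteness by strong induction, the norm at time `n` being bounded by those at earlier times
  have hKfin : ∀ n, normErr (𝕜 := 𝕜) hd η ρ n < ⊤ := by
    intro n
    induction n using Nat.strong_induction_on with
    | _ n ih =>
      refine (h₀ η hη0 hwM n).trans_lt (ENNReal.mul_lt_top ENNReal.ofReal_lt_top
        (ENNReal.add_lt_top.2 ⟨ENNReal.ofReal_lt_top, ENNReal.sum_lt_top.2 fun t ht => ?_⟩))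
      exact ENNReal.mul_lt_top ENNReal.ofReal_lt_top (ENNReal.add_lt_top.2
        ⟨ENNReal.one_lt_top, ih t (Finset.mem_range.1 ht)⟩)
  have hAfin : ∀ n, predErr (ρ := ρ) hK hd η n < ⊤ := by
    intro n
    refine (h₂ η hη0 hwM n).trans_lt (ENNReal.mul_lt_top ENNReal.ofReal_lt_top
      (ENNReal.add_lt_top.2 ⟨ENNReal.ofReal_lt_top, ENNReal.sum_lt_top.2 fun t _ => ?_⟩))
    exact ENNReal.mul_lt_top ENNReal.ofReal_lt_top (ENNReal.add_lt_top.2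
      ⟨ENNReal.one_lt_top, hKfin t⟩)
  have hx : ∀ (p : ℝ) (n t : ℕ), 0 ≤ η (t + 1) ^ 2 * gap η (t + 1) n ^ (-p) := fun p n t =>
    mul_nonneg (sq_nonneg _) (gap_rpow_nonneg hη0 _ _ _)
  set a : ℕ → ℝ := fun n => e ^ (2 * r) * (predErr (ρ := ρ) hK hd η n).toReal with ha
  set k : ℕ → ℝ := fun n => e ^ (2 * r - 1) * (normErr (𝕜 := 𝕜) hd η ρ n).toReal with hk
  have ha0 : ∀ n, 0 ≤ a n := fun n =>
    mul_nonneg (Real.rpow_nonneg he.le _) ENNReal.toReal_nonneg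
  have hk0 : ∀ n, 0 ≤ k n := fun n =>
    mul_nonneg (Real.rpow_nonneg he.le _) ENNReal.toReal_nonneg
  have hws : ∀ (p : ℝ) (f : ℕ → ℝ) (n : ℕ), (∀ t, 0 ≤ f t) → 0 ≤ wsum w p f n :=
    fun p f n hf => Finset.sum_nonneg fun t _ =>
      mul_nonneg (mul_nonneg (sq_nonneg _) (gap_rpow_nonneg hw _ _ _)) (hf t)
  have hk1 : ∀ t, 0 ≤ 1 + k t := fun t => by linarith [hk0 t]
  refine ⟨a, k, ha0, hk0, fun n => ?_, fun n => ?_, fun n => ?_, fun n => ?_, fun n => ?_⟩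
  · rw [ha, ← mul_assoc, ← Real.rpow_add he, neg_add_cancel, Real.rpow_zero, one_mul,
      ENNReal.ofReal_toReal (hAfin n).ne]
  · rw [hk, ← mul_assoc, ← Real.rpow_add he, neg_add_cancel, Real.rpow_zero, one_mul,
      ENNReal.ofReal_toReal (hKfin n).ne]
  · have h := toReal_le_of_le_ofReal_mul hC₁.le (gap_rpow_nonneg hη0 _ _ _) (hx v n) hKfin
      (h₁ η hη0 hwM n)
    refine (rescaled_le he he1 hw hC₁.le (by linarith) le_rfl hv hv2
      (fun _ => ENNReal.toReal_nonneg) h).trans ?_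
    exact mul_le_mul_of_nonneg_right (by linarith)
      (add_nonneg (gap_rpow_nonneg hw _ _ _) (hws _ _ _ hk1))
  · have h := toReal_le_of_le_ofReal_mul hC₂.le (gap_rpow_nonneg hη0 _ _ _) (hx u n) hKfin
      (h₂ η hη0 hwM n)
    refine (rescaled_le he he1 hw hC₂.le (d := 2 * r - 1) (by linarith)
      (by linarith) hu hu2 (fun _ => ENNReal.toReal_nonneg) h).trans ?_
    exact mul_le_mul_of_nonneg_right (by linarith)
      (add_nonneg (gap_rpow_nonneg hw _ _ _) (hws _ _ _ hk1))
  · have h := h₃ η hη0 hwM n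
    have hreal : (predErr (ρ := ρ) hK hd η n).toReal ≤ C₃ * (gap η 0 n ^ (-(2 * r)) +
        ∑ t ∈ Finset.range n, (η (t + 1) ^ 2 * gap η (t + 1) n ^ (-1 : ℝ) *
          (predErr (ρ := ρ) hK hd η t).toReal + η (t + 1) ^ 2 * gap η (t + 1) n ^ (-u))) := by
      have hnn : ∀ t, 0 ≤ η (t + 1) ^ 2 * gap η (t + 1) n ^ (-1 : ℝ) *
          (predErr (ρ := ρ) hK hd η t).toReal + η (t + 1) ^ 2 * gap η (t + 1) n ^ (-u) :=
        fun t => add_nonneg (mul_nonneg (hx 1 n t) ENNReal.toReal_nonneg) (hx u n t)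
      have hg := gap_rpow_nonneg hη0 0 n (-(2 * r))
      refine ENNReal.toReal_le_of_le_ofReal ?_ (h.trans (le_of_eq ?_))
      · exact mul_nonneg hC₃.le (add_nonneg hg (Finset.sum_nonneg fun t _ => hnn t))
      · rw [ENNReal.ofReal_mul hC₃.le, ENNReal.ofReal_add hg (Finset.sum_nonneg fun t _ => hnn t),
          ENNReal.ofReal_sum_of_nonneg fun t _ => hnn t]
        congr 2
        refine Finset.sum_congr rfl fun t _ => ?_
        rw [ENNReal.ofReal_add (mul_nonneg (hx 1 n t) ENNReal.toReal_nonneg) (hx u n t),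
          ENNReal.ofReal_mul (hx 1 n t), ENNReal.ofReal_toReal (hAfin t).ne]
    have he2 : 0 < e ^ (2 * r) := Real.rpow_pos_of_pos he _
    -- replacing the steps `η` by `w` costs `e ^ (-p)`, which the factor `e ^ 2` absorbs
    have hstep : ∀ p : ℝ, 0 ≤ p → p ≤ 2 → ∀ t, η (t + 1) ^ 2 * gap η (t + 1) n ^ (-p) ≤
        w (t + 1) ^ 2 * gap w (t + 1) n ^ (-p) := by
      intro p hp hp2 t
      have h2 : e ^ 2 * e ^ (-p) ≤ 1 := by
        rw [← Real.rpow_natCast, ← Real.rpow_add he]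
        exact Real.rpow_le_one he.le he1 (by push_cast; linarith)
      have h3 := gap_const_mul_rpow_le he he1 hw hp (t + 1) n
      have hg := gap_rpow_nonneg hw (t + 1) n (-p)
      calc (e * w (t + 1)) ^ 2 * gap η (t + 1) n ^ (-p)
          ≤ (e * w (t + 1)) ^ 2 * (e ^ (-p) * gap w (t + 1) n ^ (-p)) := by gcongr
        _ = (e ^ 2 * e ^ (-p)) * (w (t + 1) ^ 2 * gap w (t + 1) n ^ (-p)) := by ring
        _ ≤ 1 * (w (t + 1) ^ 2 * gap w (t + 1) n ^ (-p)) := by gcongr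
        _ = _ := one_mul _
    have hbias : e ^ (2 * r) * gap η 0 n ^ (-(2 * r)) ≤ gap w 0 n ^ (-(2 * r)) := by
      refine (mul_le_mul_of_nonneg_left (gap_const_mul_rpow_le he he1 hw
        (by linarith : 0 ≤ 2 * r) 0 n) he2.le).trans (le_of_eq ?_)
      rw [← mul_assoc, ← Real.rpow_add he, add_neg_cancel, Real.rpow_zero, one_mul]
    calc a n ≤ e ^ (2 * r) * (C₃ * (gap η 0 n ^ (-(2 * r)) +
        ∑ t ∈ Finset.range n, (η (t + 1) ^ 2 * gap η (t + 1) n ^ (-1 : ℝ) *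
          (predErr (ρ := ρ) hK hd η t).toReal + η (t + 1) ^ 2 * gap η (t + 1) n ^ (-u)))) :=
          mul_le_mul_of_nonneg_left hreal he2.le
      _ = C₃ * (e ^ (2 * r) * gap η 0 n ^ (-(2 * r)) +
        ∑ t ∈ Finset.range n, (η (t + 1) ^ 2 * gap η (t + 1) n ^ (-1 : ℝ) *
          a t + e ^ (2 * r) * (η (t + 1) ^ 2 * gap η (t + 1) n ^ (-u)))) := by
          rw [mul_left_comm, mul_add, Finset.mul_sum]
          congr 2
          refine Finset.sum_congr rfl fun t _ => ?_
          rw [ha]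
          ring
      _ ≤ C₃ * (gap w 0 n ^ (-(2 * r)) +
        ∑ t ∈ Finset.range n, (w (t + 1) ^ 2 * gap w (t + 1) n ^ (-1 : ℝ) *
          a t + w (t + 1) ^ 2 * gap w (t + 1) n ^ (-u) * 1)) := by
          refine mul_le_mul_of_nonneg_left (add_le_add hbias (Finset.sum_le_sum fun t _ => ?_))
            hC₃.le
          refine add_le_add (mul_le_mul_of_nonneg_right (hstep 1 zero_le_one one_le_two t)
            (ha0 t)) ?_
          rw [mul_one]
          exact (mul_le_of_le_one_left (hx u n t)
            (Real.rpow_le_one he.le he1 (by linarith))).trans (hstep u hu hu2 t)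
      _ = C₃ * (gap w 0 n ^ (-(2 * r)) + wsum w 1 a n + wsum w u (fun _ => 1) n) := by
          rw [Finset.sum_add_distrib, wsum, wsum, add_assoc]
      _ ≤ _ := mul_le_mul_of_nonneg_right (by linarith)
          (add_nonneg (add_nonneg (gap_rpow_nonneg hw _ _ _) (hws _ _ _ ha0))
            (hws _ _ _ fun _ => zero_le_one))

end Errors

/-! ### Weighted sums of powers -/

/-- An upper bound for the growth of `1 + ∫₁ˣ z ^ (-v) dz` in `x ≥ 1`, up to a constant factor: it is
`x ^ (1 - v)` for `v < 1`, `1 + log x` for `v = 1`, and `1` for `v > 1`. -/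
noncomputable def growth (v x : ℝ) : ℝ :=
  if v < 1 then x ^ (1 - v) else if v = 1 then 1 + Real.log x else 1

/-- `growth v x` is at most of the order `x ^ ε`. -/
def GrowthLE (v ε : ℝ) : Prop := ∃ C : ℝ, 0 < C ∧ ∀ x : ℝ, 1 ≤ x → growth v x ≤ C * x ^ ε

theorem growth_nonneg (v : ℝ) {x : ℝ} (hx : 1 ≤ x) : 0 ≤ growth v x := by
  unfold growth
  have := Real.log_nonneg hx
  split_ifs <;> positivity

theorem growth_mono (v : ℝ) {x y : ℝ} (hx : 1 ≤ x) (hxy : x ≤ y) : growth v x ≤ growth v y := by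
  unfold growth
  split_ifs with h1 h2
  · exact Real.rpow_le_rpow (by linarith) hxy (by linarith)
  · gcongr
  · exact le_rfl

theorem growth_two_mul_le (v : ℝ) :
    ∃ C : ℝ, 0 < C ∧ ∀ x : ℝ, 1 ≤ x → growth v (2 * x) ≤ C * growth v x := by
  refine ⟨2 + 2 ^ (1 - v), by positivity, fun x hx => ?_⟩
  have hl := Real.log_nonneg hx
  have h5 : (0 : ℝ) < 2 ^ (1 - v) := by positivity
  unfold growth
  split_ifs with h1 h2
  · rw [Real.mul_rpow two_pos.le (by linarith)]
    have : 0 ≤ x ^ (1 - v) := by positivity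
    nlinarith
  · rw [Real.log_mul two_ne_zero (by positivity)]
    have h4 : Real.log 2 ≤ 1 := by linarith [Real.log_two_lt_d9]
    nlinarith
  · linarith

theorem growthLE_of_ne {v ε : ℝ} (hv : v ≠ 1) (hε : 0 ≤ ε) (h : 1 - v ≤ ε) : GrowthLE v ε := by
  refine ⟨1, one_pos, fun x hx => ?_⟩
  rw [one_mul, growth]
  split_ifs with h1
  · exact Real.rpow_le_rpow_of_exponent_le hx h
  · exact Real.one_le_rpow hx hε

theorem growthLE_of_pos {v ε : ℝ} (hε : 0 < ε) (h : 1 - v ≤ ε) : GrowthLE v ε := by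
  rcases eq_or_ne v 1 with rfl | hv
  · refine ⟨1 + 1 / ε, by positivity, fun x hx => ?_⟩
    have h1 := Real.log_le_rpow_div (by linarith : 0 ≤ x) hε
    have h2 := Real.one_le_rpow hx hε.le
    rw [growth, if_neg (lt_irrefl _), if_pos rfl, add_mul, one_mul, one_div, mul_comm ε⁻¹,
      ← div_eq_mul_inv]
    exact add_le_add h2 h1
  · exact growthLE_of_ne hv hε.le h

/-- By telescoping, with the antiderivative of `z ^ (-v)` at the points `1 + a i`. -/
theorem sum_one_add_mul_rpow_le {v : ℝ} (hv : 0 ≤ v) :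
    ∃ C : ℝ, 0 < C ∧ ∀ a : ℝ, 0 < a → a ≤ 1 → ∀ n : ℕ,
      ∑ i ∈ Finset.range n, (1 + a * i) ^ (-v) ≤ C / a * growth v (1 + a * n) := by
  -- the increment `log (x + a) - log x` is at least `a / (2 x)` for `a ≤ 1 ≤ x`
  have hlog : ∀ a x : ℝ, 0 < a → a ≤ 1 → 1 ≤ x → a / (2 * x) ≤ a / (x + a) ∧
      a / (x + a) ≤ Real.log ((x + a) / x) := by
    intro a x ha ha1 hx
    refine ⟨div_le_div_of_nonneg_left ha.le (by linarith) (by linarith), ?_⟩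
    have h := Real.one_sub_inv_le_log_of_pos (x := (x + a) / x) (by positivity)
    refine le_trans (le_of_eq ?_) h
    field_simp
    ring
  have hx1 : ∀ a : ℝ, 0 < a → ∀ n : ℕ, 1 ≤ 1 + a * n := fun a ha n => by
    have : 0 ≤ a * n := by positivity
    linarith
  rcases lt_trichotomy v 1 with h1 | rfl | h1
  · refine ⟨2 / (1 - v), div_pos two_pos (by linarith), fun a ha ha1 n => ?_⟩
    rw [growth, if_pos h1]
    induction n with
    | zero => simp only [Finset.range_zero, Finset.sum_empty]; have : 0 < 1 - v := by linarith
              positivity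
    | succ n ih =>
      rw [Finset.sum_range_succ]
      have hx := hx1 a ha n
      push_cast
      set x := 1 + a * (n : ℝ) with hxdef
      rw [show 1 + a * ((n : ℝ) + 1) = x + a by rw [hxdef]; ring]
      obtain ⟨h2, h3⟩ := hlog a x ha ha1 hx
      have hx0 : 0 < x := by linarith
      have h4 : 1 + (1 - v) * (a / (2 * x)) ≤ ((x + a) / x) ^ (1 - v) := by
        rw [Real.rpow_def_of_pos (by positivity)]
        have := Real.add_one_le_exp (Real.log ((x + a) / x) * (1 - v))
        nlinarith
      rw [Real.div_rpow (by positivity) hx0.le, le_div_iff₀ (by positivity)] at h4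
      have h5 : x ^ (1 - v) = x ^ (-v) * x := by
        rw [← Real.rpow_add_one hx0.ne']
        congr 1
        ring
      have h6 : (1 + (1 - v) * (a / (2 * x))) * x ^ (1 - v) =
          x ^ (1 - v) + (1 - v) * a / 2 * x ^ (-v) := by
        rw [add_mul, one_mul]
        conv_lhs => rw [h5]
        rw [h5]
        field_simp
      rw [h6] at h4
      have h7 : x ^ (-v) = 2 / (1 - v) / a * ((1 - v) * a / 2 * x ^ (-v)) := by
        have : 1 - v ≠ 0 := by linarith
        field_simp
      rw [h7]
      have h8 : 0 ≤ 2 / (1 - v) / a := by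
        have : 0 < 1 - v := by linarith
        positivity
      nlinarith
  · refine ⟨2, two_pos, fun a ha ha1 n => ?_⟩
    rw [growth, if_neg (lt_irrefl _), if_pos rfl]
    have key : ∑ i ∈ Finset.range n, (1 + a * (i : ℝ)) ^ (-1 : ℝ) ≤
        2 / a * Real.log (1 + a * n) := by
      induction n with
      | zero => simp
      | succ n ih =>
        rw [Finset.sum_range_succ]
        have hx := hx1 a ha n
        push_cast
        set x := 1 + a * (n : ℝ) with hxdef
        rw [show 1 + a * ((n : ℝ) + 1) = x + a by rw [hxdef]; ring]
        obtain ⟨h2, h3⟩ := hlog a x ha ha1 hx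
        have hx0 : 0 < x := by linarith
        rw [Real.log_div (by positivity) hx0.ne'] at h3
        have h7 : x ^ (-1 : ℝ) = 2 / a * (a / (2 * x)) := by
          rw [Real.rpow_neg_one]
          field_simp
        rw [h7]
        have h8 : 0 ≤ 2 / a := by positivity
        nlinarith
    refine key.trans (mul_le_mul_of_nonneg_left (by linarith) (by positivity))
  · refine ⟨2 ^ v / (v - 1), div_pos (by positivity) (by linarith), fun a ha ha1 n => ?_⟩
    rw [growth, if_neg (by linarith), if_neg h1.ne']
    have hc : 0 ≤ 2 ^ v / (v - 1) / a := by
      have : 0 < v - 1 := by linarith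
      positivity
    have key : ∑ i ∈ Finset.range n, (1 + a * (i : ℝ)) ^ (-v) ≤
        2 ^ v / (v - 1) / a * (1 - (1 + a * n) ^ (1 - v)) := by
      induction n with
      | zero => simp
      | succ n ih =>
        rw [Finset.sum_range_succ]
        have hx := hx1 a ha n
        push_cast
        set x := 1 + a * (n : ℝ) with hxdef
        rw [show 1 + a * ((n : ℝ) + 1) = x + a by rw [hxdef]; ring]
        obtain ⟨h2, h3⟩ := hlog a x ha ha1 hx
        have hx0 : 0 < x := by linarith
        have hy0 : 0 < x + a := by linarith
        have h4 : 1 + (v - 1) * (a / (x + a)) ≤ (x / (x + a)) ^ (1 - v) := by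
          rw [Real.rpow_def_of_pos (by positivity)]
          have := Real.add_one_le_exp (Real.log (x / (x + a)) * (1 - v))
          rw [← inv_div (x + a) x, Real.log_inv] at this ⊢
          nlinarith
        rw [Real.div_rpow hx0.le hy0.le, le_div_iff₀ (by positivity)] at h4
        have h5 : (x + a) ^ (1 - v) = (x + a) ^ (-v) * (x + a) := by
          rw [← Real.rpow_add_one hy0.ne']
          congr 1
          ring
        have h6 : (1 + (v - 1) * (a / (x + a))) * (x + a) ^ (1 - v) =
            (x + a) ^ (1 - v) + (v - 1) * a * (x + a) ^ (-v) := by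
          rw [add_mul, one_mul]
          congr 1
          rw [h5]
          field_simp
        rw [h6] at h4
        have h7 : x ^ (-v) ≤ 2 ^ v * (x + a) ^ (-v) := by
          have : (2 * x) ^ (-v) ≤ (x + a) ^ (-v) :=
            Real.rpow_le_rpow_of_nonpos hy0 (by linarith) (by linarith)
          rw [Real.mul_rpow two_pos.le hx0.le] at this
          calc x ^ (-v) = 2 ^ v * (2 ^ (-v) * x ^ (-v)) := by
                rw [← mul_assoc, ← Real.rpow_add two_pos, add_neg_cancel, Real.rpow_zero, one_mul]
            _ ≤ _ := by gcongr
        have h8 : 2 ^ v * (x + a) ^ (-v) =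
            2 ^ v / (v - 1) / a * ((v - 1) * a * (x + a) ^ (-v)) := by
          have : v - 1 ≠ 0 := by linarith
          field_simp
        rw [h8] at h7
        nlinarith
    refine key.trans (mul_le_mul_of_nonneg_left ?_ hc)
    have : 0 ≤ (1 + a * (n : ℝ)) ^ (1 - v) := Real.rpow_nonneg (by linarith [hx1 a ha n]) _
    linarith

/-- A discrete Gronwall argument: a recursive bound whose total weight is small from the index `N`
on gives a bound that depends on the constants only. -/
theorem exists_bound_of_recursion (c U : ℝ) (hc : 0 ≤ c) (hU : 0 ≤ U) (N : ℕ) :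
    ∃ A : ℝ, 0 ≤ A ∧ ∀ (L : ℕ) (W : ℕ → ℕ → ℝ) (k : ℕ → ℝ), (∀ t n, 0 ≤ W t n) → (∀ n, 0 ≤ k n) →
      (∀ n ≤ L, ∑ t ∈ Finset.range n, W t n ≤ U) →
      (∀ n ≤ L, N ≤ n → c * ∑ t ∈ Finset.range n, W t n ≤ 1 / 2) →
      (∀ n ≤ L, k n ≤ c * (1 + ∑ t ∈ Finset.range n, W t n * (1 + k t))) →
      ∀ n ≤ L, k n ≤ A := by
  have hsum : ∀ (n : ℕ) (W : ℕ → ℕ → ℝ) (k : ℕ → ℝ) (B : ℝ), (∀ t n, 0 ≤ W t n) →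
      (∀ t < n, k t ≤ B) → ∑ t ∈ Finset.range n, W t n * (1 + k t) ≤
      (∑ t ∈ Finset.range n, W t n) * (1 + B) := by
    intro n W k B hW hk
    rw [Finset.sum_mul]
    exact Finset.sum_le_sum fun t ht => mul_le_mul_of_nonneg_left
      (by linarith [hk t (Finset.mem_range.1 ht)]) (hW _ _)
  have h1 : ∃ A : ℝ, 0 ≤ A ∧ ∀ (L : ℕ) (W : ℕ → ℕ → ℝ) (k : ℕ → ℝ), (∀ t n, 0 ≤ W t n) →
      (∀ n ≤ L, ∑ t ∈ Finset.range n, W t n ≤ U) →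
      (∀ n ≤ L, k n ≤ c * (1 + ∑ t ∈ Finset.range n, W t n * (1 + k t))) →
      ∀ n ≤ L, n < N → k n ≤ A := by
    induction N with
    | zero => exact ⟨0, le_rfl, fun _ _ _ _ _ _ n _ hn => absurd hn (Nat.not_lt_zero n)⟩
    | succ N ih =>
      obtain ⟨B, hB, h⟩ := ih
      refine ⟨B + c * (1 + U * (1 + B)), by positivity, fun L W k hW hWU hk n hn hnN => ?_⟩
      have h2 := hsum n W k B hW fun t ht => h L W k hW hWU hk t (by omega) (by omega)
      have h3 : (∑ t ∈ Finset.range n, W t n) * (1 + B) ≤ U * (1 + B) :=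
        mul_le_mul_of_nonneg_right (hWU n hn) (by linarith)
      have h4 : c * (1 + ∑ t ∈ Finset.range n, W t n * (1 + k t)) ≤ c * (1 + U * (1 + B)) :=
        mul_le_mul_of_nonneg_left (by linarith) hc
      linarith [hk n hn]
  obtain ⟨B, hB, h⟩ := h1
  refine ⟨B + 2 * c + 1, by positivity, fun L W k hW hk0 hWU hWN hk n hn => ?_⟩
  induction n using Nat.strong_induction_on with
  | _ n ih =>
    rcases lt_or_ge n N with hnN | hnN
    · linarith [h L W k hW hWU hk n hn hnN]
    · have h2 := hsum n W k _ hW fun t ht => ih t ht (by omega)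
      have h3 := hWN n hn hnN
      have h4 := mul_le_mul_of_nonneg_left h2 hc
      have h5 : c * ((∑ t ∈ Finset.range n, W t n) * (1 + (B + 2 * c + 1))) ≤
          1 / 2 * (1 + (B + 2 * c + 1)) := by
        rw [← mul_assoc]
        exact mul_le_mul_of_nonneg_right h3 (by linarith)
      linarith [hk n hn]

/-! ### Noise sums for decaying step sizes -/

theorem decay_nonneg (θ : ℝ) (i : ℕ) : 0 ≤ (i : ℝ) ^ (-θ) := Real.rpow_nonneg i.cast_nonneg _

theorem le_gap_decay {θ : ℝ} (hθ : 0 ≤ θ) (a b : ℕ) :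
    1 + (b + 1 : ℝ) ^ (-θ) * ((b - a : ℕ) : ℝ) ≤ gap (fun i => (i : ℝ) ^ (-θ)) a b := by
  rw [gap, add_le_add_iff_left]
  have : ∑ i ∈ Finset.Ico a b, (b + 1 : ℝ) ^ (-θ) ≤
      ∑ i ∈ Finset.Ico a b, ((i + 1 : ℕ) : ℝ) ^ (-θ) := by
    refine Finset.sum_le_sum fun i hi => ?_
    refine Real.rpow_le_rpow_of_nonpos (by positivity) ?_ (by linarith)
    push_cast
    have : (i : ℝ) ≤ b := by exact_mod_cast (Finset.mem_Ico.1 hi).2.le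
    linarith
  rwa [Finset.sum_const, Nat.card_Ico, nsmul_eq_mul, mul_comm] at this

/-- At least half of the steps number `1, …, b` come after the step `a`, each of at least
`(b + 1) ^ (-θ)`. -/
theorem half_rpow_le_gap_decay {θ : ℝ} (hθ : 0 ≤ θ) {a b : ℕ} (hab : 2 * a ≤ b) :
    (b + 1 : ℝ) ^ (1 - θ) / 2 ≤ gap (fun i => (i : ℝ) ^ (-θ)) a b := by
  refine le_trans ?_ (le_gap_decay hθ a b)
  have hN : (1 : ℝ) ≤ b + 1 := by linarith [(b.cast_nonneg : (0 : ℝ) ≤ b)]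
  rw [sub_eq_add_neg, Real.rpow_add (by linarith), Real.rpow_one, Nat.cast_sub (by omega)]
  have h1 : (b + 1 : ℝ) ^ (-θ) ≤ 1 := Real.rpow_le_one_of_one_le_of_nonpos hN (by linarith)
  have h2 : 0 ≤ (b + 1 : ℝ) ^ (-θ) := Real.rpow_nonneg (by linarith) _
  have h3 : (2 * a : ℝ) ≤ b := by exact_mod_cast hab
  nlinarith

theorem gap_decay_rpow_le {θ : ℝ} (hθ : 0 ≤ θ) {q : ℝ} (hq : 0 ≤ q) {a b : ℕ} (hab : 2 * a ≤ b) :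
    gap (fun i => (i : ℝ) ^ (-θ)) a b ^ (-q) ≤ 2 ^ q * (b + 1 : ℝ) ^ (-(q * (1 - θ))) := by
  have hN : (0 : ℝ) < b + 1 := by positivity
  have h := Real.rpow_le_rpow_of_nonpos (by positivity) (half_rpow_le_gap_decay hθ hab)
    (neg_nonpos.2 hq)
  refine h.trans (le_of_eq ?_)
  rw [Real.div_rpow (by positivity) two_pos.le, ← Real.rpow_mul hN.le, Real.rpow_neg two_pos.le,
    div_inv_eq_mul, mul_comm]
  congr 2
  ring

/-- The indices below `n / 2` are controlled by the sum of all steps, those above `n / 2` by the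
last step size. -/
theorem exists_wsum_decay_le {θ v q : ℝ} (hθ : 0 ≤ θ) (hθ1 : θ ≤ 1) (hv : 0 ≤ v) (hq : 0 ≤ q) :
    ∃ C : ℝ, 0 < C ∧ ∀ (F : ℝ) (f : ℕ → ℝ), (∀ t, f t ≤ F * (t + 1 : ℝ) ^ (-q)) → 0 ≤ F →
      ∀ n : ℕ, wsum (fun i => (i : ℝ) ^ (-θ)) v f n ≤
      C * F * ((n + 1 : ℝ) ^ (-(v * (1 - θ))) * growth (2 * θ + q) (n + 1) +
        (n + 1 : ℝ) ^ (-(θ + q)) * growth v ((n + 1 : ℝ) ^ (1 - θ))) := by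
  set p := 2 * θ + q with hp
  have hp0 : 0 ≤ p := by positivity
  obtain ⟨C₁, hC₁, h₁⟩ := sum_one_add_mul_rpow_le hp0
  obtain ⟨C₂, hC₂, h₂⟩ := sum_one_add_mul_rpow_le hv
  obtain ⟨C₃, hC₃, h₃⟩ := growth_two_mul_le v
  refine ⟨2 ^ v * C₁ + 2 ^ p * C₂ * C₃, by positivity, fun F f hf hF n => ?_⟩
  have hN : (1 : ℝ) ≤ n + 1 := by linarith [(n.cast_nonneg : (0 : ℝ) ≤ n)]
  have hN0 : (0 : ℝ) < n + 1 := by linarith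
  set N : ℝ := n + 1 with hNdef
  set a : ℝ := N ^ (-θ) with ha
  have ha0 : 0 < a := by positivity
  have ha1 : a ≤ 1 := Real.rpow_le_one_of_one_le_of_nonpos hN (by linarith)
  have hterm : ∀ t ∈ Finset.range n, (((t + 1 : ℕ) : ℝ) ^ (-θ)) ^ 2 *
      gap (fun i => (i : ℝ) ^ (-θ)) (t + 1) n ^ (-v) * f t ≤
      F * (2 ^ v * N ^ (-(v * (1 - θ))) * (1 + 1 * (t : ℝ)) ^ (-p) +
        2 ^ p * N ^ (-p) * (1 + a * ((n - 1 - t : ℕ) : ℝ)) ^ (-v)) := by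
    intro t ht
    have htn : t + 1 ≤ n := Finset.mem_range.1 ht
    set g := gap (fun i => (i : ℝ) ^ (-θ)) (t + 1) n ^ (-v) with hg
    have hg0 : 0 ≤ g := gap_rpow_nonneg (decay_nonneg θ) _ _ _
    have ht1 : (0 : ℝ) < t + 1 := by positivity
    have hpow : (((t + 1 : ℕ) : ℝ) ^ (-θ)) ^ 2 * (t + 1 : ℝ) ^ (-q) = (t + 1 : ℝ) ^ (-p) := by
      push_cast
      rw [← Real.rpow_natCast, ← Real.rpow_mul ht1.le, ← Real.rpow_add ht1]
      congr 1
      push_cast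
      rw [hp]
      ring
    have h4 : (((t + 1 : ℕ) : ℝ) ^ (-θ)) ^ 2 * g * f t ≤ F * ((t + 1 : ℝ) ^ (-p) * g) := by
      calc _ ≤ (((t + 1 : ℕ) : ℝ) ^ (-θ)) ^ 2 * g * (F * (t + 1 : ℝ) ^ (-q)) :=
            mul_le_mul_of_nonneg_left (hf t) (by positivity)
        _ = F * ((((t + 1 : ℕ) : ℝ) ^ (-θ)) ^ 2 * (t + 1 : ℝ) ^ (-q) * g) := by ring
        _ = _ := by rw [hpow]
    refine h4.trans (mul_le_mul_of_nonneg_left ?_ hF)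
    have hx0 : 0 ≤ (1 + 1 * (t : ℝ)) ^ (-p) := by positivity
    have hy0 : 0 ≤ (1 + a * ((n - 1 - t : ℕ) : ℝ)) ^ (-v) := by positivity
    rw [one_mul, add_comm 1 (t : ℝ)] at hx0 ⊢
    -- either the steps after `t + 1` have a sum of the order `N ^ (1 - θ)`, or `t + 1 ≥ N / 2`
    rcases le_or_gt (2 * (t + 1)) n with h | h
    · have h5 := gap_decay_rpow_le hθ hv h
      have : 0 ≤ 2 ^ p * N ^ (-p) * (1 + a * ((n - 1 - t : ℕ) : ℝ)) ^ (-v) := by positivity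
      calc (t + 1 : ℝ) ^ (-p) * g ≤ (t + 1 : ℝ) ^ (-p) * (2 ^ v * N ^ (-(v * (1 - θ)))) := by
            gcongr
        _ ≤ _ := by linarith
    · have h5 : (t + 1 : ℝ) ^ (-p) ≤ 2 ^ p * N ^ (-p) := by
        have : N / 2 ≤ t + 1 := by
          have : (n + 1 : ℝ) ≤ 2 * (t + 1) := by exact_mod_cast h
          rw [hNdef]
          linarith
        refine (Real.rpow_le_rpow_of_nonpos (by positivity) this (by linarith)).trans (le_of_eq ?_)
        rw [Real.div_rpow hN0.le two_pos.le, Real.rpow_neg two_pos.le, div_inv_eq_mul, mul_comm]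
      have h6 : g ≤ (1 + a * ((n - 1 - t : ℕ) : ℝ)) ^ (-v) := by
        refine Real.rpow_le_rpow_of_nonpos (by positivity) ?_ (by linarith)
        have := le_gap_decay hθ (t + 1) n
        rwa [show n - (t + 1) = n - 1 - t by omega] at this
      have : 0 ≤ 2 ^ v * N ^ (-(v * (1 - θ))) * (t + 1 : ℝ) ^ (-p) := by positivity
      calc (t + 1 : ℝ) ^ (-p) * g ≤ 2 ^ p * N ^ (-p) *
            (1 + a * ((n - 1 - t : ℕ) : ℝ)) ^ (-v) := by gcongr
        _ ≤ _ := by linarith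
  have hs1 := h₁ 1 one_pos le_rfl n
  have hs2 := h₂ a ha0 ha1 n
  rw [← Finset.sum_range_reflect] at hs2
  have h1N : 1 + 1 * (n : ℝ) = N := by rw [hNdef]; ring
  rw [h1N, div_one] at hs1
  have hx1 : 1 ≤ N ^ (1 - θ) := Real.one_le_rpow hN (by linarith)
  have hg2 : growth v (1 + a * n) ≤ C₃ * growth v (N ^ (1 - θ)) := by
    refine (growth_mono v (by have : 0 ≤ a * (n : ℝ) := by positivity
                              linarith) ?_).trans (h₃ _ hx1)
    have : a * n ≤ N ^ (1 - θ) := by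
      rw [sub_eq_add_neg, Real.rpow_add hN0, Real.rpow_one, mul_comm]
      exact mul_le_mul_of_nonneg_right (by rw [hNdef]; linarith) ha0.le
    linarith
  have hpa : N ^ (-p) * (C₂ / a) = C₂ * N ^ (-(θ + q)) := by
    rw [ha, Real.rpow_neg hN0.le θ, div_inv_eq_mul, mul_left_comm, ← Real.rpow_add hN0]
    congr 2
    rw [hp]
    ring
  have hgp := growth_nonneg p hN
  have hgv := growth_nonneg v hx1
  calc wsum (fun i => (i : ℝ) ^ (-θ)) v f n
      ≤ ∑ t ∈ Finset.range n, F * (2 ^ v * N ^ (-(v * (1 - θ))) * (1 + 1 * (t : ℝ)) ^ (-p) +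
        2 ^ p * N ^ (-p) * (1 + a * ((n - 1 - t : ℕ) : ℝ)) ^ (-v)) := Finset.sum_le_sum hterm
    _ = F * (2 ^ v * N ^ (-(v * (1 - θ))) * ∑ t ∈ Finset.range n, (1 + 1 * (t : ℝ)) ^ (-p) +
        2 ^ p * N ^ (-p) * ∑ t ∈ Finset.range n, (1 + a * ((n - 1 - t : ℕ) : ℝ)) ^ (-v)) := by
        rw [← Finset.mul_sum, Finset.sum_add_distrib, Finset.mul_sum, Finset.mul_sum]
    _ ≤ F * (2 ^ v * N ^ (-(v * (1 - θ))) * (C₁ * growth p N) +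
        2 ^ p * N ^ (-p) * (C₂ / a * (C₃ * growth v (N ^ (1 - θ))))) := by
        gcongr
        exact hs2.trans (mul_le_mul_of_nonneg_left hg2 (by positivity))
    _ = F * (2 ^ v * C₁ * (N ^ (-(v * (1 - θ))) * growth p N) +
        2 ^ p * C₂ * C₃ * (N ^ (-(θ + q)) * growth v (N ^ (1 - θ)))) := by
        rw [show 2 ^ p * N ^ (-p) * (C₂ / a * (C₃ * growth v (N ^ (1 - θ)))) =
          2 ^ p * (N ^ (-p) * (C₂ / a)) * (C₃ * growth v (N ^ (1 - θ))) by ring, hpa]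
        ring
    _ ≤ (2 ^ v * C₁ + 2 ^ p * C₂ * C₃) * F * (N ^ (-(v * (1 - θ))) * growth p N +
        N ^ (-(θ + q)) * growth v (N ^ (1 - θ))) := by
        have e1 : 0 ≤ N ^ (-(v * (1 - θ))) * growth p N := by positivity
        have e2 : 0 ≤ N ^ (-(θ + q)) * growth v (N ^ (1 - θ)) := by positivity
        have e3 : 0 ≤ F * (2 ^ v * C₁) * (N ^ (-(θ + q)) * growth v (N ^ (1 - θ))) := by positivity
        have e4 : 0 ≤ F * (2 ^ p * C₂ * C₃) * (N ^ (-(v * (1 - θ))) * growth p N) := by positivity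
        nlinarith

/-- The rate `β` is attained if both parts of `exists_wsum_decay_le` attain it. -/
theorem exists_wsum_decay_le_rpow {θ v q ε₁ ε₂ β : ℝ} (hθ : 0 ≤ θ) (hθ1 : θ ≤ 1) (hv : 0 ≤ v)
    (hq : 0 ≤ q) (h₁ : GrowthLE (2 * θ + q) ε₁) (h₂ : GrowthLE v ε₂)
    (hβ₁ : β + ε₁ ≤ v * (1 - θ)) (hβ₂ : β + (1 - θ) * ε₂ ≤ θ + q) :
    ∃ C : ℝ, 0 < C ∧ ∀ (F : ℝ) (f : ℕ → ℝ), (∀ t, f t ≤ F * (t + 1 : ℝ) ^ (-q)) → 0 ≤ F →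
      ∀ n : ℕ, wsum (fun i => (i : ℝ) ^ (-θ)) v f n ≤ C * F * (n + 1 : ℝ) ^ (-β) := by
  obtain ⟨C, hC, h⟩ := exists_wsum_decay_le hθ hθ1 hv hq
  obtain ⟨C₁, hC₁, h₁⟩ := h₁
  obtain ⟨C₂, hC₂, h₂⟩ := h₂
  refine ⟨C * (C₁ + C₂), by positivity, fun F f hf hF n => (h F f hf hF n).trans ?_⟩
  have hN : (1 : ℝ) ≤ n + 1 := by linarith [(n.cast_nonneg : (0 : ℝ) ≤ n)]
  have hN0 : (0 : ℝ) < n + 1 := by linarith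
  set N : ℝ := n + 1 with hNdef
  have e1 : N ^ (-(v * (1 - θ))) * growth (2 * θ + q) N ≤ C₁ * N ^ (-β) := by
    calc _ ≤ N ^ (-(v * (1 - θ))) * (C₁ * N ^ ε₁) := by gcongr; exact h₁ N hN
      _ = C₁ * N ^ (-(v * (1 - θ)) + ε₁) := by rw [Real.rpow_add hN0]; ring
      _ ≤ _ := by
        gcongr
        linarith
  have e2 : N ^ (-(θ + q)) * growth v (N ^ (1 - θ)) ≤ C₂ * N ^ (-β) := by
    calc _ ≤ N ^ (-(θ + q)) * (C₂ * (N ^ (1 - θ)) ^ ε₂) := by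
          gcongr
          exact h₂ _ (Real.one_le_rpow hN (by linarith))
      _ = C₂ * N ^ (-(θ + q) + (1 - θ) * ε₂) := by
          rw [Real.rpow_add hN0, Real.rpow_mul hN0.le]; ring
      _ ≤ _ := by
        gcongr
        linarith
  calc _ ≤ C * F * (C₁ * N ^ (-β) + C₂ * N ^ (-β)) := by gcongr
    _ = _ := by ring

/-! ### Rates for decaying step sizes -/

/-- A recursive bound is uniform in `n` if the total weight of the noise decays. -/
theorem exists_bound_of_wsum {c C β : ℝ} (hc : 0 < c) (hC : 0 ≤ C) (hβ : 0 < β) (v : ℝ) :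
    ∃ A : ℝ, 0 ≤ A ∧ ∀ (L : ℕ) (w k : ℕ → ℝ), (∀ i, 0 ≤ w i) → (∀ n, 0 ≤ k n) →
      (∀ n ≤ L, wsum w v (fun _ => 1) n ≤ C * (n + 1 : ℝ) ^ (-β)) →
      (∀ n ≤ L, k n ≤ c * (1 + wsum w v (fun t => 1 + k t) n)) → ∀ n ≤ L, k n ≤ A := by
  have htend : Tendsto (fun n : ℕ => c * (C * (n + 1 : ℝ) ^ (-β))) atTop (𝓝 (c * (C * 0))) := by
    refine ((tendsto_rpow_neg_atTop hβ).comp ?_ |>.const_mul C).const_mul c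
    exact tendsto_atTop_add_const_right _ _ tendsto_natCast_atTop_atTop
  rw [mul_zero, mul_zero] at htend
  obtain ⟨N, hN⟩ := eventually_atTop.1 (htend.eventually_le_const (by norm_num : (0 : ℝ) < 1 / 2))
  obtain ⟨A, hA, h⟩ := exists_bound_of_recursion c C hc.le hC N
  refine ⟨A, hA, fun L w k hw hk hwC hrec => ?_⟩
  have hsum : ∀ n, ∑ t ∈ Finset.range n, w (t + 1) ^ 2 * gap w (t + 1) n ^ (-v) =
      wsum w v (fun _ => 1) n := fun n => by simp only [wsum, mul_one]
  refine h L (fun t n => w (t + 1) ^ 2 * gap w (t + 1) n ^ (-v)) k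
    (fun t n => mul_nonneg (sq_nonneg _) (gap_rpow_nonneg hw _ _ _)) hk (fun n hn => ?_)
    (fun n hn hNn => ?_) hrec
  · rw [hsum]
    refine (hwC n hn).trans (mul_le_of_le_one_right hC ?_)
    exact Real.rpow_le_one_of_one_le_of_nonpos (by linarith [(n.cast_nonneg : (0 : ℝ) ≤ n)])
      (by linarith)
  · rw [hsum]
    exact (mul_le_mul_of_nonneg_left (hwC n hn) hc.le).trans (hN n hNn)

theorem wsum_add (w : ℕ → ℝ) (v : ℝ) (f g : ℕ → ℝ) (n : ℕ) :
    wsum w v (fun t => f t + g t) n = wsum w v f n + wsum w v g n := by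
  simp only [wsum, mul_add, Finset.sum_add_distrib]

theorem wsum_anti {w : ℕ → ℝ} (hw : ∀ i, 0 ≤ w i) {v u : ℝ} (hvu : v ≤ u) {f : ℕ → ℝ}
    (hf : ∀ t, 0 ≤ f t) (n : ℕ) : wsum w u f n ≤ wsum w v f n := by
  refine Finset.sum_le_sum fun t _ => mul_le_mul_of_nonneg_right (mul_le_mul_of_nonneg_left
    (Real.rpow_le_rpow_of_exponent_le (one_le_gap hw _ _) (by linarith)) (sq_nonneg _)) (hf t)

theorem gap_rpow_le_one {w : ℕ → ℝ} (hw : ∀ i, 0 ≤ w i) {q : ℝ} (hq : 0 ≤ q) (a b : ℕ) :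
    gap w a b ^ (-q) ≤ 1 :=
  Real.rpow_le_one_of_one_le_of_nonpos (one_le_gap hw a b) (by linarith)

theorem one_add_log_le {x : ℝ} (hx : 2 ≤ x) : 1 + Real.log x ≤ 3 * Real.log x := by
  have h1 := Real.log_le_log two_pos hx
  linarith [Real.log_two_gt_d9]

/-- `exists_wsum_decay_le_rpow` for bounded `f`. -/
theorem exists_wsum_decay_le_of_bdd {θ v ε₁ ε₂ β : ℝ} (hθ : 0 ≤ θ) (hθ1 : θ ≤ 1) (hv : 0 ≤ v)
    (h₁ : GrowthLE (2 * θ) ε₁) (h₂ : GrowthLE v ε₂)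
    (hβ₁ : β + ε₁ ≤ v * (1 - θ)) (hβ₂ : β + (1 - θ) * ε₂ ≤ θ) :
    ∃ C : ℝ, 0 < C ∧ ∀ (F : ℝ) (f : ℕ → ℝ), (∀ t, f t ≤ F) → 0 ≤ F →
      ∀ n : ℕ, wsum (fun i => (i : ℝ) ^ (-θ)) v f n ≤ C * F * (n + 1 : ℝ) ^ (-β) := by
  obtain ⟨C, hC, h⟩ := exists_wsum_decay_le_rpow (q := 0) (β := β) hθ hθ1 hv le_rfl
    (by rwa [add_zero]) h₂ hβ₁ (by rwa [add_zero])
  exact ⟨C, hC, fun F f hf hF n => h F f (fun t => by simpa using hf t) hF n⟩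

/-- The norm of the error stays bounded for `s / (1 + s) < θ`: then `(1 - s) (1 - θ) > 1 - 2 θ` and
`θ > (1 - θ) s`, so both parts of the noise sum decay. -/
theorem exists_norm_bound_decay {s θ v C q : ℝ} (hs0 : 0 ≤ s) (hs1 : s < 1) (hθ1 : θ < 1)
    (hsθ : s / (1 + s) < θ) (hv : 0 ≤ v) (hvs : 1 - s ≤ v) (hvG : GrowthLE v s) (hC : 0 < C)
    (hq : 0 ≤ q) :
    ∃ A : ℝ, 0 ≤ A ∧ ∀ k : ℕ → ℝ, (∀ n, 0 ≤ k n) →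
      (∀ n, k n ≤ C * (gap (fun i => (i : ℝ) ^ (-θ)) 0 n ^ (-q) +
        wsum (fun i => (i : ℝ) ^ (-θ)) v (fun t => 1 + k t) n)) → ∀ n, k n ≤ A := by
  have hθ0 : 0 < θ := lt_of_le_of_lt (by positivity) hsθ
  rw [div_lt_iff₀ (by linarith)] at hsθ
  have hd : 0 < (1 - s) * (1 - θ) := mul_pos (by linarith) (by linarith)
  have hδ : 0 < θ - (1 - θ) * s := by nlinarith
  have hvd : (1 - s) * (1 - θ) ≤ v * (1 - θ) :=
    mul_le_mul_of_nonneg_right hvs (by linarith)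
  set β := min ((1 - s) * (1 - θ)) (θ - (1 - θ) * s) / 2 with hβdef
  have hβ : 0 < β := half_pos (lt_min hd hδ)
  have hβ1 : β ≤ (1 - s) * (1 - θ) / 2 := by rw [hβdef]; gcongr; exact min_le_left _ _
  have hβ2 : β ≤ (θ - (1 - θ) * s) / 2 := by rw [hβdef]; gcongr; exact min_le_right _ _
  obtain ⟨D, hD, h⟩ := exists_wsum_decay_le_of_bdd (ε₁ := (1 - s) * (1 - θ) - β) (β := β) hθ0.le
    hθ1.le hv (growthLE_of_pos (by linarith) (by nlinarith)) hvG (by linarith) (by linarith)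
  obtain ⟨A, hA, hb⟩ := exists_bound_of_wsum hC hD.le hβ v
  refine ⟨A, hA, fun k hk hrec n => hb n _ k (decay_nonneg θ) hk (fun m _ => ?_) (fun m _ => ?_) n
    le_rfl⟩
  · simpa using h 1 (fun _ => 1) (fun _ => le_rfl) zero_le_one m
  · refine (hrec m).trans (mul_le_mul_of_nonneg_left ?_ hC.le)
    linarith [gap_rpow_le_one (decay_nonneg θ) hq 0 m]

/-- The prediction error stays bounded for all `0 < θ < 1`, by its own recursion. -/
theorem exists_pred_bound_decay {θ C q u : ℝ} (hθ0 : 0 < θ) (hθ1 : θ < 1) (hu : 1 ≤ u) (hC : 0 < C)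
    (hq : 0 ≤ q) :
    ∃ A : ℝ, 0 ≤ A ∧ ∀ a : ℕ → ℝ, (∀ n, 0 ≤ a n) →
      (∀ n, a n ≤ C * (gap (fun i => (i : ℝ) ^ (-θ)) 0 n ^ (-q) +
        wsum (fun i => (i : ℝ) ^ (-θ)) 1 a n +
        wsum (fun i => (i : ℝ) ^ (-θ)) u (fun _ => 1) n)) → ∀ n, a n ≤ A := by
  set β := min θ (1 - θ) / 2 with hβdef
  have hβ : 0 < β := half_pos (lt_min hθ0 (by linarith))
  have hβ1 : β ≤ θ / 2 := by rw [hβdef]; gcongr; exact min_le_left _ _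
  have hβ2 : β ≤ (1 - θ) / 2 := by rw [hβdef]; gcongr; exact min_le_right _ _
  obtain ⟨D, hD, h⟩ := exists_wsum_decay_le_of_bdd (v := 1) (ε₁ := 1 - θ - β)
    (ε₂ := θ / 2 / (1 - θ)) (β := β) hθ0.le
    hθ1.le zero_le_one (growthLE_of_pos (by linarith) (by linarith))
    (growthLE_of_pos (div_pos (by linarith) (by linarith)) (by
      have : 0 ≤ θ / 2 / (1 - θ) := div_nonneg (by linarith) (by linarith)
      linarith)) (by linarith) (by
      rw [mul_div_cancel₀ _ (by linarith : 1 - θ ≠ 0)]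
      linarith)
  obtain ⟨A, hA, hb⟩ := exists_bound_of_wsum hC hD.le hβ 1
  refine ⟨A, hA, fun a ha hrec n => hb n _ a (decay_nonneg θ) ha (fun m _ => ?_) (fun m _ => ?_) n
    le_rfl⟩
  · simpa using h 1 (fun _ => 1) (fun _ => le_rfl) zero_le_one m
  · refine (hrec m).trans (mul_le_mul_of_nonneg_left ?_ hC.le)
    rw [wsum_add]
    linarith [gap_rpow_le_one (decay_nonneg θ) hq 0 m,
      wsum_anti (decay_nonneg θ) hu (f := fun _ => 1) (fun _ => zero_le_one) m]

/-- The rate of the prediction error for decaying step sizes. -/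
theorem exists_pred_rate_decay {r s θ v C : ℝ} (hr : 1 / 2 < r) (hs0 : 0 ≤ s) (hs1 : s ≤ 1)
    (hθ0 : 0 < θ) (hθ1 : θ < 1) (hv : 0 ≤ v) (hvs : 1 - s ≤ v) (hvG : GrowthLE v s) (hC : 0 < C) :
    ∃ c : ℝ, 0 < c ∧ ∀ a k : ℕ → ℝ, (∀ n, 0 ≤ a n) → (∀ n, 0 ≤ k n) →
      (∀ n, k n ≤ C * (gap (fun i => (i : ℝ) ^ (-θ)) 0 n ^ (-(2 * r - 1)) +
        wsum (fun i => (i : ℝ) ^ (-θ)) v (fun t => 1 + k t) n)) →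
      (∀ n, a n ≤ C * (gap (fun i => (i : ℝ) ^ (-θ)) 0 n ^ (-(2 * r)) +
        wsum (fun i => (i : ℝ) ^ (-θ)) (2 - s) (fun t => 1 + k t) n)) →
      (∀ n, a n ≤ C * (gap (fun i => (i : ℝ) ^ (-θ)) 0 n ^ (-(2 * r)) +
        wsum (fun i => (i : ℝ) ^ (-θ)) 1 a n +
        wsum (fun i => (i : ℝ) ^ (-θ)) (2 - s) (fun _ => 1) n)) →
      ∀ n : ℕ, 1 ≤ n → a n ≤ c * predRateDecay r s θ n := by
  have hbias : ∀ n : ℕ, gap (fun i => (i : ℝ) ^ (-θ)) 0 n ^ (-(2 * r)) ≤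
      2 ^ (2 * r) * (n + 1 : ℝ) ^ (-(2 * r * (1 - θ))) := fun n =>
    gap_decay_rpow_le hθ0.le (by linarith) (by omega)
  have hN1 : ∀ n : ℕ, (1 : ℝ) ≤ n + 1 := fun n => by linarith [(n.cast_nonneg : (0 : ℝ) ≤ n)]
  have hpow : ∀ (n : ℕ) {x y : ℝ}, y ≤ x → (n + 1 : ℝ) ^ (-x) ≤ (n + 1 : ℝ) ^ (-y) :=
    fun n x y h => Real.rpow_le_rpow_of_exponent_le (hN1 n) (by linarith)
  obtain ⟨A, hA, hAa⟩ := exists_pred_bound_decay (u := 2 - s) hθ0 hθ1 (by linarith) hC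
    (by linarith : 0 ≤ 2 * r)
  rcases hs1.eq_or_lt with rfl | hs1
  · -- for `s = 1` the prediction error itself is bounded, and the noise has exponent `1`
    have hm : min (2 * r) (2 - 1) = 1 := by
      rw [min_eq_right] <;> linarith
    have hθ2 : θ ≤ 1 / (1 + 1) ↔ θ ≤ 1 / 2 := by norm_num
    rcases le_or_gt θ (1 / 2) with hθ | hθ
    · obtain ⟨D, hD, h⟩ := exists_wsum_decay_le (v := 1) (q := 0) hθ0.le hθ1.le zero_le_one le_rfl
      refine ⟨C * (2 ^ (2 * r) * 3 + D * (1 + A) * 6), by positivity,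
        fun a k ha hk _ _ hP n hn => ?_⟩
      have hN2 : (2 : ℝ) ≤ n + 1 := by
        have : (1 : ℝ) ≤ n := by exact_mod_cast hn
        linarith
      have hlog := one_add_log_le hN2
      have hlog0 : 0 ≤ Real.log (n + 1) := Real.log_nonneg (hN1 n)
      have hN0 : (0 : ℝ) < n + 1 := by linarith
      simp only [predRateDecay, hm, fTwo, if_true, hθ2, if_pos hθ]
      have h1 := h (1 + A) (fun t => a t + 1) (fun t => by
        simpa [add_comm] using hAa a ha hP t) (by linarith) n
      simp only [add_zero, one_mul] at h1
      have h2 : (n + 1 : ℝ) ^ (-(1 - θ)) * growth (2 * θ) (n + 1) ≤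
          (n + 1 : ℝ) ^ (-θ) * (3 * Real.log (n + 1)) := by
        rcases hθ.eq_or_lt with rfl | hθ
        · rw [growth, if_neg (by norm_num), if_pos (by norm_num)]
          norm_num only
          gcongr
        · rw [growth, if_pos (by linarith), ← Real.rpow_add hN0,
            show -(1 - θ) + (1 - 2 * θ) = -θ by ring]
          exact le_mul_of_one_le_right (by positivity) (by linarith)
      have h3 : (n + 1 : ℝ) ^ (-θ) * growth 1 ((n + 1 : ℝ) ^ (1 - θ)) ≤
          (n + 1 : ℝ) ^ (-θ) * (3 * Real.log (n + 1)) := by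
        refine mul_le_mul_of_nonneg_left ?_ (by positivity)
        rw [growth, if_neg (lt_irrefl _), if_pos rfl, Real.log_rpow hN0]
        nlinarith
      have h4 : (n + 1 : ℝ) ^ (-(2 * r * (1 - θ))) ≤
          (n + 1 : ℝ) ^ (-θ) * (3 * Real.log (n + 1)) :=
        (hpow n (by nlinarith : θ ≤ 2 * r * (1 - θ))).trans
          (le_mul_of_one_le_right (by positivity) (by linarith))
      set R := (n + 1 : ℝ) ^ (-θ) * Real.log (n + 1)
      have h5 := hP n
      rw [show (2 : ℝ) - 1 = 1 by norm_num, add_assoc, ← wsum_add] at h5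
      refine h5.trans ?_
      rw [mul_assoc]
      refine mul_le_mul_of_nonneg_left ?_ hC.le
      have h6 := h1.trans (mul_le_mul_of_nonneg_left (add_le_add h2 h3) (by positivity))
      have h7 := (hbias n).trans (mul_le_mul_of_nonneg_left h4 (by positivity))
      calc _ ≤ 2 ^ (2 * r) * ((n + 1 : ℝ) ^ (-θ) * (3 * Real.log (n + 1))) +
            D * (1 + A) * ((n + 1 : ℝ) ^ (-θ) * (3 * Real.log (n + 1)) +
              (n + 1 : ℝ) ^ (-θ) * (3 * Real.log (n + 1))) := add_le_add h7 h6
        _ = _ := by ring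
    · obtain ⟨D, hD, h⟩ := exists_wsum_decay_le_of_bdd (v := 1) (ε₁ := 0)
        (ε₂ := (2 * θ - 1) / (1 - θ)) (β := 1 - θ) hθ0.le hθ1.le zero_le_one
        (growthLE_of_ne (by linarith) le_rfl (by linarith))
        (growthLE_of_pos (div_pos (by linarith) (by linarith)) (by
          have : 0 ≤ (2 * θ - 1) / (1 - θ) := div_nonneg (by linarith) (by linarith)
          linarith)) (by linarith) (by
          rw [mul_div_cancel₀ _ (by linarith : 1 - θ ≠ 0)]
          linarith)
      refine ⟨C * (2 ^ (2 * r) + D * (1 + A)), by positivity,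
        fun a k ha hk _ _ hP n hn => ?_⟩
      simp only [predRateDecay, hm, fTwo, hθ2, if_neg hθ.not_ge]
      have h1 := h (1 + A) (fun t => a t + 1) (fun t => by
        linarith [hAa a ha hP t]) (by linarith) n
      have h5 := hP n
      rw [show (2 : ℝ) - 1 = 1 by norm_num, add_assoc, ← wsum_add] at h5
      refine h5.trans ?_
      rw [mul_assoc, one_mul]
      refine mul_le_mul_of_nonneg_left ?_ hC.le
      have h4 := hpow n (by nlinarith : 1 - θ ≤ 2 * r * (1 - θ))
      have h7 := (hbias n).trans (mul_le_mul_of_nonneg_left h4 (by positivity))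
      linarith
  · set m := min (2 * r) (2 - s) with hm
    have hm1 : 1 < m := lt_min (by linarith) (by linarith)
    have hm2 : m ≤ 2 * r := min_le_left _ _
    have hm3 : m ≤ 2 - s := min_le_right _ _
    -- it suffices to bound the noise term of the recursion by the rate
    have hnoise : ∃ D : ℝ, 0 < D ∧ ∀ (F : ℝ) (f : ℕ → ℝ), (∀ t, f t ≤ F) → 0 ≤ F → ∀ n : ℕ,
        wsum (fun i => (i : ℝ) ^ (-θ)) (2 - s) f n ≤ D * F * predRateDecay r s θ n := by
      simp only [predRateDecay, ← hm, fTwo, if_neg hs1.ne, mul_one]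
      split_ifs with hθ
      · rw [le_div_iff₀ (by linarith)] at hθ
        refine exists_wsum_decay_le_of_bdd (ε₁ := (2 - s) * (1 - θ) - θ) (ε₂ := 0) hθ0.le hθ1.le
          (by linarith) ?_ (growthLE_of_ne (by linarith) le_rfl (by linarith)) (by linarith)
          (by linarith)
        rcases eq_or_ne (2 * θ) 1 with h | h
        · exact growthLE_of_pos (by nlinarith) (by nlinarith)
        · exact growthLE_of_ne h (by nlinarith) (by nlinarith)
      · rw [not_le, div_lt_iff₀ (by linarith)] at hθ
        refine exists_wsum_decay_le_of_bdd (ε₁ := 0) (ε₂ := 0) hθ0.le hθ1.le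
          (by linarith) (growthLE_of_ne ?_ le_rfl ?_)
          (growthLE_of_ne (by linarith) le_rfl (by linarith)) (by nlinarith)
          (by linarith)
        · nlinarith
        · nlinarith
    have hbias' : ∀ n : ℕ, gap (fun i => (i : ℝ) ^ (-θ)) 0 n ^ (-(2 * r)) ≤
        2 ^ (2 * r) * predRateDecay r s θ n := by
      intro n
      refine (hbias n).trans (mul_le_mul_of_nonneg_left ?_ (by positivity))
      simp only [predRateDecay, ← hm, fTwo, if_neg hs1.ne, mul_one]
      split_ifs with hθ
      · rw [le_div_iff₀ (by linarith)] at hθ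
        exact hpow n (by nlinarith)
      · exact hpow n (by nlinarith)
    obtain ⟨D, hD, hnoise⟩ := hnoise
    rcases lt_or_ge (s / (1 + s)) θ with hsθ | hsθ
    · obtain ⟨B, hB, hBk⟩ := exists_norm_bound_decay hs0 hs1 hθ1 hsθ hv hvs hvG hC
        (by linarith : 0 ≤ 2 * r - 1)
      refine ⟨C * (2 ^ (2 * r) + D * (1 + B)), by positivity,
        fun a k ha hk hE hP' hP n hn => (hP' n).trans ?_⟩
      rw [mul_assoc]
      refine mul_le_mul_of_nonneg_left ?_ hC.le
      have h1 := hnoise (1 + B) (fun t => 1 + k t) (fun t => by linarith [hBk k hk hE t])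
        (by linarith) n
      linarith [hbias' n]
    · -- bootstrap: a bounded error is of the order `n ^ (-θ / 2)`, and then of the order `n ^ (-θ)`
      have hθ2 : 2 * θ < 1 := by
        rw [le_div_iff₀ (by linarith)] at hsθ
        nlinarith
      have hrate : ∀ n, predRateDecay r s θ n = (n + 1 : ℝ) ^ (-θ) := by
        intro n
        simp only [predRateDecay, ← hm, fTwo, if_neg hs1.ne, mul_one]
        refine if_pos ?_
        rw [le_div_iff₀ (by linarith)]
        nlinarith
      simp only [hrate] at hnoise hbias' ⊢
      have hε : 0 < θ / 2 / (1 - θ) := div_pos (by linarith) (by linarith)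
      have hεθ : (1 - θ) * (θ / 2 / (1 - θ)) = θ / 2 :=
        mul_div_cancel₀ _ (by linarith : 1 - θ ≠ 0)
      obtain ⟨D₁, hD₁, h₁⟩ := exists_wsum_decay_le_of_bdd (v := 1) (ε₁ := 1 - 2 * θ)
        (ε₂ := θ / 2 / (1 - θ)) (β := θ / 2) hθ0.le hθ1.le zero_le_one
        (growthLE_of_pos (by linarith) (by linarith))
        (growthLE_of_pos hε (by linarith)) (by linarith) (by linarith)
      obtain ⟨D₂, hD₂, h₂⟩ := exists_wsum_decay_le_rpow (v := 1) (ε₁ := 1 - 2 * θ) (q := θ / 2)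
        (ε₂ := θ / 2 / (1 - θ)) (β := θ) hθ0.le hθ1.le zero_le_one (by linarith)
        (growthLE_of_pos (by linarith) (by linarith))
        (growthLE_of_pos hε (by linarith)) (by linarith) (by linarith)
      set B := C * (2 ^ (2 * r) + D₁ * A + D) with hB
      have hB0 : 0 ≤ B := by positivity
      have hhalf : ∀ a : ℕ → ℝ, (∀ n, 0 ≤ a n) →
          (∀ n, a n ≤ C * (gap (fun i => (i : ℝ) ^ (-θ)) 0 n ^ (-(2 * r)) +
          wsum (fun i => (i : ℝ) ^ (-θ)) 1 a n +
          wsum (fun i => (i : ℝ) ^ (-θ)) (2 - s) (fun _ => 1) n)) →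
          ∀ n, a n ≤ B * (n + 1 : ℝ) ^ (-(θ / 2)) := by
        intro a ha hP n
        refine (hP n).trans ?_
        rw [hB, mul_assoc]
        refine mul_le_mul_of_nonneg_left ?_ hC.le
        have e0 := hpow n (by linarith : θ / 2 ≤ θ)
        have e1 := (hbias' n).trans (mul_le_mul_of_nonneg_left e0 (by positivity))
        have e2 := h₁ A a (hAa a ha hP) hA n
        have e3 := (hnoise 1 (fun _ => 1) (fun _ => le_rfl) zero_le_one n).trans
          (mul_le_mul_of_nonneg_left e0 (by positivity))
        linarith
      refine ⟨C * (2 ^ (2 * r) + D₂ * B + D), by positivity,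
        fun a k ha hk _ _ hP n hn => (hP n).trans ?_⟩
      rw [mul_assoc]
      refine mul_le_mul_of_nonneg_left ?_ hC.le
      have e2 := h₂ B a (hhalf a ha hP) hB0 n
      have e3 := hnoise 1 (fun _ => 1) (fun _ => le_rfl) zero_le_one n
      linarith [hbias' n]

/-- The rate of the estimation error for decaying step sizes. -/
theorem exists_est_rate_decay {r s θ v C : ℝ} (hr : 1 / 2 < r) (hs0 : 0 ≤ s) (hs1 : s < 1)
    (hsθ : s / (1 + s) < θ) (hθ1 : θ < 1) (hv : 0 ≤ v) (hvs : 1 - s ≤ v) (hvG : GrowthLE v s)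
    (hC : 0 < C) :
    ∃ c : ℝ, 0 < c ∧ ∀ k : ℕ → ℝ, (∀ n, 0 ≤ k n) →
      (∀ n, k n ≤ C * (gap (fun i => (i : ℝ) ^ (-θ)) 0 n ^ (-(2 * r - 1)) +
        wsum (fun i => (i : ℝ) ^ (-θ)) v (fun t => 1 + k t) n)) →
      ∀ n : ℕ, 1 ≤ n → k n ≤ c * estRateDecay r s θ n := by
  have hθ0 : 0 < θ := lt_of_le_of_lt (by positivity) hsθ
  obtain ⟨B, hB, hBk⟩ := exists_norm_bound_decay hs0 hs1 hθ1 hsθ hv hvs hvG hC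
    (by linarith : 0 ≤ 2 * r - 1)
  have hbias : ∀ n : ℕ, gap (fun i => (i : ℝ) ^ (-θ)) 0 n ^ (-(2 * r - 1)) ≤
      2 ^ (2 * r - 1) * (n + 1 : ℝ) ^ (-((2 * r - 1) * (1 - θ))) := fun n =>
    gap_decay_rpow_le hθ0.le (by linarith) (by omega)
  have hN1 : ∀ n : ℕ, (1 : ℝ) ≤ n + 1 := fun n => by linarith [(n.cast_nonneg : (0 : ℝ) ≤ n)]
  have hpow : ∀ (n : ℕ) {x y : ℝ}, y ≤ x → (n + 1 : ℝ) ^ (-x) ≤ (n + 1 : ℝ) ^ (-y) :=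
    fun n x y h => Real.rpow_le_rpow_of_exponent_le (hN1 n) (by linarith)
  have hvd : (1 - s) * (1 - θ) ≤ v * (1 - θ) :=
    mul_le_mul_of_nonneg_right hvs (by linarith)
  have hlogge : ∀ n : ℕ, 1 ≤ n → 1 ≤ 3 * fThree θ n := by
    intro n hn
    have hN2 : (2 : ℝ) ≤ n + 1 := by
      have : (1 : ℝ) ≤ n := by exact_mod_cast hn
      linarith
    unfold fThree
    split_ifs
    · linarith [one_add_log_le hN2, Real.log_nonneg (hN1 n)]
    · norm_num
  have hnoise : ∃ D : ℝ, 0 < D ∧ ∀ n : ℕ, 1 ≤ n →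
      (n + 1 : ℝ) ^ (-(v * (1 - θ))) * growth (2 * θ) (n + 1) +
        (n + 1 : ℝ) ^ (-θ) * growth v ((n + 1 : ℝ) ^ (1 - θ)) ≤ D * estRateDecay r s θ n ∧
      (n + 1 : ℝ) ^ (-((2 * r - 1) * (1 - θ))) ≤ D * estRateDecay r s θ n := by
    obtain ⟨D, hD, hvD⟩ := hvG
    have hsec : ∀ n : ℕ, (n + 1 : ℝ) ^ (-θ) * growth v ((n + 1 : ℝ) ^ (1 - θ)) ≤
        D * (n + 1 : ℝ) ^ (-((1 + s) * θ - s)) := by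
      intro n
      have hN0 : (0 : ℝ) < n + 1 := by linarith [hN1 n]
      calc _ ≤ (n + 1 : ℝ) ^ (-θ) * (D * ((n + 1 : ℝ) ^ (1 - θ)) ^ s) := by
            gcongr
            exact hvD _ (Real.one_le_rpow (hN1 n) (by linarith))
        _ = D * ((n + 1 : ℝ) ^ (-θ) * (n + 1 : ℝ) ^ ((1 - θ) * s)) := by
            rw [← Real.rpow_mul hN0.le]
            ring
        _ = _ := by
            rw [← Real.rpow_add hN0]
            congr 2
            ring
    have hfst : ∀ n : ℕ, (n + 1 : ℝ) ^ (-(v * (1 - θ))) * growth (2 * θ) (n + 1) ≤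
        (n + 1 : ℝ) ^ (-((1 - s) * (1 - θ))) * growth (2 * θ) (n + 1) := fun n =>
      mul_le_mul_of_nonneg_right (hpow n hvd) (growth_nonneg _ (hN1 n))
    -- below `1/2` both parts of the noise have the same order
    have hfst' : θ < 1 / 2 → ∀ n : ℕ, (n + 1 : ℝ) ^ (-(v * (1 - θ))) * growth (2 * θ) (n + 1) ≤
        (n + 1 : ℝ) ^ (-((1 + s) * θ - s)) := by
      intro hθ n
      refine (hfst n).trans (le_of_eq ?_)
      rw [growth, if_pos (by linarith), ← Real.rpow_add (by linarith [hN1 n])]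
      congr 1
      ring
    have h2rs : 0 < 2 * r + s := by linarith
    by_cases hθ : θ ≤ min ((2 * r + s - 1) / (2 * r + s)) (1 / 2)
    · have hθa : θ * (2 * r + s) ≤ 2 * r + s - 1 :=
        (le_div_iff₀ h2rs).1 (hθ.trans (min_le_left _ _))
      have hθb : θ ≤ 1 / 2 := hθ.trans (min_le_right _ _)
      refine ⟨3 * D + 3, by positivity, fun n hn => ?_⟩
      have hl := hlogge n hn
      have hf : 0 ≤ fThree θ n := by linarith
      have hexp : s - (1 + s) * θ = -((1 + s) * θ - s) := by ring
      simp only [estRateDecay, if_pos hθ, hexp]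
      set R := (n + 1 : ℝ) ^ (-((1 + s) * θ - s)) with hR
      have hR0 : 0 ≤ R := Real.rpow_nonneg (by linarith [hN1 n]) _
      have hRf : R ≤ 3 * (R * fThree θ n) := by nlinarith
      have hRf0 : 0 ≤ R * fThree θ n := mul_nonneg hR0 hf
      constructor
      · have h1 : (n + 1 : ℝ) ^ (-(v * (1 - θ))) * growth (2 * θ) (n + 1) ≤
            3 * (R * fThree θ n) := by
          rcases hθb.eq_or_lt with h | h
          · refine (hfst n).trans ?_
            have hN2 : (2 : ℝ) ≤ n + 1 := by
              have : (1 : ℝ) ≤ n := by exact_mod_cast hn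
              linarith
            rw [growth, if_neg (by linarith), if_pos (by linarith), fThree, if_pos h, hR,
              show (1 + s) * θ - s = (1 - s) * (1 - θ) by rw [h]; ring, mul_left_comm 3]
            exact mul_le_mul_of_nonneg_left (one_add_log_le hN2)
              (Real.rpow_nonneg (by linarith [hN1 n]) _)
          · exact (hfst' h n).trans hRf
        have h2 := (hsec n).trans (mul_le_mul_of_nonneg_left hRf hD.le)
        linarith
      · refine (hpow n (by nlinarith : (1 + s) * θ - s ≤ (2 * r - 1) * (1 - θ))).trans ?_
        have : 0 ≤ D * (R * fThree θ n) := by positivity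
        linarith
    · have hθ' : (2 * r + s - 1 < θ * (2 * r + s)) ∨ 1 / 2 < θ := by
        by_contra! h
        exact hθ (le_min ((le_div_iff₀ h2rs).2 h.1) h.2)
      set m := min (2 * r - 1) (1 - s) with hm
      have hm1 : m ≤ 2 * r - 1 := min_le_left _ _
      have hm2 : m ≤ 1 - s := min_le_right _ _
      have hexp : m * (1 - θ) ≤ (1 + s) * θ - s := by
        rcases hθ' with h | h
        · nlinarith
        · nlinarith
      obtain ⟨D₁, hD₁, h₁⟩ : ∃ D : ℝ, 0 < D ∧ ∀ n : ℕ,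
          (n + 1 : ℝ) ^ (-(v * (1 - θ))) * growth (2 * θ) (n + 1) ≤
            D * (n + 1 : ℝ) ^ (-(m * (1 - θ))) := by
        have hGr : GrowthLE (2 * θ) ((1 - s - m) * (1 - θ)) := by
          rcases eq_or_ne (2 * θ) 1 with h | h
          · refine growthLE_of_pos ?_ (by nlinarith)
            refine mul_pos ?_ (by linarith)
            rcases hθ' with h' | h'
            · nlinarith
            · linarith
          · refine growthLE_of_ne h (mul_nonneg (by linarith) (by linarith)) ?_
            nlinarith
        obtain ⟨D', hD', h'⟩ := hGr
        refine ⟨D', hD', fun n => (hfst n).trans ?_⟩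
        have hN0 : (0 : ℝ) < n + 1 := by linarith [hN1 n]
        calc _ ≤ (n + 1 : ℝ) ^ (-((1 - s) * (1 - θ))) *
              (D' * (n + 1 : ℝ) ^ ((1 - s - m) * (1 - θ))) := by
              gcongr
              exact h' _ (hN1 n)
          _ = D' * ((n + 1 : ℝ) ^ (-((1 - s) * (1 - θ))) *
              (n + 1 : ℝ) ^ ((1 - s - m) * (1 - θ))) := by ring
          _ = _ := by
              rw [← Real.rpow_add hN0]
              congr 2
              ring
      refine ⟨D₁ + D + 1, by positivity, fun n hn => ?_⟩
      simp only [estRateDecay, if_neg hθ, ← hm]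
      have hR0 : 0 ≤ (n + 1 : ℝ) ^ (-(m * (1 - θ))) := Real.rpow_nonneg (by linarith [hN1 n]) _
      constructor
      · have := (hsec n).trans (mul_le_mul_of_nonneg_left (hpow n hexp) hD.le)
        linarith [h₁ n]
      · have := hpow n (by nlinarith : m * (1 - θ) ≤ (2 * r - 1) * (1 - θ))
        have h3 : 0 ≤ (D₁ + D) * (n + 1 : ℝ) ^ (-(m * (1 - θ))) := by positivity
        linarith
  obtain ⟨D, hD, hnoise⟩ := hnoise
  obtain ⟨D', hD', h⟩ := exists_wsum_decay_le (v := v) (q := 0) hθ0.le hθ1.le hv le_rfl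
  refine ⟨C * (2 ^ (2 * r - 1) * D + D' * (1 + B) * D), by positivity, fun k hk hE n hn =>
    (hE n).trans ?_⟩
  rw [mul_assoc]
  refine mul_le_mul_of_nonneg_left ?_ hC.le
  have h1 := h (1 + B) (fun t => 1 + k t) (fun t => by simpa using hBk k hk hE t) (by linarith) n
  simp only [add_zero] at h1
  obtain ⟨h2, h3⟩ := hnoise n hn
  have h4 := h1.trans (mul_le_mul_of_nonneg_left h2 (by positivity))
  have h5 := (hbias n).trans (mul_le_mul_of_nonneg_left h3 (by positivity))
  linarith

/-! ### Rates for constant step sizes -/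

theorem gap_const (a : ℝ) (m n : ℕ) : gap (fun _ => a) m n = 1 + a * ((n - m : ℕ) : ℝ) := by
  rw [gap, Finset.sum_const, Nat.card_Ico, nsmul_eq_mul, mul_comm]

theorem gap_const_rpow_le {θ q : ℝ} (hθ : 0 ≤ θ) (hq : 0 ≤ q) {T : ℕ} (hT : 1 ≤ T) :
    gap (fun _ => (T : ℝ) ^ (-θ)) 0 T ^ (-q) ≤ (T + 1 : ℝ) ^ (-(q * (1 - θ))) := by
  have hT0 : (0 : ℝ) < T := by exact_mod_cast hT
  have hN : (1 : ℝ) ≤ T + 1 := by linarith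
  have hN0 : (0 : ℝ) < T + 1 := by linarith
  have h1 : (T + 1 : ℝ) ^ (1 - θ) ≤ gap (fun _ => (T : ℝ) ^ (-θ)) 0 T := by
    rw [gap_const, Nat.sub_zero, sub_eq_add_neg, Real.rpow_add hN0, Real.rpow_one]
    have h2 : (T + 1 : ℝ) ^ (-θ) ≤ (T : ℝ) ^ (-θ) :=
      Real.rpow_le_rpow_of_nonpos hT0 (by linarith) (by linarith)
    have h3 : (T + 1 : ℝ) ^ (-θ) ≤ 1 := Real.rpow_le_one_of_one_le_of_nonpos hN (by linarith)
    nlinarith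
  refine (Real.rpow_le_rpow_of_nonpos (by positivity) h1 (by linarith)).trans (le_of_eq ?_)
  rw [← Real.rpow_mul hN0.le]
  congr 1
  ring

theorem rpow_neg_le_two_mul {θ : ℝ} (hθ : 0 ≤ θ) (hθ1 : θ ≤ 1) {T : ℕ} (hT : 1 ≤ T) :
    (T : ℝ) ^ (-θ) ≤ 2 * (T + 1 : ℝ) ^ (-θ) := by
  have hT1 : (1 : ℝ) ≤ T := by exact_mod_cast hT
  have h := Real.rpow_le_rpow_of_nonpos (by positivity) (by linarith : (T + 1 : ℝ) / 2 ≤ T)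
    (neg_nonpos.2 hθ)
  refine h.trans ?_
  rw [Real.div_rpow (by linarith) two_pos.le, Real.rpow_neg two_pos.le, div_inv_eq_mul, mul_comm]
  gcongr
  exact Real.rpow_le_self_of_one_le one_le_two hθ1

/-- The noise sum for the constant step size `T ^ (-θ)` up to the time `T`. -/
theorem exists_wsum_const_le {θ v : ℝ} (hθ : 0 ≤ θ) (hθ1 : θ ≤ 1) (hv : 0 ≤ v) :
    ∃ C : ℝ, 0 < C ∧ ∀ (T : ℕ), 1 ≤ T → ∀ (F : ℝ) (f : ℕ → ℝ) (n : ℕ), n ≤ T →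
      (∀ t < n, f t ≤ F) → 0 ≤ F →
      wsum (fun _ => (T : ℝ) ^ (-θ)) v f n ≤
      C * F * ((T + 1 : ℝ) ^ (-θ) * growth v ((T + 1 : ℝ) ^ (1 - θ))) := by
  obtain ⟨C₂, hC₂, h₂⟩ := sum_one_add_mul_rpow_le hv
  obtain ⟨C₃, hC₃, h₃⟩ := growth_two_mul_le v
  refine ⟨C₂ * C₃ * C₃ * 2, by positivity, fun T hT F f n hn hf hF => ?_⟩
  have hT1 : (1 : ℝ) ≤ T := by exact_mod_cast hT
  have hN : (1 : ℝ) ≤ T + 1 := by linarith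
  have hN0 : (0 : ℝ) < T + 1 := by linarith
  set a : ℝ := (T : ℝ) ^ (-θ) with ha
  have ha0 : 0 < a := by positivity
  have ha1 : a ≤ 1 := Real.rpow_le_one_of_one_le_of_nonpos hT1 (by linarith)
  have haN := rpow_neg_le_two_mul hθ hθ1 hT
  rw [← ha] at haN
  have hs := h₂ a ha0 ha1 n
  rw [← Finset.sum_range_reflect] at hs
  have hx1 : 1 ≤ (T + 1 : ℝ) ^ (1 - θ) := Real.one_le_rpow hN (by linarith)
  have hg : growth v (1 + a * n) ≤ C₃ * (C₃ * growth v ((T + 1 : ℝ) ^ (1 - θ))) := by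
    have h5 : 1 + a * n ≤ 2 * (2 * (T + 1 : ℝ) ^ (1 - θ)) := by
      have h6 : (n : ℝ) ≤ T := by exact_mod_cast hn
      have h7 : a * n ≤ 2 * (T + 1 : ℝ) ^ (1 - θ) := by
        calc a * n ≤ (2 * (T + 1 : ℝ) ^ (-θ)) * (T + 1) := by
              gcongr
              linarith
          _ = _ := by
              rw [sub_eq_add_neg, Real.rpow_add hN0, Real.rpow_one]
              ring
      linarith
    have h8 : 1 ≤ 1 + a * (n : ℝ) := by
      have : 0 ≤ a * (n : ℝ) := by positivity
      linarith
    refine (growth_mono v h8 h5).trans ((h₃ _ (by linarith)).trans ?_)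
    exact mul_le_mul_of_nonneg_left (h₃ _ hx1) hC₃.le
  have hgv := growth_nonneg v hx1
  calc wsum (fun _ => a) v f n
      ≤ ∑ t ∈ Finset.range n, a ^ 2 * F * (1 + a * ((n - 1 - t : ℕ) : ℝ)) ^ (-v) := by
        refine Finset.sum_le_sum fun t ht => ?_
        rw [gap_const, show n - (t + 1) = n - 1 - t by omega, mul_right_comm]
        have := hf t (Finset.mem_range.1 ht)
        gcongr
    _ = a ^ 2 * F * ∑ t ∈ Finset.range n, (1 + a * ((n - 1 - t : ℕ) : ℝ)) ^ (-v) := by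
        rw [Finset.mul_sum]
    _ ≤ a ^ 2 * F * (C₂ / a * (C₃ * (C₃ * growth v ((T + 1 : ℝ) ^ (1 - θ))))) := by
        gcongr
        exact hs.trans (mul_le_mul_of_nonneg_left hg (by positivity))
    _ = C₂ * C₃ * C₃ * F * (a * growth v ((T + 1 : ℝ) ^ (1 - θ))) := by
        field_simp
    _ ≤ C₂ * C₃ * C₃ * F * ((2 * (T + 1 : ℝ) ^ (-θ)) * growth v ((T + 1 : ℝ) ^ (1 - θ))) := by
        gcongr
    _ = _ := by ring

theorem exists_wsum_const_le_rpow {θ v ε β : ℝ} (hθ : 0 ≤ θ) (hθ1 : θ ≤ 1) (hv : 0 ≤ v)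
    (h : GrowthLE v ε) (hβ : β + (1 - θ) * ε ≤ θ) :
    ∃ C : ℝ, 0 < C ∧ ∀ (T : ℕ), 1 ≤ T → ∀ (F : ℝ) (f : ℕ → ℝ) (n : ℕ), n ≤ T →
      (∀ t < n, f t ≤ F) → 0 ≤ F →
      wsum (fun _ => (T : ℝ) ^ (-θ)) v f n ≤ C * F * (T + 1 : ℝ) ^ (-β) := by
  obtain ⟨C, hC, h₁⟩ := exists_wsum_const_le hθ hθ1 hv
  obtain ⟨D, hD, h₂⟩ := h
  refine ⟨C * D, by positivity, fun T hT F f n hn hf hF => (h₁ T hT F f n hn hf hF).trans ?_⟩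
  have hN : (1 : ℝ) ≤ T + 1 := by linarith [(T.cast_nonneg : (0 : ℝ) ≤ T)]
  have hN0 : (0 : ℝ) < T + 1 := by linarith
  calc _ ≤ C * F * ((T + 1 : ℝ) ^ (-θ) * (D * ((T + 1 : ℝ) ^ (1 - θ)) ^ ε)) := by
        gcongr
        exact h₂ _ (Real.one_le_rpow hN (by linarith))
    _ = C * D * F * (T + 1 : ℝ) ^ (-θ + (1 - θ) * ε) := by
        rw [Real.rpow_add hN0, Real.rpow_mul hN0.le]
        ring
    _ ≤ _ := by
        gcongr
        linarith

theorem rpow_neg_anti (T : ℕ) {x y : ℝ} (h : y ≤ x) :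
    (T + 1 : ℝ) ^ (-x) ≤ (T + 1 : ℝ) ^ (-y) :=
  Real.rpow_le_rpow_of_exponent_le (by linarith [(T.cast_nonneg : (0 : ℝ) ≤ T)]) (by linarith)

theorem rpow_neg_le_of_le {T n : ℕ} (h : n ≤ T) {β : ℝ} (hβ : 0 ≤ β) :
    (T + 1 : ℝ) ^ (-β) ≤ (n + 1 : ℝ) ^ (-β) := by
  have : (n : ℝ) ≤ T := by exact_mod_cast h
  exact Real.rpow_le_rpow_of_nonpos (by positivity) (by linarith) (by linarith)

/-- The norm of the error stays bounded up to the time `T`, uniformly in `T`, for `s / (1 + s) < θ`. -/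
theorem exists_norm_bound_const {s θ v C q : ℝ} (hs0 : 0 ≤ s) (hθ1 : θ < 1)
    (hsθ : s / (1 + s) < θ) (hv : 0 ≤ v) (hvG : GrowthLE v s) (hC : 0 < C) (hq : 0 ≤ q) :
    ∃ A : ℝ, 0 ≤ A ∧ ∀ (T : ℕ), 1 ≤ T → ∀ k : ℕ → ℝ, (∀ n, 0 ≤ k n) →
      (∀ n, k n ≤ C * (gap (fun _ => (T : ℝ) ^ (-θ)) 0 n ^ (-q) +
        wsum (fun _ => (T : ℝ) ^ (-θ)) v (fun t => 1 + k t) n)) → ∀ n ≤ T, k n ≤ A := by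
  have hθ0 : 0 < θ := lt_of_le_of_lt (by positivity) hsθ
  rw [div_lt_iff₀ (by linarith)] at hsθ
  have hδ : 0 < θ - (1 - θ) * s := by nlinarith
  obtain ⟨D, hD, h⟩ := exists_wsum_const_le_rpow (β := θ - (1 - θ) * s) hθ0.le
    hθ1.le hv hvG (by linarith)
  obtain ⟨A, hA, hb⟩ := exists_bound_of_wsum hC hD.le hδ v
  refine ⟨A, hA, fun T hT k hk hrec => ?_⟩
  have hw : ∀ i : ℕ, 0 ≤ (fun _ => (T : ℝ) ^ (-θ) : ℕ → ℝ) i := fun _ => by positivity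
  refine hb T _ k hw hk (fun n hn => ?_) (fun n _ => ?_)
  · have := h T hT 1 (fun _ => 1) n hn (fun _ _ => le_rfl) zero_le_one
    rw [mul_one] at this
    exact this.trans (mul_le_mul_of_nonneg_left (rpow_neg_le_of_le hn hδ.le) hD.le)
  · refine (hrec n).trans (mul_le_mul_of_nonneg_left ?_ hC.le)
    linarith [gap_rpow_le_one hw hq 0 n]

/-- The prediction error stays bounded up to the time `T`, uniformly in `T`. -/
theorem exists_pred_bound_const {θ C q u : ℝ} (hθ0 : 0 < θ) (hθ1 : θ < 1) (hu : 1 ≤ u) (hC : 0 < C)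
    (hq : 0 ≤ q) :
    ∃ A : ℝ, 0 ≤ A ∧ ∀ (T : ℕ), 1 ≤ T → ∀ a : ℕ → ℝ, (∀ n, 0 ≤ a n) →
      (∀ n, a n ≤ C * (gap (fun _ => (T : ℝ) ^ (-θ)) 0 n ^ (-q) +
        wsum (fun _ => (T : ℝ) ^ (-θ)) 1 a n +
        wsum (fun _ => (T : ℝ) ^ (-θ)) u (fun _ => 1) n)) → ∀ n ≤ T, a n ≤ A := by
  obtain ⟨D, hD, h⟩ := exists_wsum_const_le_rpow (v := 1) (β := θ / 2)
    (ε := θ / 2 / (1 - θ)) hθ0.le hθ1.le zero_le_one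
    (growthLE_of_pos (div_pos (by linarith) (by linarith)) (by
      have : 0 ≤ θ / 2 / (1 - θ) := div_nonneg (by linarith) (by linarith)
      linarith)) (by
      rw [mul_div_cancel₀ _ (by linarith : 1 - θ ≠ 0)]
      linarith)
  obtain ⟨A, hA, hb⟩ := exists_bound_of_wsum hC hD.le (half_pos hθ0) 1
  refine ⟨A, hA, fun T hT a ha hrec => ?_⟩
  have hw : ∀ i : ℕ, 0 ≤ (fun _ => (T : ℝ) ^ (-θ) : ℕ → ℝ) i := fun _ => by positivity
  refine hb T _ a hw ha (fun n hn => ?_) (fun n _ => ?_)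
  · have := h T hT 1 (fun _ => 1) n hn (fun _ _ => le_rfl) zero_le_one
    rw [mul_one] at this
    exact this.trans (mul_le_mul_of_nonneg_left (rpow_neg_le_of_le hn (half_pos hθ0).le) hD.le)
  · refine (hrec n).trans (mul_le_mul_of_nonneg_left ?_ hC.le)
    rw [wsum_add]
    linarith [gap_rpow_le_one hw hq 0 n,
      wsum_anti hw hu (f := fun _ => 1) (fun _ => zero_le_one) n]

/-- The rate of the estimation error for constant step sizes. -/
theorem exists_est_rate_const {r s θ v C : ℝ} (hr : 1 / 2 < r) (hs0 : 0 ≤ s)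
    (hsθ : s / (1 + s) < θ) (hθ1 : θ < 1) (hv : 0 ≤ v) (hvG : GrowthLE v s)
    (hC : 0 < C) :
    ∃ c : ℝ, 0 < c ∧ ∀ (T : ℕ), 1 ≤ T → ∀ k : ℕ → ℝ, (∀ n, 0 ≤ k n) →
      (∀ n, k n ≤ C * (gap (fun _ => (T : ℝ) ^ (-θ)) 0 n ^ (-(2 * r - 1)) +
        wsum (fun _ => (T : ℝ) ^ (-θ)) v (fun t => 1 + k t) n)) →
      k T ≤ c * estRateConst r s θ T := by
  have hθ0 : 0 < θ := lt_of_le_of_lt (by positivity) hsθ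
  obtain ⟨B, hB, hBk⟩ := exists_norm_bound_const hs0 hθ1 hsθ hv hvG hC
    (by linarith : 0 ≤ 2 * r - 1)
  obtain ⟨D, hD, h⟩ := exists_wsum_const_le_rpow (β := (1 + s) * θ - s) hθ0.le
    hθ1.le hv hvG (by linarith)
  refine ⟨C * (1 + D * (1 + B)), by positivity, fun T hT k hk hE => (hE T).trans ?_⟩
  rw [mul_assoc]
  refine mul_le_mul_of_nonneg_left ?_ hC.le
  have h1 := h T hT (1 + B) (fun t => 1 + k t) T le_rfl
    (fun t ht => by linarith [hBk T hT k hk hE t ht.le]) (by linarith)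
  have h2 := gap_const_rpow_le hθ0.le (by linarith : 0 ≤ 2 * r - 1) hT
  have h2rs : 0 < 2 * r + s := by linarith
  have hDB : 0 ≤ D * (1 + B) := by positivity
  unfold estRateConst
  split_ifs with hθ
  · rw [le_div_iff₀ h2rs] at hθ
    rw [show s - (1 + s) * θ = -((1 + s) * θ - s) by ring]
    have h3 := rpow_neg_anti T (by nlinarith : (1 + s) * θ - s ≤ (2 * r - 1) * (1 - θ))
    linarith
  · rw [not_le, div_lt_iff₀ h2rs] at hθ
    have h3 := rpow_neg_anti T (by nlinarith : (2 * r - 1) * (1 - θ) ≤ (1 + s) * θ - s)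
    have h4 := mul_le_mul_of_nonneg_left h3 hDB
    linarith

/-- The rate of the prediction error for constant step sizes. -/
theorem exists_pred_rate_const {r s θ v C : ℝ} (hr : 1 / 2 < r) (hs0 : 0 ≤ s) (hs1 : s ≤ 1)
    (hθ0 : 0 < θ) (hθ1 : θ < 1) (hv : 0 ≤ v) (hvG : GrowthLE v s) (hC : 0 < C) :
    ∃ c : ℝ, 0 < c ∧ ∀ (T : ℕ), 1 ≤ T → ∀ a k : ℕ → ℝ, (∀ n, 0 ≤ a n) → (∀ n, 0 ≤ k n) →
      (∀ n, k n ≤ C * (gap (fun _ => (T : ℝ) ^ (-θ)) 0 n ^ (-(2 * r - 1)) +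
        wsum (fun _ => (T : ℝ) ^ (-θ)) v (fun t => 1 + k t) n)) →
      (∀ n, a n ≤ C * (gap (fun _ => (T : ℝ) ^ (-θ)) 0 n ^ (-(2 * r)) +
        wsum (fun _ => (T : ℝ) ^ (-θ)) (2 - s) (fun t => 1 + k t) n)) →
      (∀ n, a n ≤ C * (gap (fun _ => (T : ℝ) ^ (-θ)) 0 n ^ (-(2 * r)) +
        wsum (fun _ => (T : ℝ) ^ (-θ)) 1 a n +
        wsum (fun _ => (T : ℝ) ^ (-θ)) (2 - s) (fun _ => 1) n)) →
      a T ≤ c * predRateConst r s θ T := by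
  have hw : ∀ (T : ℕ) (i : ℕ), 0 ≤ (fun _ => (T : ℝ) ^ (-θ) : ℕ → ℝ) i := fun _ _ => by positivity
  obtain ⟨A, hA, hAa⟩ := exists_pred_bound_const (u := 2 - s) hθ0 hθ1 (by linarith) hC
    (by linarith : 0 ≤ 2 * r)
  have h2r : 0 < 2 * r + 1 := by linarith
  have hbias : ∃ D : ℝ, 0 < D ∧ ∀ T : ℕ, 1 ≤ T → gap (fun _ => (T : ℝ) ^ (-θ)) 0 T ^ (-(2 * r)) ≤
      D * predRateConst r s θ T := by
    refine ⟨3, by norm_num, fun T hT => ?_⟩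
    refine (gap_const_rpow_le hθ0.le (by linarith : 0 ≤ 2 * r) hT).trans ?_
    unfold predRateConst fTwo
    have hN2 : (2 : ℝ) ≤ T + 1 := by
      have : (1 : ℝ) ≤ T := by exact_mod_cast hT
      linarith
    split_ifs with hθ hs
    · rw [le_div_iff₀ h2r] at hθ
      refine (rpow_neg_anti T (by linarith : θ ≤ 2 * r * (1 - θ))).trans ?_
      rw [mul_left_comm]
      refine le_mul_of_one_le_right (by positivity) ?_
      linarith [one_add_log_le hN2, Real.log_nonneg (by linarith : (1 : ℝ) ≤ T + 1)]
    · rw [le_div_iff₀ h2r] at hθ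
      refine (rpow_neg_anti T (by linarith : θ ≤ 2 * r * (1 - θ))).trans ?_
      have : (0 : ℝ) ≤ (T + 1 : ℝ) ^ (-θ) := by positivity
      linarith
    · have : (0 : ℝ) ≤ (T + 1 : ℝ) ^ (-(2 * r * (1 - θ))) := by positivity
      linarith
  have hnoise : ∃ D : ℝ, 0 < D ∧ ∀ (T : ℕ), 1 ≤ T → ∀ (F : ℝ) (f : ℕ → ℝ), (∀ t < T, f t ≤ F) →
      0 ≤ F → wsum (fun _ => (T : ℝ) ^ (-θ)) (2 - s) f T ≤ D * F * predRateConst r s θ T := by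
    unfold predRateConst fTwo
    by_cases hθ : θ ≤ 2 * r / (2 * r + 1)
    · simp only [if_pos hθ]
      rcases hs1.eq_or_lt with rfl | hs
      · obtain ⟨D, hD, h⟩ := exists_wsum_const_le (v := 2 - 1) hθ0.le hθ1.le (by norm_num)
        refine ⟨D * 3, by positivity, fun T hT F f hf hF =>
          (h T hT F f T le_rfl hf hF).trans ?_⟩
        have hN2 : (2 : ℝ) ≤ T + 1 := by
          have : (1 : ℝ) ≤ T := by exact_mod_cast hT
          linarith
        have hl0 : 0 ≤ Real.log (T + 1 : ℝ) := Real.log_nonneg (by linarith)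
        have hg : growth (2 - 1) ((T + 1 : ℝ) ^ (1 - θ)) ≤ 3 * Real.log (T + 1) := by
          rw [growth, if_neg (by norm_num), if_pos (by norm_num), Real.log_rpow (by linarith)]
          nlinarith [one_add_log_le hN2]
        rw [if_pos rfl]
        calc _ ≤ D * F * ((T + 1 : ℝ) ^ (-θ) * (3 * Real.log (T + 1))) := by gcongr
          _ = _ := by ring
      · obtain ⟨D, hD, h⟩ := exists_wsum_const_le_rpow (v := 2 - s) (ε := 0) (β := θ) hθ0.le hθ1.le
          (by linarith) (growthLE_of_ne (by linarith) le_rfl (by linarith)) (by linarith)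
        simp only [if_neg hs.ne, mul_one]
        exact ⟨D, hD, fun T hT F f hf hF => h T hT F f T le_rfl hf hF⟩
    · simp only [if_neg hθ]
      rw [not_le, div_lt_iff₀ h2r] at hθ
      have hpos : 0 < (θ - 2 * r * (1 - θ)) / (1 - θ) := div_pos (by linarith) (by linarith)
      obtain ⟨D, hD, h⟩ := exists_wsum_const_le_rpow (v := 2 - s)
        (ε := (θ - 2 * r * (1 - θ)) / (1 - θ)) (β := 2 * r * (1 - θ)) hθ0.le hθ1.le
        (by linarith) (growthLE_of_pos hpos (by linarith)) (by
          rw [mul_div_cancel₀ _ (by linarith : 1 - θ ≠ 0)]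
          linarith)
      exact ⟨D, hD, fun T hT F f hf hF => h T hT F f T le_rfl hf hF⟩
  obtain ⟨D₀, hD₀, hbias⟩ := hbias
  obtain ⟨D, hD, hnoise⟩ := hnoise
  rcases lt_or_ge (s / (1 + s)) θ with hsθ | hsθ
  · obtain ⟨B, hB, hBk⟩ := exists_norm_bound_const hs0 hθ1 hsθ hv hvG hC
      (by linarith : 0 ≤ 2 * r - 1)
    refine ⟨C * (D₀ + D * (1 + B)), by positivity,
      fun T hT a k ha hk hE hP' _ => (hP' T).trans ?_⟩
    rw [mul_assoc]
    refine mul_le_mul_of_nonneg_left ?_ hC.le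
    have h1 := hnoise T hT (1 + B) (fun t => 1 + k t)
      (fun t ht => by linarith [hBk T hT k hk hE t ht.le]) (by linarith)
    linarith [hbias T hT]
  rcases hs1.eq_or_lt with rfl | hs
  · refine ⟨C * (D₀ + D * (1 + A)), by positivity,
      fun T hT a k ha hk _ _ hP => (hP T).trans ?_⟩
    rw [mul_assoc]
    refine mul_le_mul_of_nonneg_left ?_ hC.le
    have h1 := hnoise T hT (1 + A) (fun t => a t + 1)
      (fun t ht => by linarith [hAa T hT a ha hP t ht.le]) (by linarith)
    rw [wsum_add] at h1
    have h2 : wsum (fun _ => (T : ℝ) ^ (-θ)) 1 a T = wsum (fun _ => (T : ℝ) ^ (-θ)) (2 - 1) a T := by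
      norm_num
    linarith [hbias T hT]
  · -- bootstrap: up to the time `T` the error is at most the bias plus `T ^ (-3 θ / 4)`
    have hθ2 : 2 * θ < 1 := by
      rw [le_div_iff₀ (by linarith)] at hsθ
      nlinarith
    have hrate : ∀ T, predRateConst r s θ T = (T + 1 : ℝ) ^ (-θ) := by
      intro T
      simp only [predRateConst, fTwo, if_neg hs.ne, mul_one]
      refine if_pos ?_
      rw [le_div_iff₀ h2r]
      nlinarith
    simp only [hrate] at hnoise hbias ⊢
    obtain ⟨D₁, hD₁, h₁⟩ := exists_wsum_const_le_rpow (v := 1) (β := 3 * θ / 4)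
      (ε := θ / 4 / (1 - θ)) hθ0.le hθ1.le zero_le_one
      (growthLE_of_pos (div_pos (by linarith) (by linarith)) (by
        have : 0 ≤ θ / 4 / (1 - θ) := div_nonneg (by linarith) (by linarith)
        linarith)) (by
        rw [mul_div_cancel₀ _ (by linarith : 1 - θ ≠ 0)]
        linarith)
    obtain ⟨D₂, hD₂, h₂⟩ := sum_one_add_mul_rpow_le (by linarith : 0 ≤ 2 * r)
    refine ⟨C * (D₀ + (C * (D₂ * 2) + D₁ * (C * (D₁ * (1 + A)))) + D), by positivity,
      fun T hT a k ha hk _ _ hP => (hP T).trans ?_⟩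
    rw [mul_assoc]
    refine mul_le_mul_of_nonneg_left ?_ hC.le
    have hT1 : (1 : ℝ) ≤ T := by exact_mod_cast hT
    have hN0 : (0 : ℝ) < T + 1 := by linarith
    set b : ℝ := (T : ℝ) ^ (-θ) with hb
    have hb0 : 0 < b := by positivity
    have hb1 : b ≤ 1 := Real.rpow_le_one_of_one_le_of_nonpos hT1 (by linarith)
    set F := C * (D₁ * (1 + A)) * (T + 1 : ℝ) ^ (-(3 * θ / 4)) with hF
    have hF0 : 0 ≤ F := by positivity
    have hw' : ∀ i : ℕ, 0 ≤ (fun _ => b : ℕ → ℝ) i := fun _ => hb0.le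
    have hstep : ∀ t ≤ T, a t ≤ C * gap (fun _ => b) 0 t ^ (-(2 * r)) + F := by
      intro t ht
      refine (hP t).trans ?_
      have e1 := h₁ T hT (1 + A) (fun t => a t + 1) t ht
        (fun i hi => by linarith [hAa T hT a ha hP i (hi.le.trans ht)]) (by linarith)
      rw [← hb, wsum_add] at e1
      have e2 := wsum_anti hw' (by linarith : (1 : ℝ) ≤ 2 - s) (f := fun _ => 1)
        (fun _ => zero_le_one) t
      have e3 := mul_le_mul_of_nonneg_left (e1.trans' (add_le_add_right e2 _)) hC.le
      rw [hF]
      linarith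
    have e1 : wsum (fun _ => b) 1 a T ≤
        wsum (fun _ => b) 1 (fun t => C * gap (fun _ => b) 0 t ^ (-(2 * r)) + F) T :=
      Finset.sum_le_sum fun t ht => mul_le_mul_of_nonneg_left
        (hstep t (Finset.mem_range.1 ht).le)
        (mul_nonneg (sq_nonneg _) (gap_rpow_nonneg hw' _ _ _))
    rw [wsum_add] at e1
    have e2 : wsum (fun _ => b) 1 (fun _ => F) T ≤
        D₁ * (C * (D₁ * (1 + A))) * (T + 1 : ℝ) ^ (-θ) := by
      refine (h₁ T hT F (fun _ => F) T le_rfl (fun _ _ => le_rfl) hF0).trans ?_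
      have e3 : (T + 1 : ℝ) ^ (-(3 * θ / 4)) * (T + 1 : ℝ) ^ (-(3 * θ / 4)) ≤
          (T + 1 : ℝ) ^ (-θ) := by
        rw [← Real.rpow_add hN0, ← neg_add]
        exact rpow_neg_anti T (by linarith)
      calc _ = D₁ * (C * (D₁ * (1 + A))) *
            ((T + 1 : ℝ) ^ (-(3 * θ / 4)) * (T + 1 : ℝ) ^ (-(3 * θ / 4))) := by rw [hF]; ring
        _ ≤ _ := by gcongr
    have e4 : wsum (fun _ => b) 1 (fun t => C * gap (fun _ => b) 0 t ^ (-(2 * r))) T ≤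
        C * (D₂ * 2) * (T + 1 : ℝ) ^ (-θ) := by
      have e5 := h₂ b hb0 hb1 T
      rw [growth, if_neg (by linarith), if_neg (by linarith), mul_one] at e5
      calc _ ≤ ∑ t ∈ Finset.range T, b ^ 2 * C * (1 + b * (t : ℝ)) ^ (-(2 * r)) := by
            refine Finset.sum_le_sum fun t _ => ?_
            have e6 := gap_rpow_le_one hw' zero_le_one (t + 1) T
            have e7 : 0 ≤ (1 + b * (t : ℝ)) ^ (-(2 * r)) := by positivity
            beta_reduce
            rw [gap_const b 0 t, Nat.sub_zero, ← mul_assoc, mul_right_comm (b ^ 2)]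
            exact mul_le_mul_of_nonneg_right (mul_le_of_le_one_right (by positivity) e6) e7
        _ = b ^ 2 * C * ∑ t ∈ Finset.range T, (1 + b * (t : ℝ)) ^ (-(2 * r)) := by
            rw [Finset.mul_sum]
        _ ≤ b ^ 2 * C * (D₂ / b) := by gcongr
        _ = C * D₂ * b := by field_simp
        _ ≤ C * D₂ * (2 * (T + 1 : ℝ) ^ (-θ)) := by
            gcongr
            exact rpow_neg_le_two_mul hθ0.le hθ1.le hT
        _ = _ := by ring
    have e5 := hnoise T hT 1 (fun _ => 1) (fun _ _ => le_rfl) zero_le_one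
    have e6 := hbias T hT
    rw [← hb] at e5 e6
    linarith

/-! ### Passage to the expectations of the theorem -/

theorem expectationLE_norm_sq {Ω F : Type*} [MeasurableSpace Ω] {P : Measure Ω}
    [NormedAddCommGroup F] {f : Ω → F} (hf : AEStronglyMeasurable f P) {b B : ℝ} (hb : 0 ≤ b)
    (h : ∫⁻ ω, ‖f ω‖ₑ ^ 2 ∂P = ENNReal.ofReal b) (hB : b ≤ B) :
    ExpectationLE P (fun ω => ‖f ω‖ ^ 2) B := by
  simp_rw [enorm_sq_eq_ofReal] at h
  have hm : AEStronglyMeasurable (fun ω => ‖f ω‖ ^ 2) P := hf.norm.pow 2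
  have h0 : 0 ≤ᵐ[P] fun ω => ‖f ω‖ ^ 2 := Eventually.of_forall fun ω => sq_nonneg _
  refine ⟨⟨hm, ?_⟩, ?_⟩
  · rw [hasFiniteIntegral_iff_ofReal h0, h]
    exact ENNReal.ofReal_lt_top
  · rw [integral_eq_lintegral_of_nonneg_ae h0 hm, h, ENNReal.toReal_ofReal hb]
    exact hB

theorem mul_norm_le_one_of_ofReal_lt {F : Type*} [NormedAddCommGroup F] {x : F} {e : ℝ}
    (he : 0 ≤ e) (h : ENNReal.ofReal e < ‖x‖ₑ⁻¹) : e * ‖x‖ ≤ 1 := by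
  have h1 := ENNReal.le_inv_iff_mul_le.1 h.le
  rwa [← ofReal_norm, ← ENNReal.ofReal_mul he, ENNReal.ofReal_le_one] at h1

theorem decay_le_one {θ : ℝ} (hθ : 0 < θ) (i : ℕ) : (i : ℝ) ^ (-θ) ≤ 1 := by
  rcases Nat.eq_zero_or_pos i with rfl | hi
  · rw [Nat.cast_zero, Real.zero_rpow (by linarith)]
    exact zero_le_one
  · exact Real.rpow_le_one_of_one_le_of_nonpos (by exact_mod_cast hi) (by linarith)

/-- Continuous functions that agree almost everywhere agree, as the measure has full support. -/
theorem injective_embedding {𝕜 : Type*} [RCLike 𝕜] {X Y : Type*}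
    [NormedAddCommGroup Y] [InnerProductSpace 𝕜 Y] [CompleteSpace Y]
    {H : Type*} [NormedAddCommGroup H] [InnerProductSpace 𝕜 H] [CompleteSpace H]
    [RKHS 𝕜 H X Y] [TopologicalSpace X] {κ : ℝ} [SecondCountableTopology Y]
    [MeasurableSpace X] [BorelSpace X] (μ : Measure X) [IsFiniteMeasure μ] [μ.IsOpenPosMeasure]
    (hK : IsBoundedMercer (X := X) (Y := Y) H κ) : Function.Injective (embedding μ hK) := by
  intro f g hfg
  have h1 : (f : X → Y) =ᵐ[μ] g := by
    refine (embedding_ae_eq μ hK f).symm.trans ?_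
    rw [hfg]
    exact embedding_ae_eq μ hK g
  exact DFunLike.coe_injective (((hK.continuous f).ae_eq_iff_eq μ (hK.continuous g)).1 h1)

end OpLearn

theorem theorem3
    {𝕜 : Type*} [RCLike 𝕜]
    -- the Polish input space and the separable Hilbert output space
    {X : Type*} [TopologicalSpace X] [PolishSpace X] [MeasurableSpace X] [BorelSpace X]
    {Y : Type*} [NormedAddCommGroup Y] [InnerProductSpace 𝕜 Y] [NormedSpace ℝ Y] [CompleteSpace Y]
    [SecondCountableTopology Y] [MeasurableSpace Y] [BorelSpace Y]
    -- the reproducing kernel Hilbert space `H` of the kernel `K = kernel H`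
    {H : Type*} [NormedAddCommGroup H] [InnerProductSpace 𝕜 H] [CompleteSpace H] [RKHS 𝕜 H X Y]
    {κ : ℝ} (hK : IsBoundedMercer (X := X) (Y := Y) H κ)
    -- the distribution of `(x, y)`, whose marginal on `X` has full support
    (ρ : Measure (X × Y)) [IsProbabilityMeasure ρ] [ρ.fst.IsOpenPosMeasure]
    -- conditional noise variance
    (σ : ℝ) (hσ : 0 < σ ^ 2) (hnoise : CondNoiseBounded ρ σ)
    -- source condition
    (r : ℝ) (hr : 1 / 2 < r) (g : Lp Y 2 ρ.fst)
    (hsource : regression ρ =ᵐ[ρ.fst] opPow (integralOperator ρ.fst hK) r g)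
    -- capacity condition
    (s : ℝ) (hs0 : 0 ≤ s) (hs1 : s ≤ 1)
    (htrace : opTrace (opPow (integralOperator ρ.fst hK) s) < ⊤) :
    -- all risks are finite
    (Integrable (fun z => ‖regression ρ z.1 - z.2‖ ^ 2) ρ ∧
      ∀ h : H, Integrable (fun z => ‖h z.1 - z.2‖ ^ 2) ρ) ∧
    -- the regression operator is represented by a member `hd` of `H`
    ∃ hd : H, (hd : X → Y) =ᵐ[ρ.fst] regression ρ ∧
      -- (1) decaying step sizes
      (∀ θ : ℝ, 0 < θ → θ < 1 → ∃ c₃ : ℝ, 0 < c₃ ∧ ∀ T : ℕ, 1 ≤ T → ∀ η₁ : ℝ, 0 < η₁ →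
        ENNReal.ofReal η₁ < min (min ‖integralOperator ρ.fst hK‖ₑ⁻¹ (ENNReal.ofReal (1 - θ)))
          (gammaTwo κ s θ (opTrace (opPow (integralOperator ρ.fst hK) s))) →
        ExpectationLE (Measure.pi fun _ : Fin T => ρ)
          (fun z => risk ρ (sgd (H := H) (fun t => η₁ * (t : ℝ) ^ (-θ)) T z) -
            risk ρ (regression ρ))
          (c₃ * η₁ ^ (-(2 * r)) * predRateDecay r s θ T) ∧
        (s < 1 → s / (1 + s) < θ →
          ExpectationLE (Measure.pi fun _ : Fin T => ρ)
            (fun z => ‖sgd (H := H) (fun t => η₁ * (t : ℝ) ^ (-θ)) T z - hd‖ ^ 2)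
            (c₃ * η₁ ^ (-(2 * r - 1)) * estRateDecay r s θ T))) ∧
      -- (2) constant step sizes
      (∀ θ' : ℝ, 0 < θ' → θ' < 1 → ∃ c₃' : ℝ, 0 < c₃' ∧ ∀ T : ℕ, 1 ≤ T → ∀ η : ℝ, 0 < η →
        ENNReal.ofReal η < min (min ‖integralOperator ρ.fst hK‖ₑ⁻¹ 1)
          (gammaTwo' κ s (opTrace (opPow (integralOperator ρ.fst hK) s))) →
        ExpectationLE (Measure.pi fun _ : Fin T => ρ)
          (fun z => risk ρ (sgd (H := H) (fun _ => η * (T : ℝ) ^ (-θ')) T z) -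
            risk ρ (regression ρ))
          (c₃' * η ^ (-(2 * r)) * predRateConst r s θ' T) ∧
        (s / (1 + s) < θ' →
          ExpectationLE (Measure.pi fun _ : Fin T => ρ)
            (fun z => ‖sgd (H := H) (fun _ => η * (T : ℝ) ^ (-θ')) T z - hd‖ ^ 2)
            (c₃' * η ^ (-(2 * r - 1)) * estRateConst r s θ' T))) := by
  obtain ⟨J, ⟨S⟩⟩ := exists_eigenSystem (injective_embedding ρ.fst hK) hs0 hs1 htrace
  have htr := S.tsum_eig_rpow_lt_top hs0 htrace
  have : Countable J :=
    countable_of_tsum_lt_top (fun j => Real.rpow_pos_of_pos (S.eig_pos j) s) htr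
  have := secondCountable_of_hilbertBasis S.basis
  obtain ⟨hd, hdg, hdj⟩ := S.exists_preimage_opPow hr g
  have hhd : (hd : X → Y) =ᵐ[ρ.fst] regression ρ := by
    refine (embedding_ae_eq ρ.fst hK hd).symm.trans ?_
    rw [hdg]
    exact hsource.symm
  have hQs := S.tsum_enorm_inner_vec_sq_lt_top g
  have hQ : ∀ j, ‖⟪S.basis j, hd⟫_𝕜‖ₑ ^ 2 ≤
      ENNReal.ofReal (S.eig j ^ (2 * r - 1)) * ‖⟪S.vec j, g⟫_𝕜‖ₑ ^ 2 := by
    intro j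
    have hl := S.eig_pos j
    rw [hdj, enorm_mul, mul_pow, enorm_sq_eq_ofReal ((S.eig j ^ (r - 1 / 2) : ℝ) : 𝕜),
      RCLike.norm_ofReal, sq_abs, ← Real.rpow_natCast, ← Real.rpow_mul hl.le]
    refine le_of_eq ?_
    congr 3
    push_cast
    ring
  -- the exponent `v` of the estimation error may be taken above `1` if there are finitely many
  -- eigenvalues, which is the case if `s = 0`
  obtain ⟨v, hv0, hv2, hvs, hvG, hWv⟩ : ∃ v : ℝ, 0 ≤ v ∧ v ≤ 2 ∧ 1 - s ≤ v ∧ GrowthLE v s ∧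
      ∑' j, ENNReal.ofReal (S.eig j ^ (1 - v)) < ⊤ := by
    rcases hs0.eq_or_lt with rfl | hs
    · exact ⟨2, by norm_num, le_rfl, by norm_num,
        growthLE_of_ne (by norm_num) le_rfl (by norm_num), tsum_rpow_lt_top_of_zero htr _⟩
    · refine ⟨1 - s, by linarith, by linarith, le_rfl,
        growthLE_of_ne (by linarith) hs0 (by linarith), ?_⟩
      rwa [sub_sub_cancel]
  obtain ⟨C, hC, hbound⟩ := exists_scaled_error_bounds hK S hnoise hhd S.eig_le hr hQs hQ
    (tsum_rpow_lt_top_of_le S.eig_pos S.eig_le hs1 htr) (u := 2 - s) (by linarith) (by linarith)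
    hv0 hv2 (by rwa [sub_sub_cancel]) hWv
  have hsgd : ∀ (η : ℕ → ℝ) (T : ℕ), StronglyMeasurable
      fun z : Fin T → X × Y => sgd (𝕜 := 𝕜) (H := H) η T z - hd := fun η T =>
    (stronglyMeasurable_sgd hK η T).sub stronglyMeasurable_const
  -- the rescaled errors `a` and `k` give the two expectations
  have hpred : ∀ {e a c R : ℝ} {η : ℕ → ℝ} {T : ℕ}, 0 < e → 0 ≤ a → a ≤ c * R →
      predErr (ρ := ρ) hK hd η T = ENNReal.ofReal (e ^ (-(2 * r)) * a) →
      ExpectationLE (Measure.pi fun _ : Fin T => ρ)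
        (fun z => risk ρ (sgd (𝕜 := 𝕜) (H := H) η T z) - risk ρ (regression ρ))
        (c * e ^ (-(2 * r)) * R) := by
    intro e a c R η T he ha haR h
    have hpos := Real.rpow_pos_of_pos he (-(2 * r))
    simp_rw [risk_sub_risk hK hnoise hhd]
    refine expectationLE_norm_sq
      ((embedding ρ.fst hK).continuous.comp_stronglyMeasurable (hsgd η T)).aestronglyMeasurable
      (mul_nonneg hpos.le ha) h ?_
    rw [mul_comm c, mul_assoc]
    exact mul_le_mul_of_nonneg_left haR hpos.le
  have hest : ∀ {e k c R : ℝ} {η : ℕ → ℝ} {T : ℕ}, 0 < e → 0 ≤ k → k ≤ c * R →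
      normErr (𝕜 := 𝕜) hd η ρ T = ENNReal.ofReal (e ^ (-(2 * r - 1)) * k) →
      ExpectationLE (Measure.pi fun _ : Fin T => ρ)
        (fun z => ‖sgd (𝕜 := 𝕜) (H := H) η T z - hd‖ ^ 2) (c * e ^ (-(2 * r - 1)) * R) := by
    intro e k c R η T he hk hkR h
    have hpos := Real.rpow_pos_of_pos he (-(2 * r - 1))
    refine expectationLE_norm_sq (hsgd η T).aestronglyMeasurable (mul_nonneg hpos.le hk) h ?_
    rw [mul_comm c, mul_assoc]
    exact mul_le_mul_of_nonneg_left hkR hpos.le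
  have hstep : ∀ {e x : ℝ}, 0 < e → ENNReal.ofReal e < ‖integralOperator ρ.fst hK‖ₑ⁻¹ →
      0 ≤ x → x ≤ 1 → e * x * ‖integralOperator ρ.fst hK‖ ≤ 1 := by
    intro e x he h hx hx1
    have h1 := mul_norm_le_one_of_ofReal_lt he.le h
    rw [mul_right_comm]
    exact mul_le_one₀ h1 hx hx1
  refine ⟨⟨?_, integrable_risk hK hnoise hhd⟩, hd, hhd, fun θ hθ0 hθ1 => ?_, fun θ hθ0 hθ1 => ?_⟩
  · refine (integrable_risk hK hnoise hhd hd).congr ?_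
    filter_upwards [regression_ae_eq hK hhd] with z hz
    rw [hz]
  · obtain ⟨c₁, hc₁, h₁⟩ := exists_pred_rate_decay hr hs0 hs1 hθ0 hθ1 hv0 hvs hvG hC
    have h₂ : ∃ c : ℝ, 0 < c ∧ (s < 1 → s / (1 + s) < θ → ∀ k : ℕ → ℝ, (∀ n, 0 ≤ k n) →
        (∀ n, k n ≤ C * (gap (fun i => (i : ℝ) ^ (-θ)) 0 n ^ (-(2 * r - 1)) +
          wsum (fun i => (i : ℝ) ^ (-θ)) v (fun t => 1 + k t) n)) →
        ∀ n : ℕ, 1 ≤ n → k n ≤ c * estRateDecay r s θ n) := by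
      by_cases h : s < 1 ∧ s / (1 + s) < θ
      · obtain ⟨c, hc, hk⟩ := exists_est_rate_decay hr hs0 h.1 h.2 hθ1 hv0 hvs hvG hC
        exact ⟨c, hc, fun _ _ => hk⟩
      · exact ⟨1, one_pos, fun h1 h2 => absurd ⟨h1, h2⟩ h⟩
    obtain ⟨c₂, hc₂, h₂⟩ := h₂
    refine ⟨max c₁ c₂, lt_max_of_lt_left hc₁, fun T hT e he hlt => ?_⟩
    rw [lt_min_iff, lt_min_iff] at hlt
    have he1 : e ≤ 1 := by
      have := ((ENNReal.ofReal_lt_ofReal_iff (by linarith)).1 hlt.1.2).le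
      linarith
    obtain ⟨a, k, ha, hk, hpa, hnk, hE, hP', hP⟩ := hbound e he he1 (fun i => (i : ℝ) ^ (-θ))
      (decay_nonneg θ) fun i => hstep he hlt.1.1 (decay_nonneg θ i) (decay_le_one hθ0 i)
    have hN1 : (1 : ℝ) ≤ T + 1 := by linarith [(T.cast_nonneg : (0 : ℝ) ≤ T)]
    have hlog := Real.log_nonneg hN1
    refine ⟨hpred he (ha T) ((h₁ a k ha hk hE hP' hP T hT).trans ?_) (hpa T), fun hs hsθ =>
      hest he (hk T) ((h₂ hs hsθ k hk hE T hT).trans ?_) (hnk T)⟩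
    · refine mul_le_mul_of_nonneg_right (le_max_left _ _) ?_
      unfold predRateDecay fTwo
      split_ifs <;> positivity
    · refine mul_le_mul_of_nonneg_right (le_max_right _ _) ?_
      unfold estRateDecay fThree
      split_ifs <;> positivity
  · obtain ⟨c₁, hc₁, h₁⟩ := exists_pred_rate_const hr hs0 hs1 hθ0 hθ1 hv0 hvG hC
    have h₂ : ∃ c : ℝ, 0 < c ∧ (s / (1 + s) < θ → ∀ (T : ℕ), 1 ≤ T → ∀ k : ℕ → ℝ,
        (∀ n, 0 ≤ k n) → (∀ n, k n ≤ C * (gap (fun _ => (T : ℝ) ^ (-θ)) 0 n ^ (-(2 * r - 1)) +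
          wsum (fun _ => (T : ℝ) ^ (-θ)) v (fun t => 1 + k t) n)) →
        k T ≤ c * estRateConst r s θ T) := by
      by_cases h : s / (1 + s) < θ
      · obtain ⟨c, hc, hk⟩ := exists_est_rate_const hr hs0 h hθ1 hv0 hvG hC
        exact ⟨c, hc, fun _ => hk⟩
      · exact ⟨1, one_pos, fun h' => absurd h' h⟩
    obtain ⟨c₂, hc₂, h₂⟩ := h₂
    refine ⟨max c₁ c₂, lt_max_of_lt_left hc₁, fun T hT e he hlt => ?_⟩
    rw [lt_min_iff, lt_min_iff] at hlt
    have he1 : e ≤ 1 := ENNReal.ofReal_le_one.1 hlt.1.2.le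
    obtain ⟨a, k, ha, hk, hpa, hnk, hE, hP', hP⟩ := hbound e he he1 (fun _ => (T : ℝ) ^ (-θ))
      (fun _ => decay_nonneg θ T) fun _ => hstep he hlt.1.1 (decay_nonneg θ T) (decay_le_one hθ0 T)
    have hN1 : (1 : ℝ) ≤ T + 1 := by linarith [(T.cast_nonneg : (0 : ℝ) ≤ T)]
    have hlog := Real.log_nonneg hN1
    refine ⟨hpred he (ha T) ((h₁ T hT a k ha hk hE hP' hP).trans ?_) (hpa T), fun hsθ =>
      hest he (hk T) ((h₂ hsθ T hT k hk hE).trans ?_) (hnk T)⟩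
    · refine mul_le_mul_of_nonneg_right (le_max_left _ _) ?_
      unfold predRateConst fTwo
      split_ifs <;> positivity
    · refine mul_le_mul_of_nonneg_right (le_max_right _ _) ?_
      unfold estRateConst
      split_ifs <;> positivity
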